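/- Let $-3<\gamma<0$, let $C_b>0$, and let $b$ be a measurable angular function satisfying the Grad cutoff assumption $0<b(\vartheta)\le C_b\cos\vartheta$ for $0\le\vartheta<\pi/2$. Let $M(v)=(2\pi)^{-3/2}e^{-|v|^2/2}$ and $\langle v\rangle^s=(1+|v|^2)^{s/2}$. For $v,u\in\mathbb R^3$ and $\omega\in\mathbb S^2$ put $v'=v-[(v-u)\cdot\omega]\omega$, $u'=u+[(v-u)\cdot\omega]\omega$ and $\cos\vartheta=|(v-u)\cdot\omega|/|v-u|$ with $\vartheta\in[0,\pi/2]$. Let $K=-K_1+K_2$ be the integral operator in the decomposition $L=\nu-K$ of the linearized Boltzmann collision operator, where \[ K_1f(v)=\int_{\mathbb R^3\times\mathbb S^2}|v-u|^\gamma b(\vartheta)M^{\frac12}(v)M^{\frac12}(u)f(u)\,d\omega\,du, \] \[ K_2f(v)=\int_{\mathbb R^3\times\mathbb S^2}|v-u|^\gamma b(\vartheta)M^{\frac12}(u)\left(M^{\frac12}(v')f(u')+M^{\frac12}(u')f(v')\right)d\omega\,du . \] For $f\in L^\infty(\mathbb R^3)$ and every $v\in\mathbb R^3$ these integrals converge absolutely,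 and $K$ has an integral kernel $k$: $k(v,\cdot)\in L^1(\mathbb R^3)$ and $Kf(v)=\int_{\mathbb R^3}k(v,\eta)f(\eta)\,d\eta$ for all $f\in L^\infty(\mathbb R^3)$ and $v\in\mathbb R^3$ (so that, for each $v$, $k(v,\cdot)$ is unique up to null sets). Let $\alpha=1$ if $-2<\gamma<0$, let $\alpha$ be any number in $(0,1)$ if $\gamma=-2$, and let $\alpha=3+\gamma$ if $-3<\gamma<-2$. Then there is a constant $C>0$, depending only on $\gamma$, $\alpha$ and $C_b$, such that for all $v_1,v_2\in\mathbb R^3$ \[ \int_{\mathbb R^3}|k(v_1,\eta)-k(v_2,\eta)|\,d\eta\le C\,|v_1-v_2|^{\alpha}\max\left\{\langle v_1\rangle^{\gamma-1},\langle v_2\rangle^{\gamma-1}\right\}. \] Furthermore, for every measurable $\Omega\subset\mathbb R^3$ and every $f\in L^\infty(\Omega\times\mathbb R^3)$, \[ |Kf(x,v_1)-Kf(x,v_2)|\le C\,\|f\|_{L^\infty(\Omega\times\mathbb R^3)}\,|v_1-v_2|^{\alpha}\max\left\{\langle v_1\rangle^{\gamma-1},\langle v_2\rangle^{\gamma-1}\right\}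 \] for all $v_1,v_2\in\mathbb R^3$ and almost every $x\in\Omega$, namely at every $x\in\Omega$ for which $f(x,\cdot)$ is measurable and $|f(x,\cdot)|\le\|f\|_{L^\infty(\Omega\times\mathbb R^3)}$ almost everywhere. Here $Kf(x,v)=K(f(x,\cdot))(v)$. -/

import Mathlib

open MeasureTheory

noncomputable section

namespace Boltzmann

/-- The velocity (and position) space `ℝ³` with its Euclidean norm and Lebesgue measure. -/
abbrev R3 : Type := EuclideanSpace ℝ (Fin 3)

/-- The unit sphere `𝕊²`. -/
abbrev S2 : Type := Metric.sphere (0 : R3) 1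

/-- The surface measure `dω` on `𝕊²`. -/
def surfaceMeasure : Measure S2 := (volume : Measure R3).toSphere

/-- `⟨v⟩ ^ s = (1 + |v|²) ^ (s / 2)`. -/
def bracket (v : R3) (s : ℝ) : ℝ := (1 + ‖v‖ ^ 2) ^ (s / 2)

/-- The global Maxwellian `M(v) = (2π)^(-3/2) exp (-|v|² / 2)`. -/
def maxwellian (v : R3) : ℝ :=
  (2 * Real.pi) ^ (-(3 / 2) : ℝ) * Real.exp (-(‖v‖ ^ 2 / 2))

/-- `M^(1/2)`. -/
def sqrtM (v : R3) : ℝ := Real.sqrt (maxwellian v)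

/-- Post-collisional velocity `v' = v - [(v - u) · ω] ω`. -/
def vPost (v u : R3) (ω : S2) : R3 := v - (inner ℝ (v - u) (ω : R3)) • (ω : R3)

/-- Post-collisional velocity `u' = u + [(v - u) · ω] ω`. -/
def uPost (v u : R3) (ω : S2) : R3 := u + (inner ℝ (v - u) (ω : R3)) • (ω : R3)

/-- The angle `ϑ ∈ [0, π/2]` with `cos ϑ = |(v - u) · ω| / |v - u|`. -/
def collisionAngle (v u : R3) (ω : S2) : ℝ :=
  Real.arccos (|inner ℝ (v - u) (ω : R3)| / ‖v - u‖)

/-- Grad's cutoff assumption `0 < b(ϑ) ≤ C_b cos ϑ` on a measurable angular function. The endpoint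
`ϑ = π/2`, where `cos ϑ = 0` and which is attained only on a null set of directions, is left out. -/
structure GradCutoff (Cb : ℝ) (b : ℝ → ℝ) : Prop where
  measurable : Measurable b
  pos : ∀ θ : ℝ, 0 ≤ θ → θ < Real.pi / 2 → 0 < b θ
  le_cos : ∀ θ : ℝ, 0 ≤ θ → θ < Real.pi / 2 → b θ ≤ Cb * Real.cos θ

/-- The collision cross section `|v - u|^γ b(ϑ)`. -/
def crossSection (γ : ℝ) (b : ℝ → ℝ) (v u : R3) (ω : S2) : ℝ :=
  ‖v - u‖ ^ γ * b (collisionAngle v u ω)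

/-- The integrand of `K₁ f (v)`, as a function of `(u, ω)`. -/
def K1Integrand (γ : ℝ) (b : ℝ → ℝ) (f : R3 → ℝ) (v : R3) (p : R3 × S2) : ℝ :=
  crossSection γ b v p.1 p.2 * sqrtM v * sqrtM p.1 * f p.1

/-- The integrand of `K₂ f (v)`, as a function of `(u, ω)`. -/
def K2Integrand (γ : ℝ) (b : ℝ → ℝ) (f : R3 → ℝ) (v : R3) (p : R3 × S2) : ℝ :=
  crossSection γ b v p.1 p.2 * sqrtM p.1 *
    (sqrtM (vPost v p.1 p.2) * f (uPost v p.1 p.2) +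
      sqrtM (uPost v p.1 p.2) * f (vPost v p.1 p.2))

/-- `K₁ f (v)`. -/
def K1 (γ : ℝ) (b : ℝ → ℝ) (f : R3 → ℝ) (v : R3) : ℝ :=
  ∫ p, K1Integrand γ b f v p ∂((volume : Measure R3).prod surfaceMeasure)

/-- `K₂ f (v)`. -/
def K2 (γ : ℝ) (b : ℝ → ℝ) (f : R3 → ℝ) (v : R3) : ℝ :=
  ∫ p, K2Integrand γ b f v p ∂((volume : Measure R3).prod surfaceMeasure)

/-- The operator `K = -K₁ + K₂` in the decomposition `L = ν - K` of the linearized collision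
operator. -/
def K (γ : ℝ) (b : ℝ → ℝ) (f : R3 → ℝ) (v : R3) : ℝ := -K1 γ b f v + K2 γ b f v

/-- `k` is the integral kernel of the operator `T` on bounded functions:
`T f (v) = ∫ k(v, η) f(η) dη` for every `v` and every `f ∈ L^∞(ℝ³)`, the integral being absolutely
convergent. For each `v` this determines `k(v, ·)` almost everywhere. -/
structure IsKernelOf (T : (R3 → ℝ) → R3 → ℝ) (k : R3 → R3 → ℝ) : Prop where
  integrable : ∀ v : R3, Integrable (k v) volume
  repr : ∀ f : R3 → ℝ, MemLp f ⊤ volume → ∀ v : R3, T f v = ∫ η, k v η * f η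

/-- The admissible values `α` of the exponent `α̃_γ`: `1` if `γ > -2`; `1⁻`, that is any number in
`(0, 1)`, if `γ = -2`; and `3 + γ` if `γ < -2`. -/
def IsHolderExponent (γ α : ℝ) : Prop :=
  (-2 < γ ∧ α = 1) ∨ (γ = -2 ∧ 0 < α ∧ α < 1) ∨ (γ < -2 ∧ α = 3 + γ)

/-- The norm of `L^∞(Ω × ℝ³)`. -/
def normInfty (Ω : Set R3) (f : R3 × R3 → ℝ) : ℝ :=
  (eLpNorm f ⊤ ((volume : Measure (R3 × R3)).restrict (Ω ×ˢ Set.univ))).toReal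

end Boltzmann

end

namespace Boltzmann

open scoped ENNReal NNReal BoundedContinuousFunction Topology

/-! Each of the three pieces of `K` is an integral operator with a nonnegative kernel that is Hölder
in its first variable in the weighted `L¹` sense. Put `u = v + z` and split `z = V + W` into the
parts parallel and orthogonal to `ω`; then `v' = v + V` and `u' = v + W`. Carleman's change of
variables (`lintegral_carleman`) makes `η = v + V` the outer variable and leaves an integral over
the plane orthogonal to `η - v`. With `W = |V| w` one has `|V + W| = |V| √(1 + |w|²)` and `cos ϑ = 1
/ √(1 + |w|²)`, so `b`, which is merely measurable, enters only through `|w|` (`gainDensity_eq`).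
The term with `f(u')` takes the same form by the symmetry of `δ(V · W) dV dW` (`orthInt_swap`), and
the linear cutoff bound survives that exchange.

To compare `v₁` with `v₂`, the planes orthogonal to `η - v₁` and `η - v₂` are identified by an
isometry that moves vectors of the first plane little when the two directions are close. It
preserves `|w|`, so the rough angular factor is the same on both sides and only `|η - v|^γ` times
Gaussians has to be differenced (`abs_density_sub_le`, `gainKernel_le_add`). With `h = min(|v₁ -
v₂|, 1)` the result is bounded by `majorant`: one factor `|η - v|` is replaced by `min(|η - v|, h)`,
up to a term linear in `h`.

Carleman's formula read backwards integrates this majorant. The surplus factor `|z|` in the linear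
term is absorbed by the sphere average of `exp(-(z·ω)²/32)`, which is of order `1/|z|`
(`exists_sphere_gaussian_le`). What remains is `∫ |u - v|^(γ-1) min(|u - v|, h) exp(-|u|²/16) du ≤ C
h^α ⟨v⟩^(γ-1)` (`exists_lintegral_weight_le`): the singularity at `u = v` dictates `α`, and Peetre's
inequality gives the decay. The loss term is the simpler case `W = 0`. -/

/-! ### Integration over the plane orthogonal to a unit vector -/

/-- A fixed even weight of unit mass, used to average over the normal direction of a plane. -/
noncomputable def slab (r : ℝ) : ℝ≥0∞ := (Set.Icc (-(1 / 2) : ℝ) (1 / 2)).indicator 1 r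

/-- The component of `x` orthogonal to the unit vector `ω`. -/
noncomputable def perp (ω x : R3) : R3 := x - inner ℝ x ω • ω

/-- The direction `V / |V|`. -/
noncomputable def dir (V : R3) : R3 := ‖V‖⁻¹ • V

/-- The integral of `g` over the plane orthogonal to the unit vector `ω`, written as an integral
over a slab in `ℝ³`. -/
noncomputable def planeInt (ω : R3) (g : R3 → ℝ≥0∞) : ℝ≥0∞ :=
  ∫⁻ x, slab (inner ℝ x ω) * g (perp ω x)

@[fun_prop]
lemma measurable_slab : Measurable slab :=
  measurable_one.indicator measurableSet_Icc

lemma lintegral_slab : ∫⁻ r, slab r = 1 := by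
  unfold slab
  rw [lintegral_indicator_one measurableSet_Icc]
  simp; norm_num

lemma slab_neg (r : ℝ) : slab (-r) = slab r := by
  unfold slab
  by_cases h : r ∈ Set.Icc (-(1 / 2) : ℝ) (1 / 2)
  · have h' : -r ∈ Set.Icc (-(1 / 2) : ℝ) (1 / 2) := ⟨by linarith [h.2], by linarith [h.1]⟩
    simp only [Set.indicator_of_mem h, Set.indicator_of_mem h']; rfl
  · have h' : -r ∉ Set.Icc (-(1 / 2) : ℝ) (1 / 2) :=
      fun h' => h ⟨by linarith [h'.2], by linarith [h'.1]⟩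
    simp only [Set.indicator_of_notMem h, Set.indicator_of_notMem h']

@[fun_prop]
lemma measurable_perp {X : Type*} [MeasurableSpace X] {f g : X → R3} (hf : Measurable f)
    (hg : Measurable g) : Measurable fun x => perp (f x) (g x) := by
  unfold perp; fun_prop

@[fun_prop]
lemma measurable_dir : Measurable dir := by
  unfold dir; fun_prop

/-- Cartesian coordinates adapted to the unit vector `ω`. -/
noncomputable def splitIso (ω : R3) (hω : ‖ω‖ = 1) :
    WithLp 2 (ℝ × (Submodule.span ℝ {ω})ᗮ) →ₗᵢ[ℝ] R3 where
  toFun p := p.fst • ω + (p.snd : R3)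
  map_add' p q := by simp [add_smul]; abel
  map_smul' c p := by simp [mul_smul]
  norm_map' p := by
    have h0 : inner ℝ (p.fst • ω) (p.snd : R3) = 0 :=
      Submodule.inner_right_of_mem_orthogonal
        (Submodule.smul_mem _ _ (Submodule.mem_span_singleton_self ω)) p.snd.2
    have h1 := norm_add_sq_eq_norm_sq_add_norm_sq_of_inner_eq_zero _ _ h0
    have h2 := WithLp.prod_norm_sq_eq_of_L2 p
    rw [norm_smul, hω, mul_one] at h1
    have : ‖p.fst • ω + (p.snd : R3)‖ ^ 2 = ‖p‖ ^ 2 := by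
      rw [h2, sq, h1]; simp [sq]
    exact (sq_eq_sq₀ (norm_nonneg _) (norm_nonneg _)).1 this

/-- Fubini's theorem in Cartesian coordinates adapted to the unit vector `ω`. -/
lemma lintegral_split {ω : R3} (hω : ‖ω‖ = 1) {G : ℝ → R3 → ℝ≥0∞}
    (hG : Measurable (Function.uncurry G)) :
    ∫⁻ y, G (inner ℝ y ω) (perp ω y) =
      ∫⁻ s, ∫⁻ w : (Submodule.span ℝ {ω})ᗮ, G s w := by
  have hω0 : ω ≠ 0 := by rintro rfl; simp at hω
  have hdim : Module.finrank ℝ (WithLp 2 (ℝ × (Submodule.span ℝ {ω})ᗮ)) = Module.finrank ℝ R3 := by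
    have h1 := Submodule.finrank_add_finrank_orthogonal (Submodule.span ℝ {ω})
    rw [finrank_span_singleton hω0] at h1
    rw [← h1, (WithLp.linearEquiv 2 ℝ (ℝ × (Submodule.span ℝ {ω})ᗮ)).finrank_eq,
      Module.finrank_prod, Module.finrank_self]
  let T := (splitIso ω hω).toLinearIsometryEquiv hdim
  have hT : ∀ p, T p = p.fst • ω + (p.snd : R3) := fun p => rfl
  have hin : ∀ p, inner ℝ (T p) ω = p.fst := by
    intro p
    have h0 : inner ℝ (p.snd : R3) ω = 0 :=
      Submodule.inner_left_of_mem_orthogonal (Submodule.mem_span_singleton_self ω) p.snd.2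
    rw [hT, inner_add_left, h0, real_inner_smul_left, real_inner_self_eq_norm_sq, hω]; simp
  have hmG : Measurable fun y : R3 => G (inner ℝ y ω) (perp ω y) :=
    hG.comp (by fun_prop : Measurable fun y : R3 => (inner ℝ y ω, perp ω y))
  have hmT : Measurable fun p => G (inner ℝ (T p) ω) (perp ω (T p)) :=
    hmG.comp T.continuous.measurable
  rw [← T.measurePreserving.lintegral_comp hmG,
    ← (WithLp.volume_preserving_toLp ℝ (Submodule.span ℝ {ω})ᗮ).lintegral_comp hmT,
    Measure.volume_eq_prod, lintegral_prod]
  · refine lintegral_congr fun s => lintegral_congr fun w => ?_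
    simp only [perp]
    rw [hin, hT]; simp
  · refine Measurable.aemeasurable ?_
    exact hmT.comp (WithLp.measurable_toLp 2 _)

/-- The slab has unit width, so the normal variable integrates to 1. The slab form lives on a fixed
space and is visibly measurable in `ω`; the subspace form, whose type varies with `ω`, has the
linearity of a genuine integral. -/
lemma planeInt_eq {ω : R3} (hω : ‖ω‖ = 1) {g : R3 → ℝ≥0∞} (hg : Measurable g) :
    planeInt ω g = ∫⁻ w : (Submodule.span ℝ {ω})ᗮ, g w := by
  unfold planeInt
  rw [lintegral_split hω (G := fun s w => slab s * g w) (by unfold Function.uncurry; fun_prop)]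
  have : ∀ s, ∫⁻ w : (Submodule.span ℝ {ω})ᗮ, slab s * g w
      = slab s * ∫⁻ w : (Submodule.span ℝ {ω})ᗮ, g w :=
    fun s => lintegral_const_mul _ (hg.comp measurable_subtype_coe)
  simp_rw [this]
  rw [lintegral_mul_const _ measurable_slab, lintegral_slab, one_mul]

lemma lintegral_eq_lintegral_planeInt {ω : R3} (hω : ‖ω‖ = 1) {G : ℝ → R3 → ℝ≥0∞}
    (hG : Measurable (Function.uncurry G)) :
    ∫⁻ y, G (inner ℝ y ω) (perp ω y) = ∫⁻ s, planeInt ω (G s) := by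
  rw [lintegral_split hω hG]
  refine lintegral_congr fun s => ?_
  have : Measurable (G s) := hG.comp measurable_prodMk_left
  rw [planeInt_eq hω this]

lemma lintegral_comp_smul {E : Type*} [NormedAddCommGroup E] [NormedSpace ℝ E]
    [FiniteDimensional ℝ E] [MeasurableSpace E] [BorelSpace E] (μ : Measure E)
    [μ.IsAddHaarMeasure] {f : E → ℝ≥0∞} (hf : Measurable f) {c : ℝ} (hc : c ≠ 0) :
    ∫⁻ x, f (c • x) ∂μ = ENNReal.ofReal |(c ^ Module.finrank ℝ E)⁻¹| * ∫⁻ x, f x ∂μ := by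
  rw [← lintegral_map (g := fun x : E => c • x) hf (by fun_prop), Measure.map_addHaar_smul μ hc,
    lintegral_smul_measure, smul_eq_mul]

lemma perp_smul (ω : R3) (c : ℝ) (x : R3) : perp ω (c • x) = c • perp ω x := by
  simp [perp, real_inner_smul_left, smul_sub, mul_smul]

/-- Scaling `ℝ³` gives `c³`, and the slab, now of width `1/c`, gives back `c⁻¹`. -/
lemma planeInt_smul {ω : R3} (hω : ‖ω‖ = 1) {g : R3 → ℝ≥0∞} (hg : Measurable g) {c : ℝ}
    (hc : 0 < c) :
    planeInt ω g = ENNReal.ofReal (c ^ 2) * planeInt ω fun w => g (c • w) := by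
  have e1 : planeInt ω g = ENNReal.ofReal (c ^ 3) *
      ∫⁻ x, slab (c * inner ℝ x ω) * g (c • perp ω x) := by
    have hm : Measurable fun x : R3 => slab (inner ℝ x ω) * g (perp ω x) := by fun_prop
    have := lintegral_comp_smul (volume : Measure R3) hm hc.ne'
    simp only [real_inner_smul_left, perp_smul] at this
    rw [this, planeInt, ← mul_assoc, ← ENNReal.ofReal_mul (by positivity)]
    simp [abs_of_pos hc, mul_inv_cancel₀ (pow_ne_zero 3 hc.ne')]
  have e2 : ∫⁻ x, slab (c * inner ℝ x ω) * g (c • perp ω x)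
      = ENNReal.ofReal c⁻¹ * planeInt ω fun w => g (c • w) := by
    rw [lintegral_eq_lintegral_planeInt hω (G := fun s w => slab (c * s) * g (c • w))
      (by unfold Function.uncurry; fun_prop)]
    have : ∀ s, planeInt ω (fun w => slab (c * s) * g (c • w))
        = slab (c * s) * planeInt ω (fun w => g (c • w)) := by
      intro s
      rw [planeInt_eq hω (by fun_prop), planeInt_eq hω (by fun_prop),
        lintegral_const_mul _ (by fun_prop)]
    simp_rw [this]
    rw [lintegral_mul_const _ (by fun_prop)]
    congr 1
    have := lintegral_comp_smul (volume : Measure ℝ) measurable_slab hc.ne'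
    simp only [smul_eq_mul] at this
    rw [this, lintegral_slab]
    simp [abs_of_pos hc]
  rw [e1, e2, ← mul_assoc, ← ENNReal.ofReal_mul (by positivity)]
  congr 2
  field_simp

/-! ### Polar coordinates and Carleman's representation -/

instance : IsFiniteMeasure surfaceMeasure := by unfold surfaceMeasure; infer_instance

/-- Polar coordinates in `ℝ³`. -/
lemma lintegral_polar {h : R3 → ℝ≥0∞} (hh : Measurable h) :
    ∫⁻ V, h V = ∫⁻ ω : S2, (∫⁻ r in Set.Ioi (0 : ℝ), ENNReal.ofReal (r ^ 2) * h (r • (ω : R3)))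
      ∂surfaceMeasure := by
  have h1 : ∫⁻ V, h V = ∫⁻ x : ({(0 : R3)}ᶜ : Set R3), h x ∂((volume : Measure R3).comap (↑)) := by
    rw [lintegral_subtype_comap (measurableSet_singleton _).compl h, restrict_compl_singleton]
  have h2 := (volume : Measure R3).measurePreserving_homeomorphUnitSphereProd.symm
    (homeomorphUnitSphereProd R3).toMeasurableEquiv
  have h3 := h2.lintegral_comp (f := fun x : ({(0 : R3)}ᶜ : Set R3) => h x)
    (hh.comp measurable_subtype_coe)
  have hm : Measurable fun a : S2 × Set.Ioi (0 : ℝ) => h ((a.2 : ℝ) • (a.1 : R3)) := by fun_prop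
  have h4 : ∀ a : S2 × Set.Ioi (0 : ℝ),
      h (((homeomorphUnitSphereProd R3).toMeasurableEquiv.symm a : ({(0 : R3)}ᶜ : Set R3)) : R3)
        = h ((a.2 : ℝ) • (a.1 : R3)) := fun a => rfl
  simp_rw [h4] at h3
  rw [h1, ← h3, lintegral_prod _ hm.aemeasurable]
  refine lintegral_congr fun ω => ?_
  have hmω : Measurable fun r : Set.Ioi (0 : ℝ) => h ((r : ℝ) • (ω : R3)) := by fun_prop
  rw [Measure.volumeIoiPow, lintegral_withDensity_eq_lintegral_mul _ (by fun_prop) hmω]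
  have := lintegral_subtype_comap (μ := volume) (measurableSet_Ioi (a := (0:ℝ)))
    (fun r : ℝ => ENNReal.ofReal (r ^ 2) * h (r • (ω : R3)))
  rw [← this]
  simp

lemma perp_neg_left (ω x : R3) : perp (-ω) x = perp ω x := by simp [perp]

lemma planeInt_neg (ω : R3) (g : R3 → ℝ≥0∞) : planeInt (-ω) g = planeInt ω g := by
  simp [planeInt, perp_neg_left, slab_neg]

lemma norm_dir {V : R3} (hV : V ≠ 0) : ‖dir V‖ = 1 := by
  simp [dir, norm_smul, hV]

lemma dir_neg (V : R3) : dir (-V) = -dir V := by simp [dir]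

lemma dir_smul_of_pos {ω : R3} (hω : ‖ω‖ = 1) {s : ℝ} (hs : 0 < s) : dir (s • ω) = ω := by
  simp [dir, norm_smul, hω, abs_of_pos hs, smul_smul, hs.ne']

@[fun_prop]
lemma measurable_planeInt {X : Type*} [MeasurableSpace X] {f : X → R3} {G : X → R3 → ℝ≥0∞}
    (hf : Measurable f) (hG : Measurable (Function.uncurry G)) :
    Measurable fun x => planeInt (f x) (G x) := by
  unfold planeInt
  apply Measurable.lintegral_prod_right' (f := fun p : X × R3 =>
    slab (inner ℝ p.2 (f p.1)) * G p.1 (perp (f p.1) p.2))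
  apply Measurable.mul
  · fun_prop
  · exact hG.comp (by fun_prop : Measurable fun p : X × R3 => (p.1, perp (f p.1) p.2))

lemma lintegral_eq_lintegral_Ioi_add_neg {f : ℝ → ℝ≥0∞} (hf : Measurable f) :
    ∫⁻ s, f s = ∫⁻ s in Set.Ioi 0, (f s + f (-s)) := by
  have h1 : ∫⁻ s in Set.Ioi 0, f (-s) = ∫⁻ s in Set.Iio 0, f s := by
    have := (Measure.measurePreserving_neg (volume : Measure ℝ)).setLIntegral_comp_preimage
      (s := Set.Iio 0) measurableSet_Iio hf
    simpa using this
  rw [lintegral_add_left hf, h1, ← lintegral_add_compl f (measurableSet_Ioi (a := (0:ℝ))),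
    Set.compl_Ioi, setLIntegral_congr (Iio_ae_eq_Iic (a := (0:ℝ)))]

/-- **Carleman's representation**: the decomposition of `z` into the components parallel and
orthogonal to `ω`, in which the parallel component becomes the outer variable. -/
theorem lintegral_carleman_unscaled {F : R3 → R3 → ℝ≥0∞} (hF : Measurable (Function.uncurry F)) :
    ∫⁻ ω : S2, (∫⁻ z, F (inner ℝ z (ω : R3) • (ω : R3)) (perp ω z)) ∂surfaceMeasure =
      2 * ∫⁻ V, (ENNReal.ofReal (‖V‖ ^ 2))⁻¹ * planeInt (dir V) (F V) := by
  set H : R3 → ℝ≥0∞ := fun V => planeInt (dir V) (F V) with hH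
  have hHm : Measurable H := measurable_planeInt measurable_dir hF
  -- The signed parallel component `s` is folded onto `r > 0`; `ω` and `-ω` have the same plane, so
  -- the two halves are values of `H` at `±rω`. The inserted `r² · (r²)⁻¹` supplies the polar
  -- Jacobian, and the two halves produce the factor 2.
  have e1 : ∀ ω : S2, ∫⁻ z, F (inner ℝ z (ω : R3) • (ω : R3)) (perp ω z) =
      ∫⁻ r in Set.Ioi (0 : ℝ), ENNReal.ofReal (r ^ 2) *
        ((ENNReal.ofReal (‖r • (ω : R3)‖ ^ 2))⁻¹ * (H (r • (ω : R3)) + H (-(r • (ω : R3))))) := by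
    intro ω
    have hω : ‖(ω : R3)‖ = 1 := by simp
    have hmc : Measurable fun p : ℝ × R3 => F (p.1 • (ω : R3)) p.2 :=
      hF.comp (by fun_prop : Measurable fun p : ℝ × R3 => (p.1 • (ω : R3), p.2))
    rw [lintegral_eq_lintegral_planeInt hω (G := fun s w => F (s • (ω : R3)) w) hmc,
      lintegral_eq_lintegral_Ioi_add_neg
        (measurable_planeInt (f := fun _ => (ω : R3)) (G := fun s w => F (s • (ω : R3)) w)
          measurable_const hmc)]
    refine setLIntegral_congr_fun measurableSet_Ioi fun r hr => ?_
    have hr : 0 < r := hr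
    have hn : ‖r • (ω : R3)‖ = r := by rw [norm_smul, hω]; simp [abs_of_pos hr]
    have hp : ENNReal.ofReal (r ^ 2) ≠ 0 := by simp; positivity
    rw [hn, ← mul_assoc, ENNReal.mul_inv_cancel hp ENNReal.ofReal_ne_top, one_mul]
    simp only [hH, dir_neg, dir_smul_of_pos hω hr, planeInt_neg, neg_smul]
  simp_rw [e1]
  rw [← lintegral_polar (h := fun V => (ENNReal.ofReal (‖V‖ ^ 2))⁻¹ * (H V + H (-V)))
    (by fun_prop)]
  simp_rw [mul_add]
  rw [lintegral_add_left (by fun_prop), two_mul]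
  congr 1
  have := (Measure.measurePreserving_neg (volume : Measure R3)).lintegral_comp
    (f := fun V => (ENNReal.ofReal (‖V‖ ^ 2))⁻¹ * H V) (by fun_prop)
  simpa using this

/-- The two-dimensional Jacobian of `W = |V| w` cancels `|V|⁻²`. The variable `w` is the slope of `V
+ W` relative to `V`, so angles depend on `|w|` alone. -/
theorem lintegral_carleman {F : R3 → R3 → ℝ≥0∞} (hF : Measurable (Function.uncurry F)) :
    ∫⁻ ω : S2, (∫⁻ z, F (inner ℝ z (ω : R3) • (ω : R3)) (perp ω z)) ∂surfaceMeasure =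
      2 * ∫⁻ V, planeInt (dir V) fun w => F V (‖V‖ • w) := by
  rw [lintegral_carleman_unscaled hF]
  congr 1
  refine lintegral_congr_ae ?_
  have h0 : ∀ᵐ V : R3, V ≠ 0 := by simp [ae_iff]
  filter_upwards [h0] with V hV
  have hp : ENNReal.ofReal (‖V‖ ^ 2) ≠ 0 := by simp; positivity
  have hFV : Measurable (F V) := hF.comp measurable_prodMk_left
  rw [planeInt_smul (norm_dir hV) hFV (norm_pos_iff.2 hV),
    ← mul_assoc, ENNReal.inv_mul_cancel hp ENNReal.ofReal_ne_top, one_mul]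

lemma planeInt_const_mul (ω : R3) {g : R3 → ℝ≥0∞} (hg : Measurable g) (c : ℝ≥0∞) :
    (planeInt ω fun w => c * g w) = c * planeInt ω g := by
  unfold planeInt
  rw [← lintegral_const_mul _ (by fun_prop)]
  refine lintegral_congr fun x => ?_
  ring

/-! ### Orthogonal pairs and the symmetry of `δ(V · W) dV dW` -/

lemma lintegral_gaussian_lt_top {a : ℝ} (ha : 0 < a) :
    ∫⁻ z : R3, ENNReal.ofReal (Real.exp (-a * ‖z‖ ^ 2)) < ∞ := by
  have h : Integrable fun z : R3 => Real.exp (-a * ‖z‖ ^ 2) := by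
    by_contra hn
    have h1 := GaussianFourier.integral_rexp_neg_mul_sq_norm (V := R3) ha
    rw [integral_undef hn] at h1
    have : 0 < (Real.pi / a) ^ ((Module.finrank ℝ R3 : ℝ) / 2) := by positivity
    linarith
  exact h.lintegral_lt_top

lemma inner_perp {ω : R3} (hω : ‖ω‖ = 1) (x : R3) : inner ℝ (perp ω x) ω = 0 := by
  simp [perp, inner_sub_left, real_inner_smul_left, hω]

lemma smul_add_perp (ω x : R3) : inner ℝ x ω • ω + perp ω x = x := by simp [perp]

lemma norm_smul_add_sq {ω w : R3} (hω : ‖ω‖ = 1) (hw : inner ℝ w ω = 0) (s : ℝ) :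
    ‖s • ω + w‖ ^ 2 = s ^ 2 + ‖w‖ ^ 2 := by
  rw [norm_add_sq_real, norm_smul, hω, real_inner_smul_left, real_inner_comm, hw]
  simp

lemma norm_sq_eq_perp {ω : R3} (hω : ‖ω‖ = 1) (x : R3) :
    ‖x‖ ^ 2 = (inner ℝ x ω) ^ 2 + ‖perp ω x‖ ^ 2 := by
  conv_lhs => rw [← smul_add_perp ω x]
  exact norm_smul_add_sq hω (inner_perp hω x) _

/-- The measure `δ(V · W) dV dW` on pairs of orthogonal vectors, as a functional. -/
noncomputable def orthInt (F : R3 → R3 → ℝ≥0∞) : ℝ≥0∞ :=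
  ∫⁻ V, (ENNReal.ofReal ‖V‖)⁻¹ * planeInt (dir V) (F V)

/-- The weight `|z · ω| = |V|` turns Carleman's `|V|⁻²` into `|V|⁻¹`, which is the density of `δ(V ·
W)` on the plane orthogonal to `V`. -/
lemma lintegral_inner_mul_eq_orthInt {F : R3 → R3 → ℝ≥0∞}
    (hF : Measurable (Function.uncurry F)) :
    ∫⁻ ω : S2, (∫⁻ z, ENNReal.ofReal |inner ℝ z (ω : R3)| *
      F (inner ℝ z (ω : R3) • (ω : R3)) (perp ω z)) ∂surfaceMeasure = 2 * orthInt F := by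
  have h := lintegral_carleman_unscaled (F := fun V W => ENNReal.ofReal ‖V‖ * F V W)
    (by apply Measurable.mul
        · fun_prop
        · exact hF)
  have h1 : ∀ (ω : S2) (z : R3), ‖inner ℝ z (ω : R3) • (ω : R3)‖ = |inner ℝ z (ω : R3)| := by
    intro ω z; simp [norm_smul]
  simp_rw [h1] at h
  rw [h, orthInt]
  congr 1
  refine lintegral_congr_ae ?_
  have h0 : ∀ᵐ V : R3, V ≠ 0 := by simp [ae_iff]
  filter_upwards [h0] with V hV
  have hFV : Measurable (F V) := hF.comp measurable_prodMk_left
  have hp : ENNReal.ofReal ‖V‖ ≠ 0 := by simpa using hV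
  rw [planeInt_const_mul _ hFV, ← mul_assoc, ENNReal.ofReal_pow (norm_nonneg _), sq,
    ENNReal.mul_inv (Or.inl hp) (Or.inl ENNReal.ofReal_ne_top), mul_assoc (_⁻¹),
    ENNReal.inv_mul_cancel hp ENNReal.ofReal_ne_top, mul_one]

/-- Here `n · slab (n V·y)` approximates `δ(V · y)`. The substitution `r = n|V|s` in the coordinate
`s` along `V` produces `|V|⁻¹` and an offset `r / (n|V|)` that disappears as `n → ∞`. -/
lemma lintegral_slab_inner {g : R3 → ℝ≥0∞} (hg : Measurable g) {V : R3} (hV : V ≠ 0) {n : ℝ}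
    (hn : 0 < n) :
    ∫⁻ y, ENNReal.ofReal n * slab (n * inner ℝ V y) * g y =
      (ENNReal.ofReal ‖V‖)⁻¹ * ∫⁻ r, slab r *
        planeInt (dir V) (fun w => g ((r / (n * ‖V‖)) • dir V + w)) := by
  have hω := norm_dir hV
  set ω := dir V with hωd
  have hVn : 0 < ‖V‖ := norm_pos_iff.2 hV
  have hVω : V = ‖V‖ • ω := by
    rw [hωd, dir, smul_smul, mul_inv_cancel₀ hVn.ne', one_smul]
  have hin : ∀ y, inner ℝ V y = ‖V‖ * inner ℝ y ω := by
    intro y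
    rw [real_inner_comm]
    conv_lhs => rw [hVω]
    rw [real_inner_smul_right]
  have hc : 0 < n * ‖V‖ := by positivity
  have e1 : ∫⁻ y, ENNReal.ofReal n * slab (n * inner ℝ V y) * g y =
      ∫⁻ s, planeInt ω (fun w => (ENNReal.ofReal n * slab ((n * ‖V‖) * s)) * g (s • ω + w)) := by
    rw [← lintegral_eq_lintegral_planeInt hω
      (G := fun s w => (ENNReal.ofReal n * slab ((n * ‖V‖) * s)) * g (s • ω + w))
      (by unfold Function.uncurry; fun_prop)]
    refine lintegral_congr fun y => ?_
    rw [smul_add_perp, hin, mul_assoc n]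
  have hQ : Measurable fun s : ℝ => planeInt ω (fun w => g (s • ω + w)) := by
    refine measurable_planeInt measurable_const ?_
    unfold Function.uncurry; fun_prop
  have e2 := lintegral_comp_smul (volume : Measure ℝ)
    (f := fun r => slab r * planeInt ω (fun w => g ((r / (n * ‖V‖)) • ω + w)))
    (measurable_slab.mul (hQ.comp (measurable_id.div_const _))) hc.ne'
  have e3 : ∀ s : ℝ, (n * ‖V‖) • s / (n * ‖V‖) = s := fun s => by
    rw [smul_eq_mul]; field_simp
  simp_rw [e3, smul_eq_mul] at e2
  rw [e1]
  have e4 : ∀ s : ℝ, planeInt ω (fun w => (ENNReal.ofReal n * slab ((n * ‖V‖) * s)) *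
      g (s • ω + w)) = ENNReal.ofReal n * (slab ((n * ‖V‖) * s) *
        planeInt ω (fun w => g (s • ω + w))) := fun s => by
    rw [planeInt_const_mul _ (by fun_prop), mul_assoc]
  simp_rw [e4]
  rw [lintegral_const_mul _ (by fun_prop), e2, ← mul_assoc, ← ENNReal.ofReal_mul hn.le]
  congr 1
  rw [← ENNReal.ofReal_inv_of_pos hVn]
  congr 1
  rw [Module.finrank_self, pow_one, abs_of_pos (by positivity)]
  field_simp

/-- Back on sphere times space the integrand is `|z · ω| exp(-|z|²)`, and half of the Gaussian
absorbs the linear factor. -/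
lemma orthInt_gaussian_lt_top :
    orthInt (fun V W => ENNReal.ofReal (Real.exp (-(‖V‖ ^ 2 + ‖W‖ ^ 2)))) < ∞ := by
  have h := lintegral_inner_mul_eq_orthInt
    (F := fun V W => ENNReal.ofReal (Real.exp (-(‖V‖ ^ 2 + ‖W‖ ^ 2))))
    (by unfold Function.uncurry; fun_prop)
  have hb : ∫⁻ ω : S2, (∫⁻ z, ENNReal.ofReal |inner ℝ z (ω : R3)| *
      ENNReal.ofReal (Real.exp (-(‖inner ℝ z (ω : R3) • (ω : R3)‖ ^ 2 + ‖perp ω z‖ ^ 2))))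
        ∂surfaceMeasure ≤ ∫⁻ ω : S2, (∫⁻ z : R3, ENNReal.ofReal (Real.exp (-(1/2) * ‖z‖ ^ 2)))
        ∂surfaceMeasure := by
    refine lintegral_mono fun ω => lintegral_mono fun z => ?_
    have hω : ‖(ω : R3)‖ = 1 := by simp
    have h1 : ‖inner ℝ z (ω : R3) • (ω : R3)‖ ^ 2 + ‖perp ω z‖ ^ 2 = ‖z‖ ^ 2 := by
      rw [norm_sq_eq_perp hω z, norm_smul, hω]; simp
    have h2 : |inner ℝ z (ω : R3)| ≤ ‖z‖ := by
      have := abs_real_inner_le_norm z (ω : R3); rwa [hω, mul_one] at this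
    simp only
    rw [h1, ← ENNReal.ofReal_mul (abs_nonneg _)]
    refine ENNReal.ofReal_le_ofReal ?_
    have h3 : ‖z‖ ≤ Real.exp (1 / 2 * ‖z‖ ^ 2) := by
      have := Real.add_one_le_exp (1 / 2 * ‖z‖ ^ 2)
      nlinarith [sq_nonneg (‖z‖ - 1)]
    calc _ ≤ Real.exp (1 / 2 * ‖z‖ ^ 2) * Real.exp (-‖z‖ ^ 2) := by
          gcongr; exact h2.trans h3
      _ = _ := by rw [← Real.exp_add]; congr 1; ring
  rw [h] at hb
  have : ∫⁻ ω : S2, (∫⁻ z : R3, ENNReal.ofReal (Real.exp (-(1/2) * ‖z‖ ^ 2))) ∂surfaceMeasure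
      < ∞ := by
    rw [lintegral_const]
    exact ENNReal.mul_lt_top (lintegral_gaussian_lt_top (by norm_num)) (measure_lt_top _ _)
  have h2 := hb.trans_lt this
  by_contra hn
  rw [not_lt, top_le_iff] at hn
  rw [hn] at h2
  simp at h2

/-- Collects the iterated integrals into one over a fixed product space, where dominated convergence
applies. -/
lemma lintegral_prod_slab {G : R3 → ℝ → R3 → ℝ≥0∞}
    (hG : Measurable fun p : R3 × ℝ × R3 => G p.1 p.2.1 p.2.2) :
    ∫⁻ p : R3 × ℝ × R3, (ENNReal.ofReal ‖p.1‖)⁻¹ * (slab p.2.1 *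
      (slab (inner ℝ p.2.2 (dir p.1)) * G p.1 p.2.1 (perp (dir p.1) p.2.2))) =
    ∫⁻ V, (ENNReal.ofReal ‖V‖)⁻¹ * ∫⁻ r, slab r * planeInt (dir V) (G V r) := by
  have hm : Measurable fun p : R3 × ℝ × R3 => (ENNReal.ofReal ‖p.1‖)⁻¹ * (slab p.2.1 *
      (slab (inner ℝ p.2.2 (dir p.1)) * G p.1 p.2.1 (perp (dir p.1) p.2.2))) := by
    have h : Measurable fun p : R3 × ℝ × R3 => G p.1 p.2.1 (perp (dir p.1) p.2.2) :=
      hG.comp (by fun_prop : Measurable fun p : R3 × ℝ × R3 => (p.1, p.2.1, perp (dir p.1) p.2.2))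
    fun_prop
  rw [Measure.volume_eq_prod, lintegral_prod _ hm.aemeasurable]
  refine lintegral_congr fun V => ?_
  have hm1 : Measurable fun p : ℝ × R3 => (slab p.1 *
      (slab (inner ℝ p.2 (dir V)) * G V p.1 (perp (dir V) p.2))) := by
    have h : Measurable fun p : ℝ × R3 => G V p.1 (perp (dir V) p.2) :=
      hG.comp (by fun_prop : Measurable fun p : ℝ × R3 => (V, p.1, perp (dir V) p.2))
    fun_prop
  dsimp only
  rw [lintegral_const_mul _ hm1, Measure.volume_eq_prod, lintegral_prod _ hm1.aemeasurable]
  congr 1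
  refine lintegral_congr fun r => ?_
  have hm2 : Measurable fun x : R3 =>
      (slab (inner ℝ x (dir V)) * G V r (perp (dir V) x)) := by
    have h : Measurable fun x : R3 => G V r (perp (dir V) x) :=
      hG.comp (by fun_prop : Measurable fun x : R3 => (V, r, perp (dir V) x))
    fun_prop
  dsimp only
  rw [lintegral_const_mul _ hm2, planeInt]

/-- Dominated convergence. The offset along `dir V` is orthogonal to the plane, so it only lengthens
the second argument; the Gaussian without offset, times a bound for `F`, therefore dominates every
approximant. -/
lemma tendsto_orthInt (F : R3 × R3 →ᵇ ℝ≥0) :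
    Filter.Tendsto (fun n : ℕ => ∫⁻ V, ∫⁻ y, ENNReal.ofReal (n + 1) *
        slab ((n + 1) * inner ℝ V y) *
          (F (V, y) * ENNReal.ofReal (Real.exp (-(‖V‖ ^ 2 + ‖y‖ ^ 2))))) Filter.atTop
      (𝓝 (orthInt fun V y =>
        F (V, y) * ENNReal.ofReal (Real.exp (-(‖V‖ ^ 2 + ‖y‖ ^ 2))))) := by
  set g : R3 → R3 → ℝ≥0∞ := fun V y =>
    F (V, y) * ENNReal.ofReal (Real.exp (-(‖V‖ ^ 2 + ‖y‖ ^ 2))) with hg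
  have hFm : Measurable F := F.continuous.measurable
  have hgm : Measurable (Function.uncurry g) := by
    simp only [hg, Function.uncurry_def]; fun_prop
  have h0 : ∀ᵐ V : R3, V ≠ 0 := by simp [ae_iff]
  have hGm : ∀ c : ℝ, Measurable fun p : R3 × ℝ × R3 =>
      g p.1 ((p.2.1 / (c * ‖p.1‖)) • dir p.1 + p.2.2) := fun c =>
    hgm.comp (by fun_prop :
      Measurable fun p : R3 × ℝ × R3 => (p.1, (p.2.1 / (c * ‖p.1‖)) • dir p.1 + p.2.2))
  have e1 : ∀ n : ℕ, ∫⁻ V, ∫⁻ y, ENNReal.ofReal (n + 1) * slab ((n + 1) * inner ℝ V y) * g V y =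
      ∫⁻ p : R3 × ℝ × R3, (ENNReal.ofReal ‖p.1‖)⁻¹ * (slab p.2.1 *
      (slab (inner ℝ p.2.2 (dir p.1)) *
        g p.1 ((p.2.1 / (((n : ℝ) + 1) * ‖p.1‖)) • dir p.1 + perp (dir p.1) p.2.2))) := by
    intro n
    rw [lintegral_prod_slab (G := fun V r w => g V ((r / (((n : ℝ) + 1) * ‖V‖)) • dir V + w))
      (hGm _)]
    refine lintegral_congr_ae ?_
    filter_upwards [h0] with V hV
    exact lintegral_slab_inner (hgm.comp measurable_prodMk_left) hV (by positivity)
  have e2 : orthInt g = ∫⁻ p : R3 × ℝ × R3, (ENNReal.ofReal ‖p.1‖)⁻¹ * (slab p.2.1 *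
      (slab (inner ℝ p.2.2 (dir p.1)) * g p.1 (perp (dir p.1) p.2.2))) := by
    rw [lintegral_prod_slab (G := fun V _ w => g V w)
      (hgm.comp (by fun_prop : Measurable fun p : R3 × ℝ × R3 => (p.1, p.2.2)))]
    refine lintegral_congr fun V => ?_
    rw [lintegral_mul_const _ measurable_slab, lintegral_slab, one_mul]
  change Filter.Tendsto (fun n : ℕ => ∫⁻ V, ∫⁻ y, ENNReal.ofReal (n + 1) *
    slab ((n + 1) * inner ℝ V y) * g V y) Filter.atTop (𝓝 (orthInt g))
  simp_rw [e1, e2]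
  refine tendsto_lintegral_of_dominated_convergence
    (fun p : R3 × ℝ × R3 => (ENNReal.ofReal ‖p.1‖)⁻¹ * (slab p.2.1 *
      (slab (inner ℝ p.2.2 (dir p.1)) * ((nndist F 0 : ℝ≥0∞) *
        ENNReal.ofReal (Real.exp (-(‖p.1‖ ^ 2 + ‖perp (dir p.1) p.2.2‖ ^ 2)))))))
    (fun n => ?_) (fun n => ?_) ?_ ?_
  · have h : Measurable fun p : R3 × ℝ × R3 =>
        g p.1 ((p.2.1 / (((n : ℝ) + 1) * ‖p.1‖)) • dir p.1 + perp (dir p.1) p.2.2) :=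
      hgm.comp (by fun_prop : Measurable fun p : R3 × ℝ × R3 =>
        (p.1, (p.2.1 / (((n : ℝ) + 1) * ‖p.1‖)) • dir p.1 + perp (dir p.1) p.2.2))
    fun_prop
  · have h0' : ∀ᵐ p : R3 × ℝ × R3, p.1 ≠ 0 :=
      Measure.quasiMeasurePreserving_fst.ae h0
    filter_upwards [h0'] with p hp
    gcongr
    simp only [hg]
    gcongr
    · exact BoundedContinuousFunction.NNReal.upper_bound F _
    · refine (sq_le_sq₀ (norm_nonneg _) (norm_nonneg _)).1 ?_
      rw [norm_smul_add_sq (norm_dir hp) (inner_perp (norm_dir hp) _)]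
      nlinarith [sq_nonneg (p.2.1 / ((↑n + 1) * ‖p.1‖))]
  · rw [lintegral_prod_slab (G := fun V _ w => (nndist F 0 : ℝ≥0∞) *
        ENNReal.ofReal (Real.exp (-(‖V‖ ^ 2 + ‖w‖ ^ 2)))) (by fun_prop)]
    have h3 : ∀ V : R3, ∫⁻ r, slab r * planeInt (dir V) (fun w => (nndist F 0 : ℝ≥0∞) *
        ENNReal.ofReal (Real.exp (-(‖V‖ ^ 2 + ‖w‖ ^ 2)))) =
        nndist F 0 * planeInt (dir V) (fun w =>
          ENNReal.ofReal (Real.exp (-(‖V‖ ^ 2 + ‖w‖ ^ 2)))) := by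
      intro V
      rw [lintegral_mul_const _ measurable_slab, lintegral_slab, one_mul,
        planeInt_const_mul _ (by fun_prop)]
    simp_rw [h3, mul_left_comm _ (nndist F 0 : ℝ≥0∞)]
    rw [lintegral_const_mul']
    · exact (ENNReal.mul_lt_top ENNReal.coe_lt_top orthInt_gaussian_lt_top).ne
    · exact ENNReal.coe_ne_top
  · have h0' : ∀ᵐ p : R3 × ℝ × R3, p.1 ≠ 0 :=
      Measure.quasiMeasurePreserving_fst.ae h0
    filter_upwards [h0'] with p hp
    have hVp : ENNReal.ofReal ‖p.1‖ ≠ 0 := by simpa using hp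
    have hs : ∀ r, slab r ≠ ∞ := by
      intro r
      unfold slab
      by_cases h : r ∈ Set.Icc (-(1 / 2) : ℝ) (1 / 2)
      · rw [Set.indicator_of_mem h]; simp
      · rw [Set.indicator_of_notMem h]; simp
    refine ENNReal.Tendsto.const_mul (ENNReal.Tendsto.const_mul (ENNReal.Tendsto.const_mul ?_
      (Or.inr (hs _))) (Or.inr (hs _))) (Or.inr (ENNReal.inv_ne_top.2 hVp))
    have hgc : Continuous fun y => g p.1 y := by
      simp only [hg]
      refine Continuous.ennreal_mul (by fun_prop) (ENNReal.continuous_ofReal.comp (by fun_prop))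
        (fun y => Or.inr ENNReal.ofReal_ne_top) (fun y => Or.inr ENNReal.coe_ne_top)
    have hlim : Filter.Tendsto (fun n : ℕ =>
        (p.2.1 / (((n : ℝ) + 1) * ‖p.1‖)) • dir p.1 + perp (dir p.1) p.2.2) Filter.atTop
        (𝓝 ((0 : ℝ) • dir p.1 + perp (dir p.1) p.2.2)) := by
      refine Filter.Tendsto.add_const _ (Filter.Tendsto.smul_const ?_ _)
      refine Filter.Tendsto.div_atTop tendsto_const_nhds ?_
      exact Filter.Tendsto.atTop_mul_const (norm_pos_iff.2 hp)
        (Filter.tendsto_atTop_add_const_right _ _ tendsto_natCast_atTop_atTop)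
    have := (hgc.tendsto _).comp hlim
    rw [zero_smul, zero_add] at this
    exact this

lemma measurable_uncurry_swap {F : R3 → R3 → ℝ≥0∞} (hF : Measurable (Function.uncurry F)) :
    Measurable (Function.uncurry fun V W => F W V) :=
  hF.comp measurable_swap

/-- The approximants depend on the constraint only through `V · y`, so they are symmetric by
Tonelli, and limits are unique. -/
lemma orthInt_swap_of_continuous (F : R3 × R3 →ᵇ ℝ≥0) :
    (orthInt fun V y => F (y, V) * ENNReal.ofReal (Real.exp (-(‖V‖ ^ 2 + ‖y‖ ^ 2)))) =
      orthInt fun V y => F (V, y) * ENNReal.ofReal (Real.exp (-(‖V‖ ^ 2 + ‖y‖ ^ 2))) := by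
  have h1 := tendsto_orthInt F
  have h2 := tendsto_orthInt (F.compContinuous ⟨Prod.swap, continuous_swap⟩)
  refine tendsto_nhds_unique h2 (h1.congr fun n => ?_)
  have hFm : Measurable F := F.continuous.measurable
  rw [lintegral_lintegral_swap (by fun_prop)]
  refine lintegral_congr fun V => lintegral_congr fun y => ?_
  simp [real_inner_comm, add_comm (‖y‖ ^ 2)]

/-- The measure `δ(V · W) dV dW` is symmetric. -/
theorem orthInt_swap {F : R3 → R3 → ℝ≥0∞} (hF : Measurable (Function.uncurry F)) :
    (orthInt fun V W => F W V) = orthInt F := by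
  let T : S2 × R3 → R3 × R3 := fun p => (inner ℝ p.2 (p.1 : R3) • (p.1 : R3), perp p.1 p.2)
  have hT : Measurable T := by fun_prop
  let d : S2 × R3 → ℝ≥0∞ := fun p => ENNReal.ofReal |inner ℝ p.2 (p.1 : R3)| *
    ENNReal.ofReal (Real.exp (-(‖(T p).1‖ ^ 2 + ‖(T p).2‖ ^ 2)))
  have hd : Measurable d := by fun_prop
  let ρ : Measure (R3 × R3) := ((surfaceMeasure.prod volume).withDensity d).map T
  have hρ : ∀ F : R3 → R3 → ℝ≥0∞, Measurable (Function.uncurry F) → ∫⁻ p, F p.1 p.2 ∂ρ =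
      2 * orthInt fun V W => F V W * ENNReal.ofReal (Real.exp (-(‖V‖ ^ 2 + ‖W‖ ^ 2))) := by
    intro F hF
    have hF' : Measurable fun p : R3 × R3 => F p.1 p.2 := hF
    have hFT : Measurable fun p => F (T p).1 (T p).2 := hF'.comp hT
    have hm : Measurable (Function.uncurry fun V W => F V W *
        ENNReal.ofReal (Real.exp (-(‖V‖ ^ 2 + ‖W‖ ^ 2)))) := by
      refine hF'.mul ?_
      fun_prop
    rw [← lintegral_inner_mul_eq_orthInt hm, lintegral_map hF' hT,
      lintegral_withDensity_eq_lintegral_mul _ hd hFT, lintegral_prod _ (hd.mul hFT).aemeasurable]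
    refine lintegral_congr fun ω => lintegral_congr fun z => ?_
    simp only [Pi.mul_apply, d, T]
    ring
  have hfin : IsFiniteMeasure ρ := by
    refine ⟨?_⟩
    have := hρ (fun _ _ => 1) measurable_const
    rw [lintegral_one] at this
    rw [this]
    simpa using ENNReal.mul_lt_top ENNReal.ofNat_lt_top orthInt_gaussian_lt_top
  -- The Gaussian weight makes `ρ` finite, so bounded continuous test functions determine it.
  have hsymm : ρ = ρ.map Prod.swap := by
    refine ext_of_forall_lintegral_eq_of_IsFiniteMeasure fun f => ?_
    have hfm : Measurable f := f.continuous.measurable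
    rw [lintegral_map (by fun_prop) measurable_swap]
    have h1 := hρ (fun V W => f (V, W)) (by simp only [Function.uncurry_def]; fun_prop)
    have h2 := hρ (fun V W => f (W, V)) (by simp only [Function.uncurry_def]; fun_prop)
    rw [orthInt_swap_of_continuous f, ← h1] at h2
    exact h2.symm
  -- This factor undoes the Gaussian weight and frees the identity from any integrability assumption
  -- on `F`.
  set e : R3 → R3 → ℝ≥0∞ := fun V W => ENNReal.ofReal (Real.exp (‖V‖ ^ 2 + ‖W‖ ^ 2)) with he
  have hm : Measurable (Function.uncurry fun V W => F V W * e V W) := by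
    refine hF.mul ?_
    simp only [he]; fun_prop
  have key : ∀ V W, e V W * ENNReal.ofReal (Real.exp (-(‖V‖ ^ 2 + ‖W‖ ^ 2))) = 1 := by
    intro V W
    rw [← ENNReal.ofReal_mul (Real.exp_pos _).le, ← Real.exp_add]; simp
  have hsw : ∀ V W, e V W = e W V := fun V W => by simp only [he, add_comm]
  have h1 := hρ _ hm
  have h2 := hρ _ (measurable_uncurry_swap hm)
  have hm' : Measurable fun p : R3 × R3 => F p.1 p.2 * e p.1 p.2 := hm
  rw [hsymm, lintegral_map hm' measurable_swap] at h1
  simp only [mul_assoc, key, mul_one] at h1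
  have h3 : (2 : ℝ≥0∞) * (orthInt fun V W => F W V) = 2 * orthInt F := by
    rw [← h1]
    simp only [mul_assoc] at h2
    simp only [Prod.fst_swap, Prod.snd_swap]
    rw [h2]
    congr 2
    funext V W
    rw [hsw W V, key, mul_one]
  exact (ENNReal.mul_right_inj two_ne_zero ENNReal.ofNat_ne_top).1 h3

/-- Exchange of the components of `z` parallel and orthogonal to `ω`. -/
theorem lintegral_inner_mul_swap {F : R3 → R3 → ℝ≥0∞} (hF : Measurable (Function.uncurry F)) :
    ∫⁻ ω : S2, (∫⁻ z, ENNReal.ofReal |inner ℝ z (ω : R3)| *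
      F (perp ω z) (inner ℝ z (ω : R3) • (ω : R3))) ∂surfaceMeasure =
    ∫⁻ ω : S2, (∫⁻ z, ENNReal.ofReal |inner ℝ z (ω : R3)| *
      F (inner ℝ z (ω : R3) • (ω : R3)) (perp ω z)) ∂surfaceMeasure := by
  rw [lintegral_inner_mul_eq_orthInt hF, ← orthInt_swap hF,
    ← lintegral_inner_mul_eq_orthInt (measurable_uncurry_swap hF)]

/-! ### Integrals over the sphere -/

/-- Transfers rotation invariance and slicing from Lebesgue measure to the sphere; the 3 is the
inverse of `∫₀¹ r² dr`. -/
lemma lintegral_sphere_eq_ball {g : R3 → ℝ≥0∞} (hg : Measurable g) :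
    ∫⁻ ω : S2, g ω ∂surfaceMeasure = 3 * ∫⁻ x in Metric.ball (0 : R3) 1, g (dir x) := by
  have hm : Measurable ((Metric.ball (0 : R3) 1).indicator fun x => g (dir x)) :=
    (hg.comp measurable_dir).indicator measurableSet_ball
  rw [← lintegral_indicator measurableSet_ball, lintegral_polar hm]
  have h1 : ∀ ω : S2, ∫⁻ r in Set.Ioi (0 : ℝ), ENNReal.ofReal (r ^ 2) *
      (Metric.ball (0 : R3) 1).indicator (fun x => g (dir x)) (r • (ω : R3)) = 3⁻¹ * g ω := by
    intro ω
    have hω : ‖(ω : R3)‖ = 1 := by simp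
    have h2 : ∀ r ∈ Set.Ioi (0 : ℝ), ENNReal.ofReal (r ^ 2) *
        (Metric.ball (0 : R3) 1).indicator (fun x => g (dir x)) (r • (ω : R3)) =
        (Set.Iio (1 : ℝ)).indicator (fun r => ENNReal.ofReal (r ^ 2)) r * g ω := by
      intro r hr
      have hr : 0 < r := hr
      have hn : ‖r • (ω : R3)‖ = r := by rw [norm_smul, hω]; simp [abs_of_pos hr]
      by_cases h : r < 1
      · rw [Set.indicator_of_mem (by simpa [hn] using h), Set.indicator_of_mem (by simpa using h),
          dir_smul_of_pos hω hr]
      · rw [Set.indicator_of_notMem (by simpa [hn] using h),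
          Set.indicator_of_notMem (by simpa using h)]; simp
    rw [setLIntegral_congr_fun measurableSet_Ioi h2, lintegral_mul_const]
    · congr 1
      rw [lintegral_indicator measurableSet_Iio, Measure.restrict_restrict measurableSet_Iio,
        Set.inter_comm, Set.Ioi_inter_Iio, Measure.restrict_congr_set (Ioo_ae_eq_Ioc),
        ← ofReal_integral_eq_lintegral_ofReal
          (intervalIntegral.intervalIntegrable_pow (μ := volume) (a := 0) (b := 1) 2).1
          (Filter.Eventually.of_forall fun r => by positivity),
        ← intervalIntegral.integral_of_le zero_le_one, integral_pow]
      norm_num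
      rw [ENNReal.ofReal_div_of_pos (by norm_num)]
      simp
    · exact Measurable.indicator (by fun_prop) measurableSet_Iio
  simp_rw [h1]
  rw [lintegral_const_mul _ (by fun_prop), ← mul_assoc,
    ENNReal.mul_inv_cancel (by norm_num) (by norm_num), one_mul]

lemma lintegral_sphere_comp_isometry (Q : R3 ≃ₗᵢ[ℝ] R3) {g : R3 → ℝ≥0∞} (hg : Measurable g) :
    ∫⁻ ω : S2, g (Q ω) ∂surfaceMeasure = ∫⁻ ω : S2, g ω ∂surfaceMeasure := by
  rw [lintegral_sphere_eq_ball hg,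
    lintegral_sphere_eq_ball (g := fun x => g (Q x)) (hg.comp Q.continuous.measurable)]
  congr 1
  have h := Q.measurePreserving.setLIntegral_comp_preimage
    (s := Metric.ball (0 : R3) 1) measurableSet_ball
    (f := fun x => g (dir x)) (hg.comp measurable_dir)
  have h2 : Q ⁻¹' Metric.ball (0 : R3) 1 = Metric.ball (0 : R3) 1 := by
    ext x; simp
  rw [h2] at h
  rw [← h]
  refine lintegral_congr fun x => ?_
  simp [dir]

/-- Vectors of equal length are exchanged by a reflection, under which the surface measure is
invariant. -/
lemma lintegral_sphere_inner_eq {q : ℝ → ℝ≥0∞} (hq : Measurable q) {a c : R3} (h : ‖a‖ = ‖c‖) :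
    ∫⁻ ω : S2, q (inner ℝ a (ω : R3)) ∂surfaceMeasure =
      ∫⁻ ω : S2, q (inner ℝ c (ω : R3)) ∂surfaceMeasure := by
  let Q : R3 ≃ₗᵢ[ℝ] R3 := (Submodule.span ℝ {a - c})ᗮ.reflection
  have hQ : Q a = c := Submodule.reflection_sub h
  rw [← lintegral_sphere_comp_isometry Q (g := fun x => q (inner ℝ c x)) (by fun_prop)]
  refine lintegral_congr fun ω => ?_
  rw [← hQ, Q.inner_map_map]

/-- On the slab the normal component is at most 1/2 in absolute value, so inserting its Gaussian
costs less than a factor `e`. -/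
lemma planeInt_gaussian_le {ω : R3} (hω : ‖ω‖ = 1) :
    planeInt ω (fun w => ENNReal.ofReal (Real.exp (-‖w‖ ^ 2))) ≤
      ENNReal.ofReal (Real.exp 1) * ∫⁻ x : R3, ENNReal.ofReal (Real.exp (-1 * ‖x‖ ^ 2)) := by
  rw [planeInt, ← lintegral_const_mul _ (by fun_prop)]
  refine lintegral_mono fun x => ?_
  unfold slab
  by_cases h : inner ℝ x ω ∈ Set.Icc (-(1 / 2) : ℝ) (1 / 2)
  · simp only [Set.indicator_of_mem h, Pi.one_apply, one_mul]
    rw [← ENNReal.ofReal_mul (Real.exp_pos _).le, ← Real.exp_add]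
    refine ENNReal.ofReal_le_ofReal (Real.exp_le_exp.2 ?_)
    rw [norm_sq_eq_perp hω x]
    nlinarith [h.1, h.2]
  · rw [Set.indicator_of_notMem h, zero_mul]; exact zero_le

/-- The Gaussian in the direction of `z` has mass at most of order `1 / |z|` on the sphere. -/
lemma exists_sphere_gaussian_le : ∃ C : ℝ, 0 < C ∧ ∀ z : R3,
    ENNReal.ofReal ‖z‖ * ∫⁻ ω : S2, ENNReal.ofReal (Real.exp (-(inner ℝ z (ω : R3)) ^ 2 / 32))
      ∂surfaceMeasure ≤ ENNReal.ofReal (C * min ‖z‖ 1) := by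
  set I3 := ∫⁻ x : R3, ENNReal.ofReal (Real.exp (-1 * ‖x‖ ^ 2)) with hI3
  have hI3f : I3 < ∞ := lintegral_gaussian_lt_top one_pos
  set I1 := ∫⁻ s : ℝ, ENNReal.ofReal (Real.exp (-(1 / 32) * s ^ 2)) with hI1
  have hI1f : I1 < ∞ := (integrable_exp_neg_mul_sq (by norm_num)).lintegral_lt_top
  set D : ℝ≥0∞ := surfaceMeasure Set.univ +
    3 * (ENNReal.ofReal (Real.exp 1) * (I1 * (ENNReal.ofReal (Real.exp 1) * I3))) with hD
  have hDf : D < ∞ := by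
    refine ENNReal.add_lt_top.2 ⟨measure_lt_top _ _, ?_⟩
    refine ENNReal.mul_lt_top (by simp) (ENNReal.mul_lt_top ENNReal.ofReal_lt_top
      (ENNReal.mul_lt_top hI1f (ENNReal.mul_lt_top ENNReal.ofReal_lt_top hI3f)))
  refine ⟨D.toReal + 1, by positivity, fun z => ?_⟩
  have hD1 : D ≤ ENNReal.ofReal (D.toReal + 1) := by
    conv_lhs => rw [← ENNReal.ofReal_toReal hDf.ne]
    exact ENNReal.ofReal_le_ofReal (by linarith)
  rw [ENNReal.ofReal_mul (by positivity)]
  have b1 : ∫⁻ ω : S2, ENNReal.ofReal (Real.exp (-(inner ℝ z (ω : R3)) ^ 2 / 32))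
      ∂surfaceMeasure ≤ D := by
    calc _ ≤ ∫⁻ ω : S2, 1 ∂surfaceMeasure := by
          refine lintegral_mono fun ω => ?_
          rw [← ENNReal.ofReal_one]
          refine ENNReal.ofReal_le_ofReal (Real.exp_le_one_iff.2 ?_)
          have := sq_nonneg (inner ℝ z (ω : R3))
          linarith
      _ = surfaceMeasure Set.univ := by simp
      _ ≤ D := le_self_add
  rcases le_total ‖z‖ 1 with hz | hz
  · rw [min_eq_left hz, mul_comm]
    gcongr
    exact b1.trans hD1
  · rw [min_eq_right hz, ENNReal.ofReal_one, mul_one]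
    refine le_trans ?_ hD1
    have hz0 : z ≠ 0 := by rintro rfl; simp at hz; linarith
    have hzp : 0 < ‖z‖ := norm_pos_iff.2 hz0
    have hω := norm_dir hz0
    have hin : ∀ x, inner ℝ z x = ‖z‖ * inner ℝ x (dir z) := by
      intro x
      rw [dir, real_inner_smul_right, ← mul_assoc, mul_inv_cancel₀ hzp.ne', one_mul,
        real_inner_comm]
    rw [lintegral_sphere_eq_ball (g := fun x =>
      ENNReal.ofReal (Real.exp (-(inner ℝ z x) ^ 2 / 32))) (by fun_prop)]
    -- For `|x| < 1` replacing `dir x` by `x` only decreases the squared inner product, and `exp(1 -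
    -- |perp x|²) ≥ 1`. The enlarged integrand is integrable on all of `ℝ³` and splits into a normal
    -- and a planar Gaussian; rescaling the normal one gives `1/|z|`.
    have b2 : ∫⁻ x in Metric.ball (0 : R3) 1,
        ENNReal.ofReal (Real.exp (-(inner ℝ z (dir x)) ^ 2 / 32)) ≤
        ∫⁻ x : R3, ENNReal.ofReal (Real.exp 1) *
          (ENNReal.ofReal (Real.exp (-(1 / 32) * (‖z‖ * inner ℝ x (dir z)) ^ 2)) *
          ENNReal.ofReal (Real.exp (-‖perp (dir z) x‖ ^ 2))) := by
      rw [← lintegral_indicator measurableSet_ball]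
      refine lintegral_mono fun x => ?_
      by_cases hx : x ∈ Metric.ball (0 : R3) 1
      · rw [Set.indicator_of_mem hx, ← ENNReal.ofReal_mul (Real.exp_pos _).le, ← Real.exp_add,
          ← ENNReal.ofReal_mul (Real.exp_pos _).le, ← Real.exp_add]
        refine ENNReal.ofReal_le_ofReal (Real.exp_le_exp.2 ?_)
        have hx1 : ‖x‖ < 1 := by simpa using hx
        have h3 := norm_sq_eq_perp hω x
        rw [← hin]
        have h4 : (inner ℝ z x) ^ 2 ≤ (inner ℝ z (dir x)) ^ 2 := by
          by_cases hx0 : x = 0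
          · subst hx0; simp [dir]
          have hxp : 0 < ‖x‖ := norm_pos_iff.2 hx0
          have : inner ℝ z x = ‖x‖ * inner ℝ z (dir x) := by
            rw [dir, real_inner_smul_right, ← mul_assoc, mul_inv_cancel₀ hxp.ne', one_mul]
          rw [this, mul_pow]
          have h5 : ‖x‖ ^ 2 ≤ 1 := by nlinarith [norm_nonneg x]
          nlinarith [sq_nonneg (inner ℝ z (dir x))]
        have h6 : ‖perp (dir z) x‖ ^ 2 ≤ 1 := by
          have h5 : ‖x‖ ^ 2 ≤ 1 := by nlinarith [norm_nonneg x]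
          nlinarith [sq_nonneg (inner ℝ x (dir z))]
        linarith
      · rw [Set.indicator_of_notMem hx]; exact zero_le
    have b3 : ∫⁻ x : R3, ENNReal.ofReal (Real.exp 1) *
          (ENNReal.ofReal (Real.exp (-(1 / 32) * (‖z‖ * inner ℝ x (dir z)) ^ 2)) *
          ENNReal.ofReal (Real.exp (-‖perp (dir z) x‖ ^ 2))) =
        ENNReal.ofReal (Real.exp 1) * ((ENNReal.ofReal ‖z‖⁻¹ * I1) *
          planeInt (dir z) (fun w => ENNReal.ofReal (Real.exp (-‖w‖ ^ 2)))) := by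
      rw [lintegral_const_mul _ (by fun_prop), lintegral_eq_lintegral_planeInt hω
        (G := fun s w => ENNReal.ofReal (Real.exp (-(1 / 32) * (‖z‖ * s) ^ 2)) *
          ENNReal.ofReal (Real.exp (-‖w‖ ^ 2))) (by unfold Function.uncurry; fun_prop)]
      congr 1
      have : ∀ s : ℝ, planeInt (dir z)
          (fun w => ENNReal.ofReal (Real.exp (-(1 / 32) * (‖z‖ * s) ^ 2)) *
            ENNReal.ofReal (Real.exp (-‖w‖ ^ 2))) = _ :=
        fun s => planeInt_const_mul _ (by fun_prop) _
      simp_rw [this]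
      rw [lintegral_mul_const _ (by fun_prop)]
      congr 1
      have h7 := lintegral_comp_smul (volume : Measure ℝ)
        (f := fun s => ENNReal.ofReal (Real.exp (-(1 / 32) * s ^ 2))) (by fun_prop) hzp.ne'
      simp only [smul_eq_mul] at h7
      rw [h7]
      simp [abs_of_pos hzp, hI1]
    calc _ ≤ ENNReal.ofReal ‖z‖ * (3 * (ENNReal.ofReal (Real.exp 1) *
          ((ENNReal.ofReal ‖z‖⁻¹ * I1) * (ENNReal.ofReal (Real.exp 1) * I3)))) := by
          refine mul_le_mul_right (mul_le_mul_right (b2.trans (b3.le.trans ?_)) _) _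
          gcongr
          exact planeInt_gaussian_le hω
      _ = (ENNReal.ofReal ‖z‖ * ENNReal.ofReal ‖z‖⁻¹) *
          (3 * (ENNReal.ofReal (Real.exp 1) * (I1 * (ENNReal.ofReal (Real.exp 1) * I3)))) := by
          ring
      _ ≤ D := by
          rw [← ENNReal.ofReal_mul hzp.le, mul_inv_cancel₀ hzp.ne', ENNReal.ofReal_one, one_mul]
          exact le_add_self

/-! ### The weighted singular integral that fixes the exponent -/

lemma IsHolderExponent.pos {γ α : ℝ} (hα : IsHolderExponent γ α) (hγ : -3 < γ) : 0 < α := by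
  rcases hα with ⟨_, h⟩ | ⟨_, h, _⟩ | ⟨_, h⟩ <;> linarith

lemma IsHolderExponent.le_one {γ α : ℝ} (hα : IsHolderExponent γ α) : α ≤ 1 := by
  rcases hα with ⟨_, h⟩ | ⟨_, _, h⟩ | ⟨_, h⟩ <;> linarith

lemma lintegral_ball_rpow_lt_top {p : ℝ} (hp : -3 < p) :
    ∫⁻ z in Metric.ball (0 : R3) 1, ENNReal.ofReal (‖z‖ ^ p) < ∞ := by
  have h : IntegrableOn (fun z : R3 => ‖z‖ ^ p) (Metric.ball (0 : R3) 1) := by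
    rw [integrableOn_fun_norm_addHaar volume (f := fun y => y ^ p)]
    have h1 : IntegrableOn (fun y : ℝ => y ^ (p + 2)) (Set.Ioo 0 1) :=
      ((intervalIntegral.intervalIntegrable_rpow' (a := 0) (b := 1)
        (by linarith : -1 < p + 2)).1).mono_set Set.Ioo_subset_Ioc_self
    refine h1.congr_fun (fun y hy => ?_) measurableSet_Ioo
    have : (y : ℝ) ^ (p + 2) = y ^ p * y ^ 2 := by
      rw [Real.rpow_add hy.1]; norm_cast
    simp [this, mul_comm]
  exact h.lintegral_lt_top

/-- The integrand is `|z|^γ` near 0, integrable as `γ > -3`, and `|z|^(γ-1)` at infinity, integrable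
as `γ < -2`. -/
lemma lintegral_rpow_mul_min_lt_top {γ : ℝ} (hγ : -3 < γ) (hγ2 : γ < -2) :
    ∫⁻ z : R3, ENNReal.ofReal (‖z‖ ^ (γ - 1) * min ‖z‖ 1) < ∞ := by
  have h : Integrable (fun z : R3 => ‖z‖ ^ (γ - 1) * min ‖z‖ 1) := by
    rw [integrable_fun_norm_addHaar volume (f := fun y => y ^ (γ - 1) * min y 1)]
    rw [← Set.Ioc_union_Ioi_eq_Ioi (zero_le_one (α := ℝ))]
    refine IntegrableOn.union ?_ ?_
    · refine ((intervalIntegral.intervalIntegrable_rpow' (a := 0) (b := 1)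
        (by linarith : -1 < γ + 2)).1).congr_fun (fun y hy => ?_) measurableSet_Ioc
      have : (y : ℝ) ^ (γ + 2) = y ^ (γ - 1) * y ^ 3 := by
        rw [← Real.rpow_natCast y 3, ← Real.rpow_add hy.1]; norm_num; ring_nf
      simp [this, min_eq_left hy.2]; ring
    · refine (integrableOn_Ioi_rpow_of_lt (a := γ + 1) (by linarith) one_pos).congr_fun
        (fun y hy => ?_) measurableSet_Ioi
      have hy1 : 1 < y := hy
      have : (y : ℝ) ^ (γ + 1) = y ^ (γ - 1) * y ^ 2 := by
        rw [← Real.rpow_natCast y 2, ← Real.rpow_add (by linarith)]; norm_num; ring_nf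
      simp [this, min_eq_right hy1.le]; ring
  exact h.lintegral_lt_top

/-- Interpolating `min(|z|, h) ≤ |z|^(1-α) h^α` leaves `|z|^(γ-α)`, integrable on the ball if `γ - α
> -3`; this covers `γ ≥ -2`. For `γ < -2` one has `γ - α = -3`, where interpolation would lose a
logarithm; scaling `z = hx` over the whole space gives exactly `h^(3+γ)`. -/
lemma exists_lintegral_ball_le {γ α : ℝ} (hγ : -3 < γ) (hα : IsHolderExponent γ α) :
    ∃ D : ℝ≥0∞, D < ∞ ∧ ∀ h : ℝ, 0 < h → h ≤ 1 →
      ∫⁻ z in Metric.ball (0 : R3) 1, ENNReal.ofReal (‖z‖ ^ (γ - 1) * min ‖z‖ h) ≤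
        D * ENNReal.ofReal (h ^ α) := by
  have hα0 := hα.pos hγ
  have hα1 := hα.le_one
  have easy : -3 < γ - α → ∃ D : ℝ≥0∞, D < ∞ ∧ ∀ h : ℝ, 0 < h → h ≤ 1 →
      ∫⁻ z in Metric.ball (0 : R3) 1, ENNReal.ofReal (‖z‖ ^ (γ - 1) * min ‖z‖ h) ≤
        D * ENNReal.ofReal (h ^ α) := by
    intro hp
    refine ⟨_, lintegral_ball_rpow_lt_top hp, fun h h0 _ => ?_⟩
    rw [← lintegral_mul_const _ (by fun_prop)]
    refine lintegral_mono fun z => ?_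
    by_cases hz : z = 0
    · subst hz; simp [h0.le]
    rw [← ENNReal.ofReal_mul (by positivity)]
    refine ENNReal.ofReal_le_ofReal ?_
    have hzp : 0 < ‖z‖ := norm_pos_iff.2 hz
    have hm : 0 < min ‖z‖ h := lt_min hzp h0
    have h1 : min ‖z‖ h ≤ ‖z‖ ^ (1 - α) * h ^ α := by
      calc min ‖z‖ h = (min ‖z‖ h) ^ (1 - α) * (min ‖z‖ h) ^ α := by
            rw [← Real.rpow_add hm]; simp
        _ ≤ _ := by
            gcongr
            · exact min_le_left _ _
            · exact min_le_right _ _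
    calc _ ≤ ‖z‖ ^ (γ - 1) * (‖z‖ ^ (1 - α) * h ^ α) := by gcongr
      _ = _ := by rw [← mul_assoc, ← Real.rpow_add hzp]; ring_nf
  rcases hα with ⟨h1, h2⟩ | ⟨h1, _, h2⟩ | ⟨h1, h2⟩
  · exact easy (by linarith)
  · exact easy (by linarith)
  · refine ⟨_, lintegral_rpow_mul_min_lt_top hγ h1, fun h h0 _ => ?_⟩
    refine (setLIntegral_le_lintegral _ _).trans ?_
    have e := lintegral_comp_smul (volume : Measure R3)
      (f := fun z => ENNReal.ofReal (‖z‖ ^ (γ - 1) * min ‖z‖ h)) (by fun_prop) h0.ne'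
    have e2 : ∀ x : R3, ENNReal.ofReal (‖h • x‖ ^ (γ - 1) * min ‖h • x‖ h) =
        ENNReal.ofReal (h ^ γ) * ENNReal.ofReal (‖x‖ ^ (γ - 1) * min ‖x‖ 1) := by
      intro x
      rw [← ENNReal.ofReal_mul (by positivity)]
      congr 1
      have : min (h * ‖x‖) h = h * min ‖x‖ 1 := by
        rw [mul_min_of_nonneg _ _ h0.le, mul_one]
      rw [norm_smul, Real.norm_of_nonneg h0.le, Real.mul_rpow h0.le (norm_nonneg _), this]
      have : h ^ γ = h ^ (γ - 1) * h := by
        rw [Real.rpow_sub_one h0.ne']; field_simp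
      rw [this]; ring
    simp_rw [e2] at e
    rw [lintegral_const_mul _ (by fun_prop)] at e
    have h3 : ENNReal.ofReal (h ^ 3) * ENNReal.ofReal |(h ^ Module.finrank ℝ R3)⁻¹| = 1 := by
      rw [← ENNReal.ofReal_mul (by positivity)]
      simp [abs_of_pos h0, mul_inv_cancel₀ (pow_ne_zero 3 h0.ne')]
    have e3 : ∫⁻ z : R3, ENNReal.ofReal (‖z‖ ^ (γ - 1) * min ‖z‖ h) =
        ENNReal.ofReal (h ^ 3) * (ENNReal.ofReal (h ^ γ) *
          ∫⁻ x : R3, ENNReal.ofReal (‖x‖ ^ (γ - 1) * min ‖x‖ 1)) := by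
      rw [e, ← mul_assoc, h3, one_mul]
    rw [e3, ← mul_assoc, ← ENNReal.ofReal_mul (by positivity), mul_comm]
    refine le_of_eq ?_
    congr 2
    rw [h2, Real.rpow_add h0]
    norm_cast

/-- The rate 1/32 is half of the available `exp(-|u|²/16)`, so that a Gaussian in `u` is left over.
-/
lemma exists_one_add_rpow_le_exp (p : ℝ) :
    ∃ c : ℝ, 0 < c ∧ ∀ x : ℝ, 0 ≤ x → (1 + x) ^ p ≤ c * Real.exp (x / 32) := by
  obtain ⟨n, hn⟩ := exists_nat_ge p
  refine ⟨n.factorial * 32 ^ n * Real.exp (1 / 32), by positivity, fun x hx => ?_⟩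
  have h1 : (1 + x) ^ p ≤ (1 + x) ^ n := by
    rw [← Real.rpow_natCast]
    exact Real.rpow_le_rpow_of_exponent_le (by linarith) hn
  have h2 := Real.pow_div_factorial_le_exp ((1 + x) / 32) (by positivity) n
  rw [div_pow, div_div, div_le_iff₀ (by positivity)] at h2
  refine h1.trans (h2.trans (le_of_eq ?_))
  rw [add_div, Real.exp_add]; ring

lemma bracket_pos (v : R3) (s : ℝ) : 0 < bracket v s := by unfold bracket; positivity

/-- Peetre's inequality applied to the weight `⟨v⟩^(γ - 1)`. -/
lemma exists_weight_le {γ : ℝ} (hγ' : γ < 0) : ∃ c : ℝ, 0 < c ∧ ∀ (h : ℝ), 0 < h → ∀ u v : R3,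
    ‖u - v‖ ^ (γ - 1) * min ‖u - v‖ h * Real.exp (-‖u‖ ^ 2 / 16) ≤
      c * bracket v (γ - 1) * ((Metric.ball (0 : R3) 1).indicator
        (fun z => ‖z‖ ^ (γ - 1) * min ‖z‖ h) (u - v) + h * Real.exp (-(1 / 32) * ‖u‖ ^ 2)) := by
  set p := (1 - γ) / 2 with hp
  have hp0 : 0 < p := by rw [hp]; linarith
  obtain ⟨c, hc, hce⟩ := exists_one_add_rpow_le_exp p
  refine ⟨c * 4 ^ p, by positivity, fun h h0 u v => ?_⟩
  set z := u - v with hz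
  set ψ := ‖z‖ ^ (γ - 1) * min ‖z‖ h with hψ
  have hψ0 : 0 ≤ ψ := by positivity
  have hbr : bracket v (γ - 1) = ((1 + ‖v‖ ^ 2) ^ p)⁻¹ := by
    rw [bracket, ← Real.rpow_neg (by positivity)]; congr 1; rw [hp]; ring
  have hV : 0 < (1 + ‖v‖ ^ 2) ^ p := by positivity
  have peetre : (1 + ‖v‖ ^ 2) ^ p ≤ 2 ^ p * (1 + ‖z‖ ^ 2) ^ p * (1 + ‖u‖ ^ 2) ^ p := by
    rw [← Real.mul_rpow (by positivity) (by positivity),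
      ← Real.mul_rpow (by positivity) (by positivity)]
    gcongr
    have h1 : ‖v‖ ≤ ‖u‖ + ‖z‖ := by
      have : v = u - z := by rw [hz]; abel
      rw [this]; exact norm_sub_le _ _
    have h2 := norm_nonneg v
    nlinarith [sq_nonneg (‖u‖ - ‖z‖), mul_nonneg (sq_nonneg ‖u‖) (sq_nonneg ‖z‖)]
  have h1 := hce (‖u‖ ^ 2) (by positivity)
  have hexp : Real.exp (‖u‖ ^ 2 / 32) * Real.exp (-‖u‖ ^ 2 / 16) =
      Real.exp (-(1 / 32) * ‖u‖ ^ 2) := by rw [← Real.exp_add]; congr 1; ring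
  -- Near `z = 0` the weight is bounded and the Gaussian is dropped. Far away `|z|^(γ-1)` cancels
  -- `|z|^(2p)` exactly, because `2p = 1 - γ`; only `h` times the Gaussian remains.
  have h2 : ψ * (1 + ‖z‖ ^ 2) ^ p * Real.exp (-(1 / 32) * ‖u‖ ^ 2) ≤ 2 ^ p *
      ((Metric.ball (0 : R3) 1).indicator
        (fun z => ‖z‖ ^ (γ - 1) * min ‖z‖ h) z + h * Real.exp (-(1 / 32) * ‖u‖ ^ 2)) := by
    by_cases hz1 : ‖z‖ < 1
    · rw [Set.indicator_of_mem (by simpa using hz1)]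
      have h3 : (1 + ‖z‖ ^ 2) ^ p ≤ 2 ^ p := by
        gcongr; nlinarith [norm_nonneg z]
      have h4 : Real.exp (-(1 / 32) * ‖u‖ ^ 2) ≤ 1 :=
        Real.exp_le_one_iff.2 (by nlinarith [sq_nonneg ‖u‖])
      calc _ ≤ ψ * 2 ^ p * 1 := by gcongr
        _ = 2 ^ p * ψ := by ring
        _ ≤ _ := by
          gcongr
          exact le_add_of_nonneg_right (by positivity)
    · rw [Set.indicator_of_notMem (by simpa using hz1), zero_add]
      have hz1 : 1 ≤ ‖z‖ := not_lt.1 hz1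
      have hzp : 0 < ‖z‖ := by linarith
      have h3 : (1 + ‖z‖ ^ 2) ^ p ≤ 2 ^ p * ‖z‖ ^ (2 * p) := by
        rw [Real.rpow_mul hzp.le, ← Real.mul_rpow (by norm_num) (by positivity)]
        gcongr
        norm_cast
        nlinarith
      have h4 : ψ ≤ ‖z‖ ^ (γ - 1) * h := by
        rw [hψ]; gcongr; exact min_le_right _ _
      have h5 : ‖z‖ ^ (γ - 1) * ‖z‖ ^ (2 * p) = 1 := by
        rw [← Real.rpow_add hzp, hp]; ring_nf; simp
      calc _ ≤ (‖z‖ ^ (γ - 1) * h) * (2 ^ p * ‖z‖ ^ (2 * p)) *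
            Real.exp (-(1 / 32) * ‖u‖ ^ 2) := by gcongr
        _ = (‖z‖ ^ (γ - 1) * ‖z‖ ^ (2 * p)) * (2 ^ p * (h * Real.exp (-(1 / 32) * ‖u‖ ^ 2))) := by
            ring
        _ = _ := by rw [h5, one_mul]
  rw [hbr]
  have h4p : (4 : ℝ) ^ p = 2 ^ p * 2 ^ p := by
    rw [← Real.mul_rpow (by norm_num) (by norm_num)]; norm_num
  rw [mul_right_comm (c * 4 ^ p), ← div_eq_mul_inv, le_div_iff₀ hV]
  calc ψ * Real.exp (-‖u‖ ^ 2 / 16) * (1 + ‖v‖ ^ 2) ^ p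
      ≤ ψ * Real.exp (-‖u‖ ^ 2 / 16) *
        (2 ^ p * (1 + ‖z‖ ^ 2) ^ p * (c * Real.exp (‖u‖ ^ 2 / 32))) := by
        gcongr
        exact peetre.trans (by gcongr)
    _ = c * 2 ^ p * (ψ * (1 + ‖z‖ ^ 2) ^ p *
        (Real.exp (‖u‖ ^ 2 / 32) * Real.exp (-‖u‖ ^ 2 / 16))) := by ring
    _ ≤ c * 2 ^ p * (2 ^ p * ((Metric.ball (0 : R3) 1).indicator
        (fun z => ‖z‖ ^ (γ - 1) * min ‖z‖ h) z + h * Real.exp (-(1 / 32) * ‖u‖ ^ 2))) := by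
        rw [hexp]; gcongr
    _ = _ := by rw [h4p]; ring

/-- The basic weighted estimate to which all kernel bounds are reduced. -/
theorem exists_lintegral_weight_le {γ α : ℝ} (hγ : -3 < γ) (hγ' : γ < 0)
    (hα : IsHolderExponent γ α) : ∃ C : ℝ, 0 < C ∧ ∀ h : ℝ, 0 < h → h ≤ 1 → ∀ v : R3,
      ∫⁻ u, ENNReal.ofReal (‖u - v‖ ^ (γ - 1) * min ‖u - v‖ h * Real.exp (-‖u‖ ^ 2 / 16)) ≤
        ENNReal.ofReal (C * (h ^ α * bracket v (γ - 1))) := by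
  obtain ⟨D, hD, hDle⟩ := exists_lintegral_ball_le hγ hα
  obtain ⟨c, hc, hcle⟩ := exists_weight_le hγ'
  set G := ∫⁻ u : R3, ENNReal.ofReal (Real.exp (-(1 / 32) * ‖u‖ ^ 2)) with hG
  have hGf : G < ∞ := lintegral_gaussian_lt_top (by norm_num)
  refine ⟨c * (D + G).toReal + 1, by positivity, fun h h0 h1 v => ?_⟩
  have hb := bracket_pos v (γ - 1)
  -- Lets the far part, which is linear in `h`, be counted as `h^α`.
  have hhα : h ≤ h ^ α := by
    simpa using Real.rpow_le_rpow_of_exponent_ge h0 h1 hα.le_one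
  have hind : ∀ z : R3, 0 ≤ (Metric.ball (0 : R3) 1).indicator
      (fun z => ‖z‖ ^ (γ - 1) * min ‖z‖ h) z := fun z =>
    Set.indicator_nonneg (fun z _ => by positivity) z
  have hm : Measurable ((Metric.ball (0 : R3) 1).indicator
      (fun z => ‖z‖ ^ (γ - 1) * min ‖z‖ h)) :=
    Measurable.indicator (by fun_prop) measurableSet_ball
  calc _ ≤ ∫⁻ u : R3, ENNReal.ofReal (c * bracket v (γ - 1)) *
        (ENNReal.ofReal ((Metric.ball (0 : R3) 1).indicator
        (fun z => ‖z‖ ^ (γ - 1) * min ‖z‖ h) (u - v)) +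
          ENNReal.ofReal h * ENNReal.ofReal (Real.exp (-(1 / 32) * ‖u‖ ^ 2))) := by
        refine lintegral_mono fun u => ?_
        rw [← ENNReal.ofReal_mul h0.le, ← ENNReal.ofReal_add (hind _) (by positivity),
          ← ENNReal.ofReal_mul (by positivity)]
        exact ENNReal.ofReal_le_ofReal (hcle h h0 u v)
    _ = ENNReal.ofReal (c * bracket v (γ - 1)) *
        ((∫⁻ z in Metric.ball (0 : R3) 1, ENNReal.ofReal (‖z‖ ^ (γ - 1) * min ‖z‖ h)) +
          ENNReal.ofReal h * G) := by
        have hm1 : Measurable fun u : R3 => ENNReal.ofReal ((Metric.ball (0 : R3) 1).indicator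
          (fun z => ‖z‖ ^ (γ - 1) * min ‖z‖ h) (u - v)) := by
          exact (hm.comp (measurable_id.sub_const v)).ennreal_ofReal
        rw [lintegral_const_mul _ (by fun_prop), lintegral_add_left hm1,
          lintegral_const_mul _ (by fun_prop),
          lintegral_sub_right_eq_self (fun z => ENNReal.ofReal ((Metric.ball (0 : R3) 1).indicator
            (fun z => ‖z‖ ^ (γ - 1) * min ‖z‖ h) z)), ← lintegral_indicator measurableSet_ball]
        congr 2
        refine lintegral_congr fun z => ?_
        by_cases hz : z ∈ Metric.ball (0 : R3) 1
        · simp only [Set.indicator_of_mem hz]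
        · simp only [Set.indicator_of_notMem hz, ENNReal.ofReal_zero]
    _ ≤ ENNReal.ofReal (c * bracket v (γ - 1)) *
        (D * ENNReal.ofReal (h ^ α) + ENNReal.ofReal (h ^ α) * G) := by
        gcongr
        exact hDle h h0 h1
    _ = ENNReal.ofReal (c * bracket v (γ - 1)) * ENNReal.ofReal (h ^ α) * (D + G) := by ring
    _ = ENNReal.ofReal (c * bracket v (γ - 1)) * ENNReal.ofReal (h ^ α) *
        ENNReal.ofReal (D + G).toReal := by
        rw [ENNReal.ofReal_toReal (ENNReal.add_lt_top.2 ⟨hD, hGf⟩).ne]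
    _ = ENNReal.ofReal (c * (D + G).toReal * (h ^ α * bracket v (γ - 1))) := by
        rw [← ENNReal.ofReal_mul (by positivity), ← ENNReal.ofReal_mul (by positivity)]
        congr 1; ring
    _ ≤ _ := by
        refine ENNReal.ofReal_le_ofReal ?_
        gcongr
        linarith

/-! ### Pointwise differences of kernel densities -/

/-- The derivative of `exp(-r²/4)` carries a factor of order `r`, absorbed by halving the exponent.
If `q - r ≥ 1` there is nothing to gain from cancellation. -/
lemma abs_exp_sub_exp_le {r q : ℝ} (hr : 0 ≤ r) (hq : 0 ≤ q) :
    |Real.exp (-r ^ 2 / 4) - Real.exp (-q ^ 2 / 4)| ≤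
      |r - q| * (Real.exp (-r ^ 2 / 8) + Real.exp (-q ^ 2 / 8)) := by
  wlog h : r ≤ q generalizing r q
  · have := this hq hr (le_of_not_ge h)
    rwa [abs_sub_comm, abs_sub_comm r, add_comm (Real.exp (-r ^ 2 / 8))]
  have hle : Real.exp (-q ^ 2 / 4) ≤ Real.exp (-r ^ 2 / 4) :=
    Real.exp_le_exp.2 (by nlinarith)
  rw [abs_of_nonneg (by linarith), abs_of_nonpos (by linarith : r - q ≤ 0)]
  set E := Real.exp (-r ^ 2 / 8) with hE
  have hE0 : 0 < E := Real.exp_pos _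
  have hEE : Real.exp (-r ^ 2 / 4) = E * E := by rw [hE, ← Real.exp_add]; congr 1; ring
  have hE1 : E ≤ 1 := Real.exp_le_one_iff.2 (by nlinarith [sq_nonneg r])
  have hq0 := Real.exp_pos (-q ^ 2 / 4)
  have hq1 := Real.exp_pos (-q ^ 2 / 8)
  suffices hs : Real.exp (-r ^ 2 / 4) - Real.exp (-q ^ 2 / 4) ≤ (q - r) * E by nlinarith
  rcases le_total 1 (q - r) with h1 | h1
  · rw [hEE] at *; nlinarith
  · have h2 : Real.exp (-q ^ 2 / 4) = E * E * Real.exp (-((q ^ 2 - r ^ 2) / 4)) := by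
      rw [← hEE, ← Real.exp_add]; congr 1; ring
    have h3 := Real.add_one_le_exp (-((q ^ 2 - r ^ 2) / 4))
    have h4 : (2 * r + 1) / 4 * E ≤ 1 := by
      have h5 := Real.add_one_le_exp (r ^ 2 / 8)
      have h6 : Real.exp (r ^ 2 / 8) * E = 1 := by
        rw [hE, ← Real.exp_add, neg_div, add_neg_cancel, Real.exp_zero]
      have h7 : (2 * r + 1) / 4 ≤ Real.exp (r ^ 2 / 8) := by nlinarith [sq_nonneg (r - 2)]
      nlinarith
    have h8 : (q ^ 2 - r ^ 2) / 4 ≤ (q - r) * ((2 * r + 1) / 4) := by nlinarith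
    have h9 : E * E - E * E * Real.exp (-((q ^ 2 - r ^ 2) / 4)) ≤
        E * E * ((q ^ 2 - r ^ 2) / 4) := by nlinarith [mul_pos hE0 hE0]
    rw [h2, hEE]
    calc _ ≤ E * E * ((q - r) * ((2 * r + 1) / 4)) := h9.trans (by gcongr)
      _ = (q - r) * E * ((2 * r + 1) / 4 * E) := by ring
      _ ≤ (q - r) * E * 1 := by
          refine mul_le_mul_of_nonneg_left h4 (mul_nonneg (by linarith) hE0.le)
      _ = _ := mul_one _

/-- The product of two Gaussians of variance parameter `c`. -/
noncomputable def gaussPair (c : ℝ) (x y : R3) : ℝ := Real.exp (-(‖x‖ ^ 2 + ‖y‖ ^ 2) / c)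

lemma gaussPair_pos (c : ℝ) (x y : R3) : 0 < gaussPair c x y := Real.exp_pos _

lemma gaussPair_four_le (x y : R3) : gaussPair 4 x y ≤ gaussPair 8 x y := by
  refine Real.exp_le_exp.2 ?_
  have := sq_nonneg ‖x‖
  have := sq_nonneg ‖y‖
  linarith

/-- The pair is a single vector of the Euclidean sum `ℝ³ ⊕ ℝ³`, and the one-variable bound is
applied to its norm. -/
lemma abs_gaussPair_sub_le (x y x' y' : R3) :
    |gaussPair 4 x y - gaussPair 4 x' y'| ≤
      (‖x - x'‖ + ‖y - y'‖) * (gaussPair 8 x y + gaussPair 8 x' y') := by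
  let a : WithLp 2 (R3 × R3) := WithLp.toLp 2 (x, y)
  let c : WithLp 2 (R3 × R3) := WithLp.toLp 2 (x', y')
  have ha : ‖a‖ ^ 2 = ‖x‖ ^ 2 + ‖y‖ ^ 2 := WithLp.prod_norm_sq_eq_of_L2 a
  have hc : ‖c‖ ^ 2 = ‖x'‖ ^ 2 + ‖y'‖ ^ 2 := WithLp.prod_norm_sq_eq_of_L2 c
  have hac : ‖a - c‖ ^ 2 = ‖x - x'‖ ^ 2 + ‖y - y'‖ ^ 2 := WithLp.prod_norm_sq_eq_of_L2 (a - c)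
  have h1 := abs_exp_sub_exp_le (norm_nonneg a) (norm_nonneg c)
  have h2 : |‖a‖ - ‖c‖| ≤ ‖x - x'‖ + ‖y - y'‖ := by
    refine (abs_norm_sub_norm_le a c).trans ?_
    refine (sq_le_sq₀ (norm_nonneg _) (by positivity)).1 ?_
    rw [hac]
    nlinarith [mul_nonneg (norm_nonneg (x - x')) (norm_nonneg (y - y'))]
  rw [ha, hc] at h1
  refine h1.trans ?_
  refine mul_le_mul_of_nonneg_right h2 ?_
  positivity

/-- Mean value inequality on `[a/2, ∞)`; the constant is `3 · 16`, from `|γ| < 3` and `2^(1-γ) ≤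
16`. -/
lemma abs_rpow_sub_rpow_le {γ a c : ℝ} (hγ : -3 < γ) (hγ' : γ < 0) (ha : 0 < a)
    (hc : a / 2 ≤ c) : |a ^ γ - c ^ γ| ≤ 48 * a ^ (γ - 1) * |a - c| := by
  have hbound : ∀ x ∈ Set.Ici (a / 2), ‖γ * x ^ (γ - 1)‖ ≤ 48 * a ^ (γ - 1) := by
    intro x hx
    have hx : a / 2 ≤ x := hx
    have hx0 : 0 < x := by linarith
    have h1 : x ^ (γ - 1) ≤ (a / 2) ^ (γ - 1) :=
      Real.rpow_le_rpow_of_nonpos (by linarith) hx (by linarith)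
    have h2 : (a / 2) ^ (γ - 1) = a ^ (γ - 1) * 2 ^ (1 - γ) := by
      rw [Real.div_rpow ha.le (by norm_num), div_eq_mul_inv, ← Real.rpow_neg (by norm_num)]
      ring_nf
    have h3 : (2 : ℝ) ^ (1 - γ) ≤ 16 := by
      calc (2 : ℝ) ^ (1 - γ) ≤ 2 ^ (4 : ℝ) :=
            Real.rpow_le_rpow_of_exponent_le (by norm_num) (by linarith)
        _ = 16 := by norm_num
    rw [norm_mul, Real.norm_eq_abs, Real.norm_eq_abs, abs_of_neg hγ',
      abs_of_pos (Real.rpow_pos_of_pos hx0 _)]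
    have h4 : 0 < a ^ (γ - 1) := Real.rpow_pos_of_pos ha _
    calc -γ * x ^ (γ - 1) ≤ 3 * (a ^ (γ - 1) * 16) := by
          rw [h2] at h1
          refine mul_le_mul (by linarith) (h1.trans (by gcongr)) (by positivity) (by norm_num)
      _ = _ := by ring
  have h := Convex.norm_image_sub_le_of_norm_hasDerivWithin_le (f := fun x : ℝ => x ^ γ)
    (f' := fun x => γ * x ^ (γ - 1)) (s := Set.Ici (a / 2)) (x := c) (y := a)
    (fun x hx => (Real.hasDerivAt_rpow_const (Or.inl (by
      have hx : a / 2 ≤ x := hx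
      linarith))).hasDerivWithinAt)
    hbound (convex_Ici _) hc (by simp; linarith)
  simpa [Real.norm_eq_abs] using h

/-- The majorant of the kernel differences. -/
noncomputable def majorant (γ h t : ℝ) (v η W : R3) : ℝ :=
  ‖η - v‖ ^ (γ - 1) * (min ‖η - v‖ h + h * (1 + t) * ‖η - v‖) * gaussPair 8 (η + W) (v + W)

lemma majorant_nonneg {h t : ℝ} (hh : 0 ≤ h) (ht : 0 ≤ t) (γ : ℝ) (v η W : R3) :
    0 ≤ majorant γ h t v η W := by
  unfold majorant
  have := (gaussPair_pos 8 (η + W) (v + W)).le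
  positivity

/-- The case `h = 1` controls the kernel itself, hence its integrability. -/
lemma rpow_mul_gaussPair_le_majorant {γ t : ℝ} (ht : 0 ≤ t) {v η : R3} (hη : η ≠ v) (W : R3) :
    ‖η - v‖ ^ γ * gaussPair 4 (η + W) (v + W) ≤ majorant γ 1 t v η W := by
  have hp : 0 < ‖η - v‖ := norm_pos_iff.2 (sub_ne_zero.2 hη)
  have h1 : ‖η - v‖ ^ γ = ‖η - v‖ ^ (γ - 1) * ‖η - v‖ := by
    rw [Real.rpow_sub_one hp.ne']; field_simp
  have := gaussPair_pos 4 (η + W) (v + W)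
  unfold majorant
  rw [h1]
  gcongr
  · have : 0 ≤ min ‖η - v‖ 1 := by positivity
    nlinarith
  · exact gaussPair_four_le _ _

/-- Pointwise estimate of the difference of two kernel densities. -/
theorem abs_density_sub_le {γ t : ℝ} (hγ : -3 < γ) (hγ' : γ < 0) (ht : 0 ≤ t)
    {v₁ v₂ η W₁ W₂ : R3} (h₁ : η ≠ v₁) (h₂ : η ≠ v₂)
    (hW : 2 * ‖v₁ - v₂‖ ≤ ‖η - v₁‖ → ‖W₁ - W₂‖ ≤ 5 * t * ‖v₁ - v₂‖) :
    |‖η - v₁‖ ^ γ * gaussPair 4 (η + W₁) (v₁ + W₁) -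
      ‖η - v₂‖ ^ γ * gaussPair 4 (η + W₂) (v₂ + W₂)| ≤
    80 * (majorant γ (min ‖v₁ - v₂‖ 1) t v₁ η W₁ + majorant γ (min ‖v₁ - v₂‖ 1) t v₂ η W₂) := by
  set d := ‖v₁ - v₂‖ with hd
  have hd0 : 0 ≤ d := norm_nonneg _
  set a := ‖η - v₁‖ with ha
  set c := ‖η - v₂‖ with hc
  have ha0 : 0 < a := norm_pos_iff.2 (sub_ne_zero.2 h₁)
  have hc0 : 0 < c := norm_pos_iff.2 (sub_ne_zero.2 h₂)
  set e₁ := gaussPair 4 (η + W₁) (v₁ + W₁) with he₁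
  set e₂ := gaussPair 4 (η + W₂) (v₂ + W₂) with he₂
  set g₁ := gaussPair 8 (η + W₁) (v₁ + W₁) with hg₁
  set g₂ := gaussPair 8 (η + W₂) (v₂ + W₂) with hg₂
  have he₁0 : 0 < e₁ := gaussPair_pos _ _ _
  have he₂0 : 0 < e₂ := gaussPair_pos _ _ _
  have hg₁0 : 0 < g₁ := gaussPair_pos _ _ _
  have hg₂0 : 0 < g₂ := gaussPair_pos _ _ _
  have heg₁ : e₁ ≤ g₁ := gaussPair_four_le _ _
  have heg₂ : e₂ ≤ g₂ := gaussPair_four_le _ _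
  have hA : a ^ γ = a ^ (γ - 1) * a := by rw [Real.rpow_sub_one ha0.ne']; field_simp
  have hC : c ^ γ = c ^ (γ - 1) * c := by rw [Real.rpow_sub_one hc0.ne']; field_simp
  have hA0 : 0 < a ^ (γ - 1) := Real.rpow_pos_of_pos ha0 _
  have hC0 : 0 < c ^ (γ - 1) := Real.rpow_pos_of_pos hc0 _
  have hac : |a - c| ≤ d := by
    have := abs_norm_sub_norm_le (η - v₁) (η - v₂)
    rwa [sub_sub_sub_cancel_left, norm_sub_rev v₂ v₁] at this
  have hac' := abs_le.1 hac
  have htri : |a ^ γ * e₁ - c ^ γ * e₂| ≤ a ^ γ * e₁ + c ^ γ * e₂ := by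
    have h1 : 0 ≤ a ^ γ * e₁ := by positivity
    have h2 : 0 ≤ c ^ γ * e₂ := by positivity
    rw [abs_le]; constructor <;> linarith
  have hM₁ : majorant γ (min d 1) t v₁ η W₁ =
    a ^ (γ - 1) * (min a (min d 1) + min d 1 * (1 + t) * a) * g₁ := rfl
  have hM₂ : majorant γ (min d 1) t v₂ η W₂ =
    c ^ (γ - 1) * (min c (min d 1) + min d 1 * (1 + t) * c) * g₂ := rfl
  -- The two arguments of the Gaussian pair move by at most `5td` and `d + 5td`.
  have hΔ : 2 * d ≤ a → |e₁ - e₂| ≤ 10 * (1 + t) * d * (g₁ + g₂) := by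
    intro hlg
    have hW' := hW hlg
    have h2 := abs_gaussPair_sub_le (η + W₁) (v₁ + W₁) (η + W₂) (v₂ + W₂)
    have h3 : ‖η + W₁ - (η + W₂)‖ + ‖v₁ + W₁ - (v₂ + W₂)‖ ≤ 10 * (1 + t) * d := by
      rw [add_sub_add_left_eq_sub, add_sub_add_comm]
      have h5 := norm_add_le (v₁ - v₂) (W₁ - W₂)
      have h6 : 10 * (1 + t) * d = 10 * d + 2 * (5 * t * d) := by ring
      linarith
    exact h2.trans (mul_le_mul_of_nonneg_right h3 (by positivity))
  rw [hM₁, hM₂]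
  clear hM₁ hM₂ hW
  clear_value d a c e₁ e₂ g₁ g₂
  -- Three regimes. If `d ≥ 1`, or if `a < 2d` (then `c < 3d`), the two terms are bounded
  -- separately. If `a ≥ 2d`, then `c ≥ a/2` and the mean value estimates apply. The constant 80 is
  -- `8 · 10`, from `c^γ ≤ 8 a^γ` and the factor 10 in `hΔ`.
  rcases le_or_gt 1 d with hd1 | hd1
  · rw [min_eq_right hd1]
    have k₁ : a ^ γ * e₁ ≤ a ^ (γ - 1) * (min a 1 + 1 * (1 + t) * a) * g₁ := by
      rw [hA]
      gcongr
      have : 0 ≤ min a 1 := by positivity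
      nlinarith
    have k₂ : c ^ γ * e₂ ≤ c ^ (γ - 1) * (min c 1 + 1 * (1 + t) * c) * g₂ := by
      rw [hC]
      gcongr
      have : 0 ≤ min c 1 := by positivity
      nlinarith
    have p₁ : 0 ≤ a ^ γ * e₁ := by positivity
    have p₂ : 0 ≤ c ^ γ * e₂ := by positivity
    linarith
  rw [min_eq_left hd1.le]
  have q₁ : 0 ≤ a ^ (γ - 1) * (d * (1 + t) * a) * g₁ := by positivity
  have q₂ : 0 ≤ c ^ (γ - 1) * (d * (1 + t) * c) * g₂ := by positivity
  rcases lt_or_ge a (2 * d) with hsm | hlg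
  · have k₁ : a ^ γ * e₁ ≤ 3 * (a ^ (γ - 1) * min a d * g₁) := by
      have : a ≤ 3 * min a d := by
        rcases min_cases a d with ⟨h, _⟩ | ⟨h, _⟩ <;> rw [h] <;> linarith
      rw [hA]
      calc a ^ (γ - 1) * a * e₁ ≤ a ^ (γ - 1) * (3 * min a d) * g₁ := by gcongr
        _ = _ := by ring
    have k₂ : c ^ γ * e₂ ≤ 3 * (c ^ (γ - 1) * min c d * g₂) := by
      have : c ≤ 3 * min c d := by
        rcases min_cases c d with ⟨h, _⟩ | ⟨h, _⟩ <;> rw [h] <;> linarith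
      rw [hC]
      calc c ^ (γ - 1) * c * e₂ ≤ c ^ (γ - 1) * (3 * min c d) * g₂ := by gcongr
        _ = _ := by ring
    have p₁ : 0 ≤ a ^ γ * e₁ := by positivity
    have p₂ : 0 ≤ c ^ γ * e₂ := by positivity
    linarith
  · have hca : a / 2 ≤ c := by linarith
    have hdc : d ≤ c := by linarith
    have hda : d ≤ a := by linarith
    rw [min_eq_right hda, min_eq_right hdc]
    have h1 := abs_rpow_sub_rpow_le hγ hγ' ha0 hca
    have h4 := hΔ hlg
    have h5 : c ^ γ ≤ 8 * a ^ γ := by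
      have s1 : c ^ γ ≤ (a / 2) ^ γ :=
        Real.rpow_le_rpow_of_nonpos (by linarith) hca hγ'.le
      have s2 : (a / 2) ^ γ = a ^ γ * 2 ^ (-γ) := by
        rw [Real.div_rpow ha0.le (by norm_num), div_eq_mul_inv, ← Real.rpow_neg (by norm_num)]
      have s3 : (2 : ℝ) ^ (-γ) ≤ 8 := by
        calc (2 : ℝ) ^ (-γ) ≤ 2 ^ (3 : ℝ) :=
              Real.rpow_le_rpow_of_exponent_le (by norm_num) (by linarith)
          _ = 8 := by norm_num
      have s4 : 0 < a ^ γ := Real.rpow_pos_of_pos ha0 _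
      nlinarith
    have h6 : |a ^ γ * e₁ - c ^ γ * e₂| ≤ |a ^ γ - c ^ γ| * e₁ + c ^ γ * |e₁ - e₂| := by
      have s1 : a ^ γ * e₁ - c ^ γ * e₂ = (a ^ γ - c ^ γ) * e₁ + c ^ γ * (e₁ - e₂) := by ring
      rw [s1]
      refine (abs_add_le _ _).trans (le_of_eq ?_)
      rw [abs_mul, abs_mul, abs_of_pos he₁0, abs_of_pos (Real.rpow_pos_of_pos hc0 _)]
    have h7 : |a ^ γ - c ^ γ| * e₁ ≤ 48 * (a ^ (γ - 1) * d * g₁) := by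
      calc _ ≤ (48 * a ^ (γ - 1) * d) * g₁ := by
            gcongr
            exact h1.trans (by gcongr)
        _ = _ := by ring
    have h8 : c ^ γ * |e₁ - e₂| ≤ 80 * (a ^ (γ - 1) * (d * (1 + t) * a) * g₁) +
        10 * (c ^ (γ - 1) * (d * (1 + t) * c) * g₂) := by
      calc c ^ γ * |e₁ - e₂| ≤ c ^ γ * (10 * (1 + t) * d * (g₁ + g₂)) := by gcongr
        _ = c ^ γ * (10 * (1 + t) * d * g₁) + c ^ γ * (10 * (1 + t) * d * g₂) := by ring
        _ ≤ (8 * a ^ γ) * (10 * (1 + t) * d * g₁) + c ^ γ * (10 * (1 + t) * d * g₂) := by gcongr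
        _ = _ := by rw [hA, hC]; ring
    have r₁ : 0 ≤ a ^ (γ - 1) * d * g₁ := by positivity
    have r₂ : 0 ≤ c ^ (γ - 1) * d * g₂ := by positivity
    linarith

/-! ### Comparison of two planes -/

lemma planeInt_mono {ω : R3} (hω : ‖ω‖ = 1) {g g' : R3 → ℝ≥0∞}
    (h : ∀ w, inner ℝ w ω = 0 → g w ≤ g' w) : planeInt ω g ≤ planeInt ω g' :=
  lintegral_mono fun x => mul_le_mul_right (h _ (inner_perp hω x)) _

lemma planeInt_add (ω : R3) {g g' : R3 → ℝ≥0∞} (hg : Measurable g) :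
    (planeInt ω fun w => g w + g' w) = planeInt ω g + planeInt ω g' := by
  unfold planeInt
  rw [← lintegral_add_left (by fun_prop)]
  simp_rw [mul_add]

lemma planeInt_comp_isometry (Q : R3 ≃ₗᵢ[ℝ] R3) (ω : R3) {g : R3 → ℝ≥0∞} (hg : Measurable g) :
    (planeInt ω fun w => g (Q w)) = planeInt (Q ω) g := by
  unfold planeInt
  have hm : Measurable fun x : R3 => slab (inner ℝ x (Q ω)) * g (perp (Q ω) x) := by fun_prop
  rw [← Q.measurePreserving.lintegral_comp hm]
  refine lintegral_congr fun x => ?_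
  simp [perp]

/-- An isometry that takes the plane orthogonal to `a` to the plane orthogonal to `c` and moves
vectors of the first plane as little as possible. -/
lemma exists_isometry_align {a c : R3} (ha : ‖a‖ = 1) (hc : ‖c‖ = 1) :
    ∃ Q : R3 ≃ₗᵢ[ℝ] R3, Q a = -c ∧
      (‖a - c‖ ≤ 1 → ∀ w, inner ℝ w a = 0 → ‖w - Q w‖ ≤ 2 * ‖w‖ * ‖a - c‖) := by
  -- The reflection along `a + c` sends `a` to `-c`; the sign is harmless for planes. For `w ⟂ a`
  -- the displacement is proportional to `(a + c)·w = -(a - c)·w`, hence small, and the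
  -- parallelogram law keeps `|a + c|` away from 0.
  refine ⟨(Submodule.span ℝ {a - -c})ᗮ.reflection,
    Submodule.reflection_sub (by rw [norm_neg, ha, hc]), fun hac w hw => ?_⟩
  rw [sub_neg_eq_add]
  set m := a + c with hm
  have hmn : 1 ≤ ‖m‖ := by
    have h1 := parallelogram_law_with_norm ℝ a c
    rw [ha, hc] at h1
    nlinarith [norm_nonneg m, norm_nonneg (a - c)]
  have hin : |inner ℝ m w| ≤ ‖a - c‖ * ‖w‖ := by
    have h2 : inner ℝ m w = -inner ℝ (a - c) w := by
      have hw' : inner ℝ a w = 0 := by rw [real_inner_comm]; exact hw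
      rw [hm, inner_add_left, inner_sub_left, hw']; ring
    rw [h2, abs_neg]
    exact abs_real_inner_le_norm _ _
  have hQ : w - (Submodule.span ℝ {m})ᗮ.reflection w = (2 * (inner ℝ m w / ‖m‖ ^ 2)) • m := by
    rw [Submodule.reflection_orthogonal_apply, Submodule.reflection_singleton_apply]
    simp only [RCLike.ofReal_real_eq_id, id_eq, two_smul, mul_smul]
    abel
  rw [hQ, norm_smul, Real.norm_eq_abs, abs_mul, abs_div, abs_of_pos (by norm_num : (0:ℝ) < 2),
    abs_of_nonneg (sq_nonneg ‖m‖)]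
  have hmp : 0 < ‖m‖ := by linarith
  calc 2 * (|inner ℝ m w| / ‖m‖ ^ 2) * ‖m‖ = 2 * |inner ℝ m w| / ‖m‖ := by field_simp
    _ ≤ 2 * |inner ℝ m w| / 1 := by gcongr
    _ ≤ _ := by linarith

lemma norm_dir_sub_dir_le {V₁ V₂ : R3} (h₁ : V₁ ≠ 0) (h₂ : V₂ ≠ 0) :
    ‖V₁‖ * ‖dir V₁ - dir V₂‖ ≤ 2 * ‖V₁ - V₂‖ := by
  have p₁ : 0 < ‖V₁‖ := norm_pos_iff.2 h₁
  have p₂ : 0 < ‖V₂‖ := norm_pos_iff.2 h₂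
  have h : ‖V₁‖ • (dir V₁ - dir V₂) = (V₁ - V₂) + (‖V₂‖ - ‖V₁‖) • dir V₂ := by
    rw [smul_sub, sub_smul]
    simp only [dir, smul_smul, mul_inv_cancel₀ p₁.ne', mul_inv_cancel₀ p₂.ne', one_smul]
    abel
  have h2 : ‖V₁‖ * ‖dir V₁ - dir V₂‖ = ‖‖V₁‖ • (dir V₁ - dir V₂)‖ := by
    rw [norm_smul, norm_norm]
  rw [h2, h]
  refine (norm_add_le _ _).trans ?_
  rw [norm_smul, norm_dir h₂, mul_one, Real.norm_eq_abs, abs_sub_comm]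
  have := abs_norm_sub_norm_le V₁ V₂
  linarith

/-! ### Gain kernels and their majorants -/

/-- `√(1 + t²)`. -/
noncomputable def japanese (t : ℝ) : ℝ := Real.sqrt (1 + t ^ 2)

lemma one_le_japanese (t : ℝ) : 1 ≤ japanese t := by
  rw [japanese, Real.one_le_sqrt]; nlinarith [sq_nonneg t]

@[fun_prop]
lemma measurable_japanese : Measurable japanese := by unfold japanese; fun_prop

lemma norm_add_smul_norm {V w : R3} (hV : V ≠ 0) (hw : inner ℝ w (dir V) = 0) :
    ‖V + ‖V‖ • w‖ = ‖V‖ * japanese ‖w‖ := by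
  have p : 0 < ‖V‖ := norm_pos_iff.2 hV
  have h : V + ‖V‖ • w = ‖V‖ • ((1 : ℝ) • dir V + w) := by
    rw [smul_add, one_smul]
    simp only [dir, smul_smul, mul_inv_cancel₀ p.ne', one_smul]
  rw [h, norm_smul, norm_norm]
  congr 1
  have h2 := norm_smul_add_sq (norm_dir hV) hw 1
  rw [japanese, ← Real.sqrt_sq (norm_nonneg _), h2]; simp

/-- The normalising constant of the Maxwellian. -/
noncomputable def maxwellConst : ℝ := (2 * Real.pi) ^ (-(3 / 2) : ℝ)

lemma maxwellConst_pos : 0 < maxwellConst := by unfold maxwellConst; positivity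

lemma sqrtM_mul_sqrtM (x y : R3) : sqrtM x * sqrtM y = maxwellConst * gaussPair 4 x y := by
  unfold sqrtM maxwellian gaussPair
  rw [← Real.sqrt_mul (by positivity)]
  have : (2 * Real.pi) ^ (-(3 / 2) : ℝ) * Real.exp (-(‖x‖ ^ 2 / 2)) *
      ((2 * Real.pi) ^ (-(3 / 2) : ℝ) * Real.exp (-(‖y‖ ^ 2 / 2))) =
      (maxwellConst * Real.exp (-(‖x‖ ^ 2 + ‖y‖ ^ 2) / 4)) ^ 2 := by
    rw [mul_pow, ← Real.exp_nat_mul, maxwellConst, mul_mul_mul_comm, ← Real.exp_add]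
    push_cast
    ring_nf
  rw [this, Real.sqrt_sq (mul_nonneg maxwellConst_pos.le (Real.exp_pos _).le)]

@[fun_prop]
lemma measurable_sqrtM : Measurable sqrtM := by unfold sqrtM maxwellian; fun_prop

@[fun_prop]
lemma measurable_gaussPair {X : Type*} [MeasurableSpace X] {f g : X → R3} (c : ℝ)
    (hf : Measurable f) (hg : Measurable g) : Measurable fun x => gaussPair c (f x) (g x) := by
  unfold gaussPair; fun_prop

lemma sqrtM_nonneg (x : R3) : 0 ≤ sqrtM x := Real.sqrt_nonneg _

/-- The density of the gain operator with angular weight `q`, as a function of the components `V`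
and `W` of the relative velocity parallel and orthogonal to `ω`. -/
noncomputable def gainDensity (γ : ℝ) (q : ℝ → ℝ) (v V W : R3) : ℝ :=
  ‖V + W‖ ^ γ * q (‖V‖ / ‖V + W‖) * (sqrtM (v + V + W) * sqrtM (v + W))

/-- The kernel of the gain operator with angular weight `q`. -/
noncomputable def gainKernel (γ : ℝ) (q : ℝ → ℝ) (v η : R3) : ℝ≥0∞ :=
  2 * planeInt (dir (η - v)) fun w => ENNReal.ofReal (gainDensity γ q v (η - v) (‖η - v‖ • w))

/-- The majorant of the differences of gain kernels. -/
noncomputable def gainMajorant (γ h : ℝ) (v η : R3) : ℝ≥0∞ :=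
  planeInt (dir (η - v)) fun w =>
    ENNReal.ofReal (japanese ‖w‖ ^ (γ - 1) * majorant γ h ‖w‖ v η (‖η - v‖ • w))

lemma measurable_gainDensity (γ : ℝ) {q : ℝ → ℝ} (hq : Measurable q) {X : Type*}
    [MeasurableSpace X] {f₁ f₂ f₃ : X → R3} (h₁ : Measurable f₁) (h₂ : Measurable f₂)
    (h₃ : Measurable f₃) : Measurable fun x => gainDensity γ q (f₁ x) (f₂ x) (f₃ x) := by
  unfold gainDensity; fun_prop

lemma measurable_majorant (γ h : ℝ) {X : Type*} [MeasurableSpace X] {f₀ : X → ℝ}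
    {f₁ f₂ f₃ : X → R3} (h₀ : Measurable f₀) (h₁ : Measurable f₁) (h₂ : Measurable f₂)
    (h₃ : Measurable f₃) : Measurable fun x => majorant γ h (f₀ x) (f₁ x) (f₂ x) (f₃ x) := by
  unfold majorant; fun_prop

lemma measurable_gainKernel (γ : ℝ) {q : ℝ → ℝ} (hq : Measurable q) (v : R3) :
    Measurable (gainKernel γ q v) := by
  unfold gainKernel
  refine Measurable.const_mul (measurable_planeInt (by fun_prop) ?_) _
  simp only [Function.uncurry_def]
  exact (measurable_gainDensity γ hq (by fun_prop) (by fun_prop) (by fun_prop)).ennreal_ofReal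

lemma measurable_gainMajorant (γ h : ℝ) (v : R3) : Measurable (gainMajorant γ h v) := by
  unfold gainMajorant
  refine measurable_planeInt (by fun_prop) ?_
  simp only [Function.uncurry_def]
  refine Measurable.ennreal_ofReal (Measurable.mul (by fun_prop) ?_)
  exact measurable_majorant γ h (by fun_prop) (by fun_prop) (by fun_prop) (by fun_prop)

/-- The gain operator with angular weight `q` is an integral operator. -/
theorem lintegral_gain_eq (γ : ℝ) {q : ℝ → ℝ} (hq : Measurable q) (v : R3) {G : R3 → ℝ≥0∞}
    (hG : Measurable G) :
    ∫⁻ ω : S2, (∫⁻ z, ENNReal.ofReal (gainDensity γ q v (inner ℝ z (ω : R3) • (ω : R3))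
      (perp ω z)) * G (v + inner ℝ z (ω : R3) • (ω : R3))) ∂surfaceMeasure =
      ∫⁻ η, gainKernel γ q v η * G η := by
  have hm : Measurable (Function.uncurry fun V W : R3 =>
      ENNReal.ofReal (gainDensity γ q v V W) * G (v + V)) := by
    simp only [Function.uncurry_def]
    have := measurable_gainDensity γ hq (X := R3 × R3) (f₁ := fun _ => v) measurable_const
      measurable_fst measurable_snd
    fun_prop
  rw [lintegral_carleman hm, ← lintegral_sub_right_eq_self _ v, ← lintegral_const_mul']
  · refine lintegral_congr fun η => ?_
    have hd : Measurable fun w => ENNReal.ofReal (gainDensity γ q v (η - v) (‖η - v‖ • w)) :=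
      (measurable_gainDensity γ hq measurable_const measurable_const
        (by fun_prop)).ennreal_ofReal
    simp_rw [mul_comm _ (G _)]
    rw [planeInt_const_mul _ hd, gainKernel, add_sub_cancel]
    ring
  · simp

/-- The angular function is isolated in a factor that depends on `|w|` only, since `cos ϑ = |V| / |V
+ W| = 1 / japanese |w|`. No regularity of `q` is then needed when `v` varies. -/
lemma gainDensity_eq (γ : ℝ) (q : ℝ → ℝ) {v η w : R3} (hη : η ≠ v)
    (hw : inner ℝ w (dir (η - v)) = 0) :
    gainDensity γ q v (η - v) (‖η - v‖ • w) =
      maxwellConst * (japanese ‖w‖ ^ γ * q (japanese ‖w‖)⁻¹) *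
      (‖η - v‖ ^ γ * gaussPair 4 (η + ‖η - v‖ • w) (v + ‖η - v‖ • w)) := by
  have hV : η - v ≠ 0 := sub_ne_zero.2 hη
  have hp : 0 < ‖η - v‖ := norm_pos_iff.2 hV
  have hj : 0 < japanese ‖w‖ := by linarith [one_le_japanese ‖w‖]
  rw [gainDensity, sqrtM_mul_sqrtM, norm_add_smul_norm hV hw, Real.mul_rpow hp.le hj.le,
    add_sub_cancel, div_mul_cancel_left₀ hp.ne']
  ring

/-- `q` is an angular weight, as a function of `cos ϑ`, with Grad's cutoff. -/
structure IsCutoffWeight (Cb : ℝ) (q : ℝ → ℝ) : Prop where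
  measurable : Measurable q
  nonneg : ∀ c, 0 ≤ c → 0 ≤ q c
  le : ∀ c, 0 ≤ c → q c ≤ Cb * c

lemma IsCutoffWeight.japanese_mul_le {Cb : ℝ} {q : ℝ → ℝ} (hq : IsCutoffWeight Cb q) (γ t : ℝ) :
    japanese t ^ γ * q (japanese t)⁻¹ ≤ Cb * japanese t ^ (γ - 1) := by
  have hj : 0 < japanese t := by linarith [one_le_japanese t]
  calc japanese t ^ γ * q (japanese t)⁻¹ ≤ japanese t ^ γ * (Cb * (japanese t)⁻¹) := by
        gcongr; exact hq.le _ (by positivity)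
    _ = _ := by rw [Real.rpow_sub_one hj.ne']; ring

lemma gainKernel_le {γ Cb : ℝ} (hCb : 0 < Cb) {q : ℝ → ℝ} (hq : IsCutoffWeight Cb q) {v η : R3}
    (hη : η ≠ v) :
    gainKernel γ q v η ≤ ENNReal.ofReal (2 * maxwellConst * Cb) * gainMajorant γ 1 v η := by
  have hc := maxwellConst_pos
  have hd := norm_dir (sub_ne_zero.2 hη)
  have hm : Measurable fun w =>
      ENNReal.ofReal (japanese ‖w‖ ^ (γ - 1) * majorant γ 1 ‖w‖ v η (‖η - v‖ • w)) := by
    refine Measurable.ennreal_ofReal (Measurable.mul (by fun_prop) ?_)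
    exact measurable_majorant γ 1 (by fun_prop) (by fun_prop) (by fun_prop) (by fun_prop)
  rw [gainKernel, gainMajorant, mul_assoc, ENNReal.ofReal_mul (by norm_num), mul_assoc,
    ENNReal.ofReal_ofNat, ← planeInt_const_mul _ hm]
  gcongr
  refine planeInt_mono hd fun w hw => ?_
  rw [gainDensity_eq γ q hη hw, ← ENNReal.ofReal_mul (by positivity)]
  refine ENNReal.ofReal_le_ofReal ?_
  have h1 := hq.japanese_mul_le γ ‖w‖
  have hj : 0 < japanese ‖w‖ := by linarith [one_le_japanese ‖w‖]
  have h2 := rpow_mul_gaussPair_le_majorant (γ := γ) (norm_nonneg w) hη (‖η - v‖ • w)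
  have h3 := gaussPair_pos 4 (η + ‖η - v‖ • w) (v + ‖η - v‖ • w)
  calc _ ≤ maxwellConst * (Cb * japanese ‖w‖ ^ (γ - 1)) *
        majorant γ 1 ‖w‖ v η (‖η - v‖ • w) := by gcongr
    _ = _ := by ring

/-- Turning the plane costs `2 · 2` and the change of scale from `|V₁|` to `|V₂|` costs 1. The
condition on `|V₁|` ensures that the directions are close enough for the bound on `Q`. -/
lemma norm_smul_sub_smul_le {V₁ V₂ w : R3} (h₁ : V₁ ≠ 0) (h₂ : V₂ ≠ 0) {Q : R3 ≃ₗᵢ[ℝ] R3}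
    (hQ : ‖dir V₁ - dir V₂‖ ≤ 1 → ‖w - Q w‖ ≤ 2 * ‖w‖ * ‖dir V₁ - dir V₂‖)
    (h : 2 * ‖V₁ - V₂‖ ≤ ‖V₁‖) :
    ‖‖V₁‖ • w - ‖V₂‖ • Q w‖ ≤ 5 * ‖w‖ * ‖V₁ - V₂‖ := by
  have p₁ : 0 < ‖V₁‖ := norm_pos_iff.2 h₁
  have h3 := norm_dir_sub_dir_le h₁ h₂
  have h4 : ‖dir V₁ - dir V₂‖ ≤ 1 := by
    by_contra hn
    have : ‖V₁‖ * 1 < ‖V₁‖ * ‖dir V₁ - dir V₂‖ := by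
      gcongr; exact not_le.1 hn
    linarith
  have h5 := hQ h4
  have e : ‖V₁‖ • w - ‖V₂‖ • Q w = ‖V₁‖ • (w - Q w) + (‖V₁‖ - ‖V₂‖) • Q w := by
    rw [smul_sub, sub_smul]; abel
  rw [e]
  refine (norm_add_le _ _).trans ?_
  rw [norm_smul, norm_smul, norm_norm, Real.norm_eq_abs, Q.norm_map]
  have h6 := abs_norm_sub_norm_le V₁ V₂
  calc ‖V₁‖ * ‖w - Q w‖ + |‖V₁‖ - ‖V₂‖| * ‖w‖
      ≤ ‖V₁‖ * (2 * ‖w‖ * ‖dir V₁ - dir V₂‖) + ‖V₁ - V₂‖ * ‖w‖ := by gcongr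
    _ = 2 * ‖w‖ * (‖V₁‖ * ‖dir V₁ - dir V₂‖) + ‖V₁ - V₂‖ * ‖w‖ := by ring
    _ ≤ 2 * ‖w‖ * (2 * ‖V₁ - V₂‖) + ‖V₁ - V₂‖ * ‖w‖ := by gcongr
    _ = _ := by ring

/-- The second plane is parametrised by `Q w`. Since `|Q w| = |w|`, both densities carry the same
angular factor `τ`, bounded by the cutoff, and `abs_density_sub_le` compares the rest. The constant
is twice 80 because of the 2 in `gainKernel`. -/
theorem gainKernel_le_add {γ Cb : ℝ} (hγ : -3 < γ) (hγ' : γ < 0) (hCb : 0 < Cb) {q : ℝ → ℝ}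
    (hq : IsCutoffWeight Cb q) {v₁ v₂ η : R3} (h₁ : η ≠ v₁) (h₂ : η ≠ v₂) :
    gainKernel γ q v₁ η ≤ gainKernel γ q v₂ η + ENNReal.ofReal (160 * maxwellConst * Cb) *
      (gainMajorant γ (min ‖v₁ - v₂‖ 1) v₁ η + gainMajorant γ (min ‖v₁ - v₂‖ 1) v₂ η) := by
  have hc := maxwellConst_pos
  have n₁ : η - v₁ ≠ 0 := sub_ne_zero.2 h₁
  have n₂ : η - v₂ ≠ 0 := sub_ne_zero.2 h₂
  set h := min ‖v₁ - v₂‖ 1 with hh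
  have h0 : 0 ≤ h := by positivity
  obtain ⟨Q, hQa, hQ⟩ := exists_isometry_align (norm_dir n₁) (norm_dir n₂)
  have hQinv : ∀ g : R3 → ℝ≥0∞, Measurable g →
      planeInt (dir (η - v₂)) g = planeInt (dir (η - v₁)) fun w => g (Q w) := by
    intro g hg
    rw [planeInt_comp_isometry Q _ hg, hQa, planeInt_neg]
  have hmM : ∀ v : R3, Measurable fun w => ENNReal.ofReal (japanese ‖w‖ ^ (γ - 1) *
      majorant γ h ‖w‖ v η (‖η - v‖ • w)) := fun v => by
    refine Measurable.ennreal_ofReal (Measurable.mul (by fun_prop) ?_)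
    exact measurable_majorant γ h (by fun_prop) (by fun_prop) (by fun_prop) (by fun_prop)
  have hmD : ∀ v : R3, Measurable fun w =>
      ENNReal.ofReal (gainDensity γ q v (η - v) (‖η - v‖ • w)) := fun v =>
    (measurable_gainDensity γ hq.measurable measurable_const measurable_const
      (by fun_prop)).ennreal_ofReal
  have hQm : Measurable Q := Q.continuous.measurable
  have hmS : Measurable fun w =>
      ENNReal.ofReal (japanese ‖w‖ ^ (γ - 1) * majorant γ h ‖w‖ v₁ η (‖η - v₁‖ • w)) +
      ENNReal.ofReal (japanese ‖Q w‖ ^ (γ - 1) * majorant γ h ‖Q w‖ v₂ η (‖η - v₂‖ • Q w)) :=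
    (hmM v₁).add ((hmM v₂).comp hQm)
  have hmQ : Measurable fun w =>
      ENNReal.ofReal (gainDensity γ q v₂ (η - v₂) (‖η - v₂‖ • Q w)) := (hmD v₂).comp hQm
  rw [gainKernel, gainKernel, gainMajorant, gainMajorant, hQinv _ (hmD v₂), hQinv _ (hmM v₂),
    ← planeInt_add _ (hmM v₁), show 160 * maxwellConst * Cb = 2 * (80 * maxwellConst * Cb) by ring,
    ENNReal.ofReal_mul (by norm_num), ENNReal.ofReal_ofNat, mul_assoc,
    ← planeInt_const_mul _ hmS, ← mul_add, ← planeInt_add _ hmQ]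
  gcongr
  refine planeInt_mono (norm_dir n₁) fun w hw => ?_
  have hw2 : inner ℝ (Q w) (dir (η - v₂)) = 0 := by
    have : inner ℝ (Q w) (Q (dir (η - v₁))) = 0 := by rw [Q.inner_map_map]; exact hw
    rw [hQa, inner_neg_right] at this
    linarith
  have hj : 0 < japanese ‖w‖ := by linarith [one_le_japanese ‖w‖]
  have M₁ := majorant_nonneg h0 (norm_nonneg w) γ v₁ η (‖η - v₁‖ • w)
  have M₂ := majorant_nonneg h0 (norm_nonneg w) γ v₂ η (‖η - v₂‖ • Q w)
  rw [gainDensity_eq γ q h₁ hw, gainDensity_eq γ q h₂ hw2, Q.norm_map,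
    ← ENNReal.ofReal_add (by positivity) (by positivity), ← ENNReal.ofReal_mul (by positivity)]
  set τ := japanese ‖w‖ ^ γ * q (japanese ‖w‖)⁻¹ with hτ
  have hτ0 : 0 ≤ τ := mul_nonneg (by positivity) (hq.nonneg _ (by positivity))
  have hτ1 : τ ≤ Cb * japanese ‖w‖ ^ (γ - 1) := hq.japanese_mul_le γ ‖w‖
  have g₁ := gaussPair_pos 4 (η + ‖η - v₁‖ • w) (v₁ + ‖η - v₁‖ • w)
  have g₂ := gaussPair_pos 4 (η + ‖η - v₂‖ • Q w) (v₂ + ‖η - v₂‖ • Q w)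
  rw [← ENNReal.ofReal_add (by positivity) (by positivity)]
  refine ENNReal.ofReal_le_ofReal ?_
  have key := abs_density_sub_le hγ hγ' (norm_nonneg w) h₁ h₂
    (W₁ := ‖η - v₁‖ • w) (W₂ := ‖η - v₂‖ • Q w) (by
      intro h2
      have e : ‖v₁ - v₂‖ = ‖(η - v₁) - (η - v₂)‖ := by
        rw [sub_sub_sub_cancel_left, norm_sub_rev]
      rw [e] at h2 ⊢
      exact norm_smul_sub_smul_le n₁ n₂ (fun hle => hQ hle w hw) h2)
  rw [← hh] at key
  have k1 := (abs_le.1 key).2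
  set A₁ := ‖η - v₁‖ ^ γ * gaussPair 4 (η + ‖η - v₁‖ • w) (v₁ + ‖η - v₁‖ • w)
  set A₂ := ‖η - v₂‖ ^ γ * gaussPair 4 (η + ‖η - v₂‖ • Q w) (v₂ + ‖η - v₂‖ • Q w)
  set B₁ := majorant γ h ‖w‖ v₁ η (‖η - v₁‖ • w)
  set B₂ := majorant γ h ‖w‖ v₂ η (‖η - v₂‖ • Q w)
  calc maxwellConst * τ * A₁ ≤ maxwellConst * τ * (A₂ + 80 * (B₁ + B₂)) := by gcongr; linarith
    _ = maxwellConst * τ * A₂ + maxwellConst * τ * (80 * (B₁ + B₂)) := by ring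
    _ ≤ maxwellConst * τ * A₂ + maxwellConst * (Cb * japanese ‖w‖ ^ (γ - 1)) *
        (80 * (B₁ + B₂)) := by gcongr
    _ = _ := by ring

/-- Meant for `x = η + W = u` and `x - y = η - v = V`: one Gaussian localises `u`, the other is kept
for the average over `ω`. -/
lemma gaussPair_eight_le (x y : R3) :
    gaussPair 8 x y ≤ Real.exp (-‖x‖ ^ 2 / 16) * Real.exp (-‖x - y‖ ^ 2 / 32) := by
  rw [gaussPair, ← Real.exp_add]
  refine Real.exp_le_exp.2 ?_
  have h1 := norm_sub_le x y
  have h2 : ‖x - y‖ ^ 2 ≤ 2 * ‖x‖ ^ 2 + 2 * ‖y‖ ^ 2 := by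
    nlinarith [norm_nonneg (x - y), sq_nonneg (‖x‖ - ‖y‖)]
  have := sq_nonneg ‖y‖
  linarith

/-- The majorant in terms of the two components of the relative velocity. -/
lemma gainMajorant_le {γ h : ℝ} (h0 : 0 ≤ h) {v η : R3} (hη : η ≠ v) :
    gainMajorant γ h v η ≤ planeInt (dir (η - v)) fun w =>
      ENNReal.ofReal (‖(η - v) + ‖η - v‖ • w‖ ^ (γ - 1) *
        (min ‖(η - v) + ‖η - v‖ • w‖ h + 2 * h * ‖(η - v) + ‖η - v‖ • w‖) *
        (Real.exp (-‖v + ((η - v) + ‖η - v‖ • w)‖ ^ 2 / 16) *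
          Real.exp (-‖η - v‖ ^ 2 / 32))) := by
  have hV : η - v ≠ 0 := sub_ne_zero.2 hη
  have hp : 0 < ‖η - v‖ := norm_pos_iff.2 hV
  refine planeInt_mono (norm_dir hV) fun w hw => ENNReal.ofReal_le_ofReal ?_
  have hj1 := one_le_japanese ‖w‖
  have hj : 0 < japanese ‖w‖ := by linarith
  have hjw : ‖w‖ ≤ japanese ‖w‖ := Real.le_sqrt_of_sq_le (by linarith)
  have hg := gaussPair_eight_le (η + ‖η - v‖ • w) (v + ‖η - v‖ • w)
  rw [add_sub_add_right_eq_sub] at hg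
  have e1 : v + ((η - v) + ‖η - v‖ • w) = η + ‖η - v‖ • w := by abel
  rw [norm_add_smul_norm hV hw, Real.mul_rpow hp.le hj.le, e1, majorant]
  have hr : 0 < ‖η - v‖ ^ (γ - 1) := Real.rpow_pos_of_pos hp _
  have hr' : 0 < japanese ‖w‖ ^ (γ - 1) := Real.rpow_pos_of_pos hj _
  have h2 : min ‖η - v‖ h + h * (1 + ‖w‖) * ‖η - v‖ ≤
      min (‖η - v‖ * japanese ‖w‖) h + 2 * h * (‖η - v‖ * japanese ‖w‖) := by
    have s1 : ‖η - v‖ ≤ ‖η - v‖ * japanese ‖w‖ := le_mul_of_one_le_right hp.le hj1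
    have s2 : h * (1 + ‖w‖) * ‖η - v‖ ≤ 2 * h * (‖η - v‖ * japanese ‖w‖) := by
      have : h * (1 + ‖w‖) * ‖η - v‖ ≤ h * (japanese ‖w‖ + japanese ‖w‖) * ‖η - v‖ := by gcongr
      linarith
    exact add_le_add (min_le_min_right _ s1) s2
  calc _ ≤ japanese ‖w‖ ^ (γ - 1) * (‖η - v‖ ^ (γ - 1) *
        (min (‖η - v‖ * japanese ‖w‖) h + 2 * h * (‖η - v‖ * japanese ‖w‖)) *
        (Real.exp (-‖η + ‖η - v‖ • w‖ ^ 2 / 16) * Real.exp (-‖η - v‖ ^ 2 / 32))) := by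
        gcongr
        exact (gaussPair_pos _ _ _).le
    _ = _ := by ring

/-- Returning from `(V, w)` to `(ω, z)` makes all factors but `exp(-(z·ω)²/32)` independent of `ω`.
The average of that factor cancels the surplus `|z|` of the linear term, which leaves the basic
weighted integral. -/
theorem exists_lintegral_gainMajorant_le {γ α : ℝ} (hγ : -3 < γ) (hγ' : γ < 0)
    (hα : IsHolderExponent γ α) : ∃ C : ℝ, 0 < C ∧ ∀ h : ℝ, 0 < h → h ≤ 1 → ∀ v : R3,
      ∫⁻ η, gainMajorant γ h v η ≤ ENNReal.ofReal (C * (h ^ α * bracket v (γ - 1))) := by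
  obtain ⟨C₁, hC₁, hw⟩ := exists_lintegral_weight_le hγ hγ' hα
  obtain ⟨C₂, hC₂, hs⟩ := exists_sphere_gaussian_le
  set S := (surfaceMeasure Set.univ).toReal with hS
  refine ⟨(S + 2 * C₂) * C₁, by positivity, fun h h0 h1 v => ?_⟩
  let F : R3 → R3 → ℝ≥0∞ := fun V W => ENNReal.ofReal (‖V + W‖ ^ (γ - 1) *
        (min ‖V + W‖ h + 2 * h * ‖V + W‖) *
        (Real.exp (-‖v + (V + W)‖ ^ 2 / 16) * Real.exp (-‖V‖ ^ 2 / 32)))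
  have hF : Measurable (Function.uncurry F) := by
    simp only [F, Function.uncurry_def]; fun_prop
  have h0η : ∀ᵐ η : R3, η ≠ v := by simp [ae_iff]
  have e1 : ∫⁻ η, gainMajorant γ h v η ≤
      ∫⁻ V, planeInt (dir V) fun w => F V (‖V‖ • w) := by
    rw [← lintegral_sub_right_eq_self (μ := (volume : Measure R3))
      (fun V => planeInt (dir V) fun w => F V (‖V‖ • w)) v]
    refine lintegral_mono_ae ?_
    filter_upwards [h0η] with η hη
    exact gainMajorant_le h0.le hη
  have e2 : ∫⁻ V, planeInt (dir V) (fun w => F V (‖V‖ • w)) ≤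
      ∫⁻ ω : S2, (∫⁻ z, F (inner ℝ z (ω : R3) • (ω : R3)) (perp ω z)) ∂surfaceMeasure := by
    rw [lintegral_carleman hF]
    exact le_mul_of_one_le_left zero_le one_le_two
  refine e1.trans (e2.trans ?_)
  have hFz : ∀ (ω : S2) (z : R3), F (inner ℝ z (ω : R3) • (ω : R3)) (perp ω z) =
      ENNReal.ofReal (‖z‖ ^ (γ - 1) * (min ‖z‖ h + 2 * h * ‖z‖) * Real.exp (-‖v + z‖ ^ 2 / 16)) *
        ENNReal.ofReal (Real.exp (-(inner ℝ z (ω : R3)) ^ 2 / 32)) := by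
    intro ω z
    have h2 : ‖inner ℝ z (ω : R3) • (ω : R3)‖ ^ 2 = (inner ℝ z (ω : R3)) ^ 2 := by
      rw [norm_smul]; simp
    simp only [F]
    rw [smul_add_perp, h2, ← ENNReal.ofReal_mul (by positivity)]
    congr 1; ring
  simp_rw [hFz]
  rw [lintegral_lintegral_swap (by fun_prop)]
  have e3 : ∀ z : R3, ∫⁻ ω : S2, ENNReal.ofReal (‖z‖ ^ (γ - 1) * (min ‖z‖ h + 2 * h * ‖z‖) *
      Real.exp (-‖v + z‖ ^ 2 / 16)) * ENNReal.ofReal (Real.exp (-(inner ℝ z (ω : R3)) ^ 2 / 32))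
      ∂surfaceMeasure ≤ ENNReal.ofReal (S + 2 * C₂) *
        ENNReal.ofReal (‖z‖ ^ (γ - 1) * min ‖z‖ h * Real.exp (-‖v + z‖ ^ 2 / 16)) := by
    intro z
    rw [lintegral_const_mul _ (by fun_prop)]
    set J := ∫⁻ ω : S2, ENNReal.ofReal (Real.exp (-(inner ℝ z (ω : R3)) ^ 2 / 32))
      ∂surfaceMeasure with hJ
    have j1 : J ≤ ENNReal.ofReal S := by
      rw [hS, ENNReal.ofReal_toReal (measure_ne_top _ _)]
      calc J ≤ ∫⁻ ω : S2, 1 ∂surfaceMeasure := by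
            refine lintegral_mono fun ω => ?_
            rw [← ENNReal.ofReal_one]
            refine ENNReal.ofReal_le_ofReal (Real.exp_le_one_iff.2 ?_)
            have := sq_nonneg (inner ℝ z (ω : R3))
            linarith
        _ = _ := by simp
    have j2 : ENNReal.ofReal ‖z‖ * J ≤ ENNReal.ofReal (C₂ * min ‖z‖ 1) := hs z
    -- After averaging, the linear term is again of the size of the main one.
    have j3 : h * min ‖z‖ 1 ≤ min ‖z‖ h := by
      rw [mul_min_of_nonneg _ _ h0.le, mul_one]
      exact min_le_min_right _ (mul_le_of_le_one_left (norm_nonneg _) h1)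
    have hS0 : 0 ≤ S := ENNReal.toReal_nonneg
    set E := Real.exp (-‖v + z‖ ^ 2 / 16)
    have hE : 0 < E := Real.exp_pos _
    have hm0 : 0 ≤ min ‖z‖ h := by positivity
    calc ENNReal.ofReal (‖z‖ ^ (γ - 1) * (min ‖z‖ h + 2 * h * ‖z‖) * E) * J
        = ENNReal.ofReal (‖z‖ ^ (γ - 1) * E) * (ENNReal.ofReal (min ‖z‖ h) * J +
            ENNReal.ofReal (2 * h) * (ENNReal.ofReal ‖z‖ * J)) := by
          rw [mul_right_comm, ENNReal.ofReal_mul (by positivity),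
            ENNReal.ofReal_add (by positivity) (by positivity),
            ENNReal.ofReal_mul (p := 2 * h) (by positivity)]
          ring
      _ ≤ ENNReal.ofReal (‖z‖ ^ (γ - 1) * E) * (ENNReal.ofReal (min ‖z‖ h) * ENNReal.ofReal S +
            ENNReal.ofReal (2 * h) * ENNReal.ofReal (C₂ * min ‖z‖ 1)) := by gcongr
      _ = ENNReal.ofReal (‖z‖ ^ (γ - 1) * E * (min ‖z‖ h * S + 2 * C₂ * (h * min ‖z‖ 1))) := by
          rw [← ENNReal.ofReal_mul hm0, ← ENNReal.ofReal_mul (by positivity),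
            ← ENNReal.ofReal_add (by positivity) (by positivity),
            ← ENNReal.ofReal_mul (by positivity)]
          congr 1; ring
      _ ≤ ENNReal.ofReal (‖z‖ ^ (γ - 1) * E * (min ‖z‖ h * S + 2 * C₂ * min ‖z‖ h)) := by
          refine ENNReal.ofReal_le_ofReal ?_
          gcongr
      _ = _ := by
          rw [← ENNReal.ofReal_mul (by positivity)]
          congr 1; ring
  calc _ ≤ ∫⁻ z : R3, ENNReal.ofReal (S + 2 * C₂) *
        ENNReal.ofReal (‖z‖ ^ (γ - 1) * min ‖z‖ h * Real.exp (-‖v + z‖ ^ 2 / 16)) :=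
        lintegral_mono e3
    _ = ENNReal.ofReal (S + 2 * C₂) * ∫⁻ u : R3,
        ENNReal.ofReal (‖u - v‖ ^ (γ - 1) * min ‖u - v‖ h * Real.exp (-‖u‖ ^ 2 / 16)) := by
        rw [lintegral_const_mul _ (by fun_prop), ← lintegral_sub_right_eq_self
          (μ := (volume : Measure R3)) (fun z => ENNReal.ofReal (‖z‖ ^ (γ - 1) * min ‖z‖ h *
            Real.exp (-‖v + z‖ ^ 2 / 16))) v]
        simp_rw [add_sub_cancel]
    _ ≤ ENNReal.ofReal (S + 2 * C₂) * ENNReal.ofReal (C₁ * (h ^ α * bracket v (γ - 1))) := by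
        gcongr
        exact hw h h0 h1 v
    _ = _ := by
        rw [← ENNReal.ofReal_mul (by positivity), mul_assoc]

/-! ### From majorants to Hölder kernels -/

lemma ofReal_abs_toReal_sub_le {A B R : ℝ≥0∞} (hA : A ≠ ∞) (hB : B ≠ ∞) (h₁ : A ≤ B + R)
    (h₂ : B ≤ A + R) : ENNReal.ofReal |A.toReal - B.toReal| ≤ R := by
  by_cases hR : R = ∞
  · rw [hR]; exact le_top
  have k₁ := ENNReal.toReal_mono (ENNReal.add_ne_top.2 ⟨hB, hR⟩) h₁
  have k₂ := ENNReal.toReal_mono (ENNReal.add_ne_top.2 ⟨hA, hR⟩) h₂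
  rw [ENNReal.toReal_add hB hR] at k₁
  rw [ENNReal.toReal_add hA hR] at k₂
  refine ENNReal.ofReal_le_of_le_toReal (abs_le.2 ⟨?_, ?_⟩) <;> linarith

/-- A nonnegative kernel on `ℝ³` that is integrable in the second variable and whose dependence on
the first one satisfies the weighted Hölder estimate with constant `C`. -/
structure IsHolderKernel (γ α C : ℝ) (κ : R3 → R3 → ℝ≥0∞) : Prop where
  measurable : ∀ v, Measurable (κ v)
  finite : ∀ v, ∫⁻ η, κ v η < ∞
  holder : ∀ v₁ v₂, ∫⁻ η, ENNReal.ofReal |(κ v₁ η).toReal - (κ v₂ η).toReal| ≤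
    ENNReal.ofReal (C * ‖v₁ - v₂‖ ^ α * max (bracket v₁ (γ - 1)) (bracket v₂ (γ - 1)))

/-- A kernel controlled by a family of majorants `m h` satisfies the weighted Hölder estimate. -/
lemma isHolderKernel_of_majorant {γ α C D : ℝ} (hC : 0 < C) (hD : 0 ≤ D) (hα : 0 < α)
    {κ : R3 → R3 → ℝ≥0∞} {m : ℝ → R3 → R3 → ℝ≥0∞} (hκ : ∀ v, Measurable (κ v))
    (hm : ∀ h v, Measurable (m h v))
    (hmC : ∀ h : ℝ, 0 < h → h ≤ 1 → ∀ v : R3,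
      ∫⁻ η, m h v η ≤ ENNReal.ofReal (C * (h ^ α * bracket v (γ - 1))))
    (hle : ∀ v η : R3, η ≠ v → κ v η ≤ ENNReal.ofReal D * m 1 v η)
    (hadd : ∀ v₁ v₂ η : R3, η ≠ v₁ → η ≠ v₂ → κ v₁ η ≤ κ v₂ η + ENNReal.ofReal D *
      (m (min ‖v₁ - v₂‖ 1) v₁ η + m (min ‖v₁ - v₂‖ 1) v₂ η)) :
    IsHolderKernel γ α (2 * D * C) κ := by
  have hne : ∀ v : R3, ∀ᵐ η : R3, η ≠ v := fun v => by simp [ae_iff]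
  have hfin : ∀ v, ∫⁻ η, κ v η < ∞ := by
    intro v
    calc ∫⁻ η, κ v η ≤ ∫⁻ η, ENNReal.ofReal D * m 1 v η := by
          refine lintegral_mono_ae ?_
          filter_upwards [hne v] with η hη using hle v η hη
      _ = ENNReal.ofReal D * ∫⁻ η, m 1 v η := lintegral_const_mul _ (hm 1 v)
      _ < ∞ := ENNReal.mul_lt_top ENNReal.ofReal_lt_top
          ((hmC 1 one_pos le_rfl v).trans_lt ENNReal.ofReal_lt_top)
  refine ⟨hκ, hfin, fun v₁ v₂ => ?_⟩
  by_cases hv : v₁ = v₂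
  · subst hv; simp
  have hd : 0 < ‖v₁ - v₂‖ := norm_pos_iff.2 (sub_ne_zero.2 hv)
  set h := min ‖v₁ - v₂‖ 1 with hh
  have h0 : 0 < h := lt_min hd one_pos
  have h1 : h ≤ 1 := min_le_right _ _
  have hb₁ := bracket_pos v₁ (γ - 1)
  have hb₂ := bracket_pos v₂ (γ - 1)
  calc ∫⁻ η, ENNReal.ofReal |(κ v₁ η).toReal - (κ v₂ η).toReal|
      ≤ ∫⁻ η, ENNReal.ofReal D * (m h v₁ η + m h v₂ η) := by
        refine lintegral_mono_ae ?_
        -- Finiteness is essential here: `toReal` sends `∞` to 0, which would break the comparison.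
        filter_upwards [hne v₁, hne v₂, ae_lt_top (hκ v₁) (hfin v₁).ne,
          ae_lt_top (hκ v₂) (hfin v₂).ne] with η e₁ e₂ f₁ f₂
        refine ofReal_abs_toReal_sub_le f₁.ne f₂.ne (hadd v₁ v₂ η e₁ e₂) ?_
        have := hadd v₂ v₁ η e₂ e₁
        rwa [norm_sub_rev, add_comm (m _ v₂ η)] at this
    _ = ENNReal.ofReal D * ((∫⁻ η, m h v₁ η) + ∫⁻ η, m h v₂ η) := by
        have hs : Measurable fun η => m h v₁ η + m h v₂ η := (hm h v₁).add (hm h v₂)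
        rw [lintegral_const_mul _ hs, lintegral_add_left (hm h v₁)]
    _ ≤ ENNReal.ofReal D * (ENNReal.ofReal (C * (h ^ α * bracket v₁ (γ - 1))) +
        ENNReal.ofReal (C * (h ^ α * bracket v₂ (γ - 1)))) := by
        gcongr
        · exact hmC h h0 h1 v₁
        · exact hmC h h0 h1 v₂
    _ = ENNReal.ofReal (D * (C * h ^ α * (bracket v₁ (γ - 1) + bracket v₂ (γ - 1)))) := by
        rw [← ENNReal.ofReal_add (by positivity) (by positivity), ← ENNReal.ofReal_mul hD]
        congr 1; ring
    _ ≤ _ := by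
        refine ENNReal.ofReal_le_ofReal ?_
        have e1 : h ^ α ≤ ‖v₁ - v₂‖ ^ α := by
          gcongr; exact min_le_left _ _
        calc D * (C * h ^ α * (bracket v₁ (γ - 1) + bracket v₂ (γ - 1)))
            ≤ D * (C * ‖v₁ - v₂‖ ^ α * (max (bracket v₁ (γ - 1)) (bracket v₂ (γ - 1)) +
                max (bracket v₁ (γ - 1)) (bracket v₂ (γ - 1)))) := by
              gcongr
              · exact le_max_left _ _
              · exact le_max_right _ _
          _ = _ := by ring

theorem exists_isHolderKernel_gain {γ α Cb : ℝ} (hγ : -3 < γ) (hγ' : γ < 0)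
    (hα : IsHolderExponent γ α) (hCb : 0 < Cb) : ∃ C : ℝ, 0 < C ∧ ∀ q : ℝ → ℝ,
      IsCutoffWeight Cb q → IsHolderKernel γ α C (gainKernel γ q) := by
  obtain ⟨C, hC, hm⟩ := exists_lintegral_gainMajorant_le hγ hγ' hα
  have hc := maxwellConst_pos
  refine ⟨2 * (160 * maxwellConst * Cb) * C, by positivity, fun q hq => ?_⟩
  refine isHolderKernel_of_majorant hC (by positivity) (hα.pos hγ)
    (measurable_gainKernel γ hq.measurable) (measurable_gainMajorant γ) hm
    (fun v η hη => (gainKernel_le hCb hq hη).trans ?_)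
    (fun v₁ v₂ η h₁ h₂ => gainKernel_le_add hγ hγ' hCb hq h₁ h₂)
  gcongr
  norm_num

/-! ### The loss kernel -/

/-- The kernel of the loss operator with total angular mass `B`. -/
noncomputable def lossKernel (γ : ℝ) (B : ℝ≥0∞) (v η : R3) : ℝ≥0∞ :=
  B * ENNReal.ofReal (‖η - v‖ ^ γ * (sqrtM v * sqrtM η))

/-- With `W = 0` the whole distance `r = |η - v|` appears in a Gaussian, and `r exp(-r²/32) ≤ 3`
removes the linear term without any average over the sphere. -/
lemma lintegral_loss_majorant_le {γ h : ℝ} (h0 : 0 < h) (h1 : h ≤ 1) (v : R3) :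
    ∫⁻ η, ENNReal.ofReal (majorant γ h 0 v η 0) ≤ 4 * ∫⁻ u, ENNReal.ofReal (‖u - v‖ ^ (γ - 1) *
      min ‖u - v‖ h * Real.exp (-‖u‖ ^ 2 / 16)) := by
  rw [← lintegral_const_mul _ (by fun_prop)]
  refine lintegral_mono fun η => ?_
  have h4 : (4 : ℝ≥0∞) = ENNReal.ofReal 4 := by simp
  rw [h4, ← ENNReal.ofReal_mul (by norm_num)]
  refine ENNReal.ofReal_le_ofReal ?_
  rw [majorant, add_zero, add_zero, add_zero, mul_one]
  have hg := gaussPair_eight_le η v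
  set r := ‖η - v‖ with hr
  have hr0 : 0 ≤ r := norm_nonneg _
  set E := Real.exp (-‖η‖ ^ 2 / 16)
  set X := Real.exp (-r ^ 2 / 32) with hX
  have hE : 0 < E := Real.exp_pos _
  have hX0 : 0 < X := Real.exp_pos _
  have hX1 : X ≤ 1 := Real.exp_le_one_iff.2 (by nlinarith [sq_nonneg r])
  have hrX : r * X ≤ 3 := by
    have s1 := Real.add_one_le_exp (r ^ 2 / 32)
    have s2 : Real.exp (r ^ 2 / 32) * X = 1 := by
      rw [hX, ← Real.exp_add, neg_div, add_neg_cancel, Real.exp_zero]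
    have s3 : r ≤ 3 * Real.exp (r ^ 2 / 32) := by nlinarith [sq_nonneg (3 * r - 16)]
    nlinarith
  have hm : (min r h + h * r) * X ≤ 4 * min r h := by
    have hm0 : 0 ≤ min r h := le_min hr0 h0.le
    have s1 : min r h * X ≤ min r h := mul_le_of_le_one_right hm0 hX1
    have s2 : h * r * X ≤ 3 * min r h := by
      rcases min_cases r h with ⟨e, _⟩ | ⟨e, _⟩ <;> rw [e]
      · have : h * r * X ≤ 1 * r * 1 := by gcongr
        linarith
      · calc h * r * X = h * (r * X) := by ring
          _ ≤ h * 3 := by gcongr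
          _ = _ := by ring
    linarith
  calc r ^ (γ - 1) * (min r h + h * r) * gaussPair 8 η v
      ≤ r ^ (γ - 1) * (min r h + h * r) * (E * X) := by gcongr
    _ = r ^ (γ - 1) * ((min r h + h * r) * X) * E := by ring
    _ ≤ r ^ (γ - 1) * (4 * min r h) * E := by gcongr
    _ = _ := by ring

theorem exists_isHolderKernel_loss {γ α : ℝ} (hγ : -3 < γ) (hγ' : γ < 0)
    (hα : IsHolderExponent γ α) (Bm : ℝ) (hBm : 0 < Bm) : ∃ C : ℝ, 0 < C ∧ ∀ B : ℝ≥0∞,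
      B ≤ ENNReal.ofReal Bm → IsHolderKernel γ α C (lossKernel γ B) := by
  obtain ⟨C, hC, hw⟩ := exists_lintegral_weight_le hγ hγ' hα
  have hc := maxwellConst_pos
  refine ⟨2 * (Bm * maxwellConst * 80) * (4 * C), by positivity, fun B hB => ?_⟩
  have hdens : ∀ v η : R3, ‖η - v‖ ^ γ * (sqrtM v * sqrtM η) =
      maxwellConst * (‖η - v‖ ^ γ * gaussPair 4 (η + 0) (v + 0)) := by
    intro v η
    rw [mul_comm (sqrtM v), sqrtM_mul_sqrtM, add_zero, add_zero]; ring
  refine isHolderKernel_of_majorant (m := fun h v η => ENNReal.ofReal (majorant γ h 0 v η 0))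
    (by positivity) (by positivity) (hα.pos hγ) (fun v => ?_) (fun h v => ?_)
    (fun h h0 h1 v => ?_) (fun v η hη => ?_) (fun v₁ v₂ η h₁ h₂ => ?_)
  · unfold lossKernel; fun_prop
  · exact (measurable_majorant γ h (by fun_prop) (by fun_prop) (by fun_prop)
      (by fun_prop)).ennreal_ofReal
  · refine (lintegral_loss_majorant_le h0 h1 v).trans ?_
    have h4 : (4 : ℝ≥0∞) = ENNReal.ofReal 4 := by simp
    rw [mul_assoc, ENNReal.ofReal_mul (by norm_num), h4]
    gcongr
    exact hw h h0 h1 v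
  · rw [lossKernel, hdens, ENNReal.ofReal_mul (p := Bm * maxwellConst) (by positivity),
      ENNReal.ofReal_mul (p := Bm) hBm.le, ENNReal.ofReal_mul hc.le, mul_assoc, mul_assoc]
    have k := rpow_mul_gaussPair_le_majorant (γ := γ) le_rfl hη 0
    gcongr
    rw [← ENNReal.ofReal_mul (by norm_num)]
    refine ENNReal.ofReal_le_ofReal (k.trans ?_)
    linarith [majorant_nonneg zero_le_one le_rfl γ v η 0]
  · have key := (abs_le.1 (abs_density_sub_le hγ hγ' le_rfl h₁ h₂ (W₁ := 0) (W₂ := 0)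
      (by intro _; simp))).2
    have h0 : 0 ≤ min ‖v₁ - v₂‖ 1 := by positivity
    have M₁ := majorant_nonneg h0 le_rfl γ v₁ η 0
    have M₂ := majorant_nonneg h0 le_rfl γ v₂ η 0
    have g₂ := gaussPair_pos 4 (η + 0) (v₂ + 0)
    rw [lossKernel, lossKernel, hdens, hdens, ← ENNReal.ofReal_add M₁ M₂]
    calc B * ENNReal.ofReal (maxwellConst * (‖η - v₁‖ ^ γ * gaussPair 4 (η + 0) (v₁ + 0)))
        ≤ B * (ENNReal.ofReal (maxwellConst * (‖η - v₂‖ ^ γ * gaussPair 4 (η + 0) (v₂ + 0))) +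
          ENNReal.ofReal (maxwellConst * 80) * ENNReal.ofReal (majorant γ (min ‖v₁ - v₂‖ 1) 0 v₁ η 0
            + majorant γ (min ‖v₁ - v₂‖ 1) 0 v₂ η 0)) := by
          gcongr
          rw [← ENNReal.ofReal_mul (by positivity),
            ← ENNReal.ofReal_add (by positivity) (by positivity)]
          refine ENNReal.ofReal_le_ofReal ?_
          rw [mul_assoc, ← mul_add]
          gcongr
          linarith
      _ ≤ _ := by
          rw [mul_add, mul_assoc Bm, ENNReal.ofReal_mul hBm.le, mul_assoc (ENNReal.ofReal Bm)]
          gcongr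

/-! ### Transport of measures and the representation of `K` -/

/-- A weighted transport identity for nonnegative functions passes to bounded functions. -/
lemma integral_eq_of_lintegral_eq {X : Type*} [MeasurableSpace X] {P : Measure X}
    {d : X → ℝ} (hd : Measurable d) (hd0 : ∀ p, 0 ≤ d p) {T : X → R3} (hT : Measurable T)
    {κ : R3 → ℝ≥0∞} (hκ : Measurable κ) (hκf : ∫⁻ η, κ η < ∞)
    (h : ∀ G : R3 → ℝ≥0∞, Measurable G →
      ∫⁻ p, ENNReal.ofReal (d p) * G (T p) ∂P = ∫⁻ η, κ η * G η)
    {f : R3 → ℝ} (hf : MemLp f ⊤ volume) :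
    Integrable (fun p => d p * f (T p)) P ∧ Integrable (fun η => (κ η).toReal * f η) ∧
      ∫ p, d p * f (T p) ∂P = ∫ η, (κ η).toReal * f η := by
  have hdm : Measurable fun p => ENNReal.ofReal (d p) := hd.ennreal_ofReal
  -- Testing with indicators says that the image of `d dP` under `T` is `κ dη`.
  have hmap : (P.withDensity fun p => ENNReal.ofReal (d p)).map T = volume.withDensity κ := by
    ext s hs
    rw [Measure.map_apply hT hs, withDensity_apply _ (hT hs), withDensity_apply _ hs,
      ← lintegral_indicator (hT hs), ← lintegral_indicator hs]
    have := h (s.indicator 1) (measurable_one.indicator hs)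
    have e1 : ∀ p, ENNReal.ofReal (d p) * s.indicator 1 (T p) =
        (T ⁻¹' s).indicator (fun p => ENNReal.ofReal (d p)) p := by
      intro p
      by_cases hp : T p ∈ s
      · rw [Set.indicator_of_mem hp, Set.indicator_of_mem (by exact hp)]; simp
      · rw [Set.indicator_of_notMem hp, Set.indicator_of_notMem (by exact hp)]; simp
    have e2 : ∀ η, κ η * s.indicator 1 η = s.indicator κ η := by
      intro η
      by_cases hp : η ∈ s
      · rw [Set.indicator_of_mem hp, Set.indicator_of_mem hp]; simp
      · rw [Set.indicator_of_notMem hp, Set.indicator_of_notMem hp]; simp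
    simp_rw [e1, e2] at this
    exact this
  have hfinm : IsFiniteMeasure ((volume : Measure R3).withDensity κ) :=
    isFiniteMeasure_withDensity hκf.ne
  -- Composition with `T` is therefore insensitive to the values of `f` on a null set.
  have hac : (volume : Measure R3).withDensity κ ≪ volume := withDensity_absolutelyContinuous _ _
  have hfint : Integrable f ((volume : Measure R3).withDensity κ) := by
    refine Integrable.of_bound (hf.1.mono_ac hac) (eLpNorm f ⊤ volume).toReal (hac.ae_le ?_)
    have hb := hf.2
    rw [eLpNorm_exponent_top] at hb ⊢
    filter_upwards [ae_le_eLpNormEssSup (f := f) (μ := volume)] with η hη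
    have := ENNReal.toReal_mono hb.ne hη
    simpa using this
  have hκt : ∀ᵐ η, κ η < ∞ := ae_lt_top hκ hκf.ne
  have hdt : ∀ᵐ p ∂P, ENNReal.ofReal (d p) < ∞ :=
    Filter.Eventually.of_forall fun _ => ENNReal.ofReal_lt_top
  have i1 := hfint
  rw [← hmap, integrable_map_measure (hmap ▸ hfint.1) hT.aemeasurable,
    integrable_withDensity_iff_integrable_smul' hdm hdt] at i1
  have i2 := hfint
  rw [integrable_withDensity_iff_integrable_smul' hκ hκt] at i2
  have e : ∫ η, f η ∂((volume : Measure R3).withDensity κ) =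
      ∫ p, f (T p) ∂(P.withDensity fun p => ENNReal.ofReal (d p)) := by
    rw [← hmap, integral_map hT.aemeasurable (hmap ▸ hfint.1)]
  rw [integral_withDensity_eq_integral_toReal_smul hκ hκt,
    integral_withDensity_eq_integral_toReal_smul hdm hdt] at e
  simp only [Function.comp_apply, smul_eq_mul, ENNReal.toReal_ofReal (hd0 _)] at i1 i2 e
  exact ⟨i1, i2, e.symm⟩

/-- The angular function as a function of `cos ϑ`, set to zero at `ϑ = π / 2`. -/
noncomputable def angular (b : ℝ → ℝ) (c : ℝ) : ℝ := if 0 < c then b (Real.arccos c) else 0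

/-- The angular weight obtained from `angular b` by exchanging the two components of the relative
velocity. -/
noncomputable def angularSwap (b : ℝ → ℝ) (c : ℝ) : ℝ :=
  angular b (Real.sqrt (1 - c ^ 2)) * (c / Real.sqrt (1 - c ^ 2))

lemma isCutoffWeight_angular {Cb : ℝ} (hCb : 0 < Cb) {b : ℝ → ℝ} (hb : GradCutoff Cb b) :
    IsCutoffWeight Cb (angular b) := by
  have hrange : ∀ c : ℝ, 0 < c → Real.arccos c < Real.pi / 2 := fun c hc =>
    Real.arccos_lt_pi_div_two.2 hc
  refine ⟨?_, fun c _ => ?_, fun c hc => ?_⟩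
  · exact Measurable.ite measurableSet_Ioi (hb.measurable.comp Real.continuous_arccos.measurable)
      measurable_const
  · unfold angular
    split_ifs with h
    · exact (hb.pos _ (Real.arccos_nonneg c) (hrange c h)).le
    · exact le_rfl
  · unfold angular
    split_ifs with h
    · refine (hb.le_cos _ (Real.arccos_nonneg c) (hrange c h)).trans ?_
      gcongr
      rcases le_total c 1 with h1 | h1
      · rw [Real.cos_arccos (by linarith) h1]
      · rw [Real.arccos_of_one_le h1, Real.cos_zero]; exact h1
    · positivity

lemma angular_zero (b : ℝ → ℝ) : angular b 0 = 0 := by simp [angular]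

/-- The cutoff yields a factor `√(1 - c²)` that cancels the denominator, leaving `C_b c`. Where the
root vanishes, the value `angular b 0 = 0` applies. -/
lemma isCutoffWeight_angularSwap {Cb : ℝ} (hCb : 0 < Cb) {b : ℝ → ℝ} (hb : GradCutoff Cb b) :
    IsCutoffWeight Cb (angularSwap b) := by
  have h := isCutoffWeight_angular hCb hb
  have hm := h.measurable
  refine ⟨by unfold angularSwap; fun_prop, fun c hc => ?_, fun c hc => ?_⟩
  · exact mul_nonneg (h.nonneg _ (Real.sqrt_nonneg _)) (by positivity)
  · unfold angularSwap
    rcases (Real.sqrt_nonneg (1 - c ^ 2)).eq_or_lt with h0 | h0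
    · rw [← h0, angular_zero, zero_mul]; positivity
    · calc _ ≤ Cb * Real.sqrt (1 - c ^ 2) * (c / Real.sqrt (1 - c ^ 2)) := by
            gcongr; exact h.le _ h0.le
        _ = _ := by field_simp

lemma lintegral_prod_shift (v : R3) {Φ : R3 × S2 → ℝ≥0∞} (hΦ : Measurable Φ) :
    ∫⁻ p, Φ p ∂((volume : Measure R3).prod surfaceMeasure) =
      ∫⁻ ω : S2, (∫⁻ z, Φ (v + z, ω)) ∂surfaceMeasure := by
  rw [lintegral_prod_symm' _ hΦ]
  refine lintegral_congr fun ω => ?_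
  rw [lintegral_add_left_eq_self (μ := (volume : Measure R3)) (fun u => Φ (u, ω)) v]

/-- For almost every `(u, ω)` the relative velocity is not orthogonal to `ω`. -/
lemma ae_inner_ne_zero (v : R3) : ∀ᵐ p ∂((volume : Measure R3).prod surfaceMeasure),
    inner ℝ (v - p.1) (p.2 : R3) ≠ 0 := by
  have hs : MeasurableSet {p : R3 × S2 | inner ℝ (v - p.1) (p.2 : R3) = 0} :=
    measurableSet_eq_fun (by fun_prop) measurable_const
  rw [ae_iff]
  simp only [ne_eq, not_not]
  rw [← lintegral_indicator_one hs,
    lintegral_prod_shift v ((measurable_one.indicator hs)), lintegral_eq_zero_iff']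
  · refine Filter.Eventually.of_forall fun ω => ?_
    have hω : ‖(ω : R3)‖ = 1 := by simp
    have e : ∀ z : R3, Set.indicator {p : R3 × S2 | inner ℝ (v - p.1) (p.2 : R3) = 0}
        (1 : R3 × S2 → ℝ≥0∞) (v + z, ω) =
        Set.indicator {(0 : ℝ)} (1 : ℝ → ℝ≥0∞) (inner ℝ z (ω : R3)) := by
      intro z
      simp only [Set.indicator_apply]
      simp
    have hm1 : Measurable (Set.indicator {(0 : ℝ)} (1 : ℝ → ℝ≥0∞)) :=
      measurable_one.indicator (measurableSet_singleton 0)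
    simp_rw [e]
    rw [lintegral_split hω (G := fun s _ => Set.indicator {(0 : ℝ)} (1 : ℝ → ℝ≥0∞) s)
      (hm1.comp measurable_fst)]
    rw [Pi.zero_apply, lintegral_eq_zero_iff' (Measurable.aemeasurable (by fun_prop))]
    have h0 : ∀ᵐ s : ℝ, s ≠ 0 := by simp [ae_iff]
    filter_upwards [h0] with s hs
    rw [Set.indicator_of_notMem (by simpa using hs)]; simp
  · refine Measurable.aemeasurable ?_
    have := (measurable_one.indicator hs : Measurable (Set.indicator
      {p : R3 × S2 | inner ℝ (v - p.1) (p.2 : R3) = 0} (1 : R3 × S2 → ℝ≥0∞))).comp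
      (by fun_prop : Measurable fun q : S2 × R3 => (v + q.2, q.1))
    exact this.lintegral_prod_right'

/-- The cross section, set to zero where the relative velocity is orthogonal to `ω`. -/
noncomputable def reducedCross (γ : ℝ) (b : ℝ → ℝ) (v : R3) (p : R3 × S2) : ℝ :=
  ‖v - p.1‖ ^ γ * angular b (|inner ℝ (v - p.1) (p.2 : R3)| / ‖v - p.1‖)

lemma crossSection_eq (γ : ℝ) (b : ℝ → ℝ) {v : R3} {p : R3 × S2}
    (hp : inner ℝ (v - p.1) (p.2 : R3) ≠ 0) :
    crossSection γ b v p.1 p.2 = reducedCross γ b v p := by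
  have h : 0 < ‖v - p.1‖ := by
    rw [norm_pos_iff]; intro h; rw [h] at hp; simp at hp
  rw [crossSection, reducedCross, angular, if_pos (by positivity), collisionAngle]

variable {γ Cb : ℝ} {b : ℝ → ℝ}

lemma measurable_reducedCross (hCb : 0 < Cb) (hb : GradCutoff Cb b) (v : R3) :
    Measurable (reducedCross γ b v) := by
  have := (isCutoffWeight_angular hCb hb).measurable
  unfold reducedCross; fun_prop

lemma reducedCross_nonneg (hCb : 0 < Cb) (hb : GradCutoff Cb b) (v : R3) (p : R3 × S2) :
    0 ≤ reducedCross γ b v p :=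
  mul_nonneg (by positivity) ((isCutoffWeight_angular hCb hb).nonneg _ (by positivity))

@[fun_prop]
lemma measurable_vPost (v : R3) : Measurable fun p : R3 × S2 => vPost v p.1 p.2 := by
  unfold vPost; fun_prop

@[fun_prop]
lemma measurable_uPost (v : R3) : Measurable fun p : R3 × S2 => uPost v p.1 p.2 := by
  unfold uPost; fun_prop

lemma vPost_add (v z : R3) (ω : S2) :
    vPost v (v + z) ω = v + inner ℝ z (ω : R3) • (ω : R3) := by
  simp [vPost, inner_neg_left]

lemma uPost_add (v z : R3) (ω : S2) : uPost v (v + z) ω = v + perp ω z := by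
  simp only [uPost, perp, sub_add_cancel_left, inner_neg_left, neg_smul]
  abel

lemma reducedCross_add (v z : R3) (ω : S2) :
    reducedCross γ b v (v + z, ω) = ‖z‖ ^ γ * angular b (|inner ℝ z (ω : R3)| / ‖z‖) := by
  simp [reducedCross, inner_neg_left]

/-- The total angular mass. -/
noncomputable def angularMass (b : ℝ → ℝ) : ℝ≥0∞ :=
  ∫⁻ ω : S2, ENNReal.ofReal (angular b |inner ℝ (EuclideanSpace.single 0 1 : R3) (ω : R3)|)
    ∂surfaceMeasure

/-- The `+ 1` keeps the bound strictly positive, as `exists_isHolderKernel_loss` requires. -/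
lemma angularMass_le (hCb : 0 < Cb) (hb : GradCutoff Cb b) :
    angularMass b ≤ ENNReal.ofReal (Cb * (surfaceMeasure Set.univ).toReal + 1) := by
  calc angularMass b ≤ ∫⁻ ω : S2, ENNReal.ofReal Cb ∂surfaceMeasure := by
        refine lintegral_mono fun ω => ENNReal.ofReal_le_ofReal ?_
        refine ((isCutoffWeight_angular hCb hb).le _ (abs_nonneg _)).trans ?_
        have := abs_real_inner_le_norm (EuclideanSpace.single 0 1 : R3) (ω : R3)
        have h2 : ‖(EuclideanSpace.single 0 1 : R3)‖ * ‖(ω : R3)‖ = 1 := by simp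
        rw [h2] at this
        exact mul_le_of_le_one_right hCb.le this
    _ = ENNReal.ofReal (Cb * (surfaceMeasure Set.univ).toReal) := by
        rw [lintegral_const, ENNReal.ofReal_mul hCb.le, ENNReal.ofReal_toReal (measure_ne_top _ _)]
    _ ≤ _ := ENNReal.ofReal_le_ofReal (by linarith)

/-- By rotation invariance the `ω`-integral of `b` does not depend on the direction of `v - u`. -/
lemma lintegral_loss_eq (hCb : 0 < Cb) (hb : GradCutoff Cb b) (v : R3) {G : R3 → ℝ≥0∞}
    (hG : Measurable G) :
    ∫⁻ p, ENNReal.ofReal (reducedCross γ b v p * (sqrtM v * sqrtM p.1)) * G p.1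
      ∂((volume : Measure R3).prod surfaceMeasure) =
    ∫⁻ η, lossKernel γ (angularMass b) v η * G η := by
  have hs := measurable_reducedCross (γ := γ) hCb hb v
  have ha := (isCutoffWeight_angular hCb hb).measurable
  rw [lintegral_prod _ (by fun_prop)]
  refine lintegral_congr_ae ?_
  have hne : ∀ᵐ η : R3, η ≠ v := by simp [ae_iff]
  filter_upwards [hne] with η hη
  have hp : v - η ≠ 0 := sub_ne_zero.2 hη.symm
  have e : ∀ ω : S2, ENNReal.ofReal (reducedCross γ b v (η, ω) * (sqrtM v * sqrtM η)) * G η =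
      ENNReal.ofReal (‖η - v‖ ^ γ * (sqrtM v * sqrtM η)) * G η *
        ENNReal.ofReal (angular b |inner ℝ (dir (v - η)) (ω : R3)|) := by
    intro ω
    have e1 : |inner ℝ (v - η) (ω : R3)| / ‖v - η‖ = |inner ℝ (dir (v - η)) (ω : R3)| := by
      rw [dir, real_inner_smul_left, abs_mul, abs_of_nonneg (inv_nonneg.2 (norm_nonneg _)),
        div_eq_inv_mul]
    rw [reducedCross, e1, norm_sub_rev, mul_right_comm, ENNReal.ofReal_mul]
    · ring
    · have := sqrtM_nonneg v
      have := sqrtM_nonneg η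
      positivity
  simp_rw [e]
  rw [lintegral_const_mul _ (by fun_prop), lintegral_sphere_inner_eq
    (q := fun r => ENNReal.ofReal (angular b |r|)) (by fun_prop)
    (c := (EuclideanSpace.single 0 1 : R3)) (by rw [norm_dir hp]; simp), lossKernel, angularMass]
  ring

lemma lintegral_gain_vPost_eq (hCb : 0 < Cb) (hb : GradCutoff Cb b) (v : R3) {G : R3 → ℝ≥0∞}
    (hG : Measurable G) :
    ∫⁻ p, ENNReal.ofReal (reducedCross γ b v p * (sqrtM p.1 * sqrtM (uPost v p.1 p.2))) *
      G (vPost v p.1 p.2) ∂((volume : Measure R3).prod surfaceMeasure) =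
    ∫⁻ η, gainKernel γ (angular b) v η * G η := by
  have hs := measurable_reducedCross (γ := γ) hCb hb v
  rw [lintegral_prod_shift v (by fun_prop),
    ← lintegral_gain_eq γ (isCutoffWeight_angular hCb hb).measurable v hG]
  refine lintegral_congr fun ω => lintegral_congr fun z => ?_
  simp only
  rw [vPost_add, uPost_add, reducedCross_add, gainDensity, smul_add_perp, add_assoc, smul_add_perp,
    norm_smul]
  simp

/-- Here `η = v + W`, so the two components of `z` must be exchanged. The swap identity carries a
weight `|z · ω|`, hence the division by `|W|` in the test function; after the swap the ratio `|V| /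
|W|` is the factor `c / √(1 - c²)` of `angularSwap`. -/
lemma lintegral_gain_uPost_eq (hCb : 0 < Cb) (hb : GradCutoff Cb b) (v : R3) {G : R3 → ℝ≥0∞}
    (hG : Measurable G) :
    ∫⁻ p, ENNReal.ofReal (reducedCross γ b v p * (sqrtM p.1 * sqrtM (vPost v p.1 p.2))) *
      G (uPost v p.1 p.2) ∂((volume : Measure R3).prod surfaceMeasure) =
    ∫⁻ η, gainKernel γ (angularSwap b) v η * G η := by
  have hs := measurable_reducedCross (γ := γ) hCb hb v
  have ha := (isCutoffWeight_angular hCb hb).measurable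
  rw [lintegral_prod_shift v (by fun_prop),
    ← lintegral_gain_eq γ (isCutoffWeight_angularSwap hCb hb).measurable v hG]
  have hF : Measurable (Function.uncurry fun V W : R3 =>
      ENNReal.ofReal (‖V + W‖ ^ γ * (angular b (‖W‖ / ‖V + W‖) / ‖W‖) *
        (sqrtM (v + (V + W)) * sqrtM (v + W))) * G (v + V)) := by
    simp only [Function.uncurry_def]; fun_prop
  have hswap := lintegral_inner_mul_swap hF
  have hnV : ∀ (z : R3) (ω : S2), ‖inner ℝ z (ω : R3) • (ω : R3)‖ = |inner ℝ z (ω : R3)| := by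
    intro z ω; rw [norm_smul]; simp
  convert hswap using 1
  · refine lintegral_congr fun ω => lintegral_congr fun z => ?_
    simp only
    rw [vPost_add, uPost_add, reducedCross_add, ← mul_assoc (ENNReal.ofReal |_|),
      ← ENNReal.ofReal_mul (abs_nonneg _), add_comm (perp _ z), smul_add_perp, hnV]
    congr 2
    rcases eq_or_ne (inner ℝ z (ω : R3)) 0 with h0 | h0
    · rw [h0]; simp [angular_zero]
    · have : 0 < |inner ℝ z (ω : R3)| := abs_pos.2 h0
      field_simp
  · refine lintegral_congr fun ω => lintegral_congr fun z => ?_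
    have hω : ‖(ω : R3)‖ = 1 := by simp
    rw [← mul_assoc, ← ENNReal.ofReal_mul (abs_nonneg _), gainDensity, add_assoc v, smul_add_perp,
      hnV]
    congr 2
    rcases eq_or_ne z 0 with hz | hz
    · subst hz; simp [angularSwap]
    · have hzp : 0 < ‖z‖ := norm_pos_iff.2 hz
      have hsq : Real.sqrt (1 - (|inner ℝ z (ω : R3)| / ‖z‖) ^ 2) = ‖perp ω z‖ / ‖z‖ := by
        rw [← Real.sqrt_sq (by positivity : 0 ≤ ‖perp (ω : R3) z‖ / ‖z‖)]
        congr 1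
        rw [div_pow, div_pow, sq_abs]
        field_simp
        linarith [norm_sq_eq_perp hω z]
      rw [angularSwap, hsq, div_div_div_cancel_right₀ hzp.ne']
      ring

/-- The integral kernel of `K`. -/
noncomputable def kernelK (γ : ℝ) (b : ℝ → ℝ) (v η : R3) : ℝ :=
  -(lossKernel γ (angularMass b) v η).toReal +
    ((gainKernel γ (angularSwap b) v η).toReal + (gainKernel γ (angular b) v η).toReal)

/-- The value `b(π/2)` is unconstrained, but it is seen only on a null set. -/
lemma K1Integrand_ae_eq (f : R3 → ℝ) (v : R3) :
    K1Integrand γ b f v =ᵐ[(volume : Measure R3).prod surfaceMeasure]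
      fun p => reducedCross γ b v p * (sqrtM v * sqrtM p.1) * f p.1 := by
  filter_upwards [ae_inner_ne_zero v] with p hp
  rw [K1Integrand, crossSection_eq γ b hp]; ring

lemma K2Integrand_ae_eq (f : R3 → ℝ) (v : R3) :
    K2Integrand γ b f v =ᵐ[(volume : Measure R3).prod surfaceMeasure] fun p =>
      reducedCross γ b v p * (sqrtM p.1 * sqrtM (vPost v p.1 p.2)) * f (uPost v p.1 p.2) +
      reducedCross γ b v p * (sqrtM p.1 * sqrtM (uPost v p.1 p.2)) * f (vPost v p.1 p.2) := by
  filter_upwards [ae_inner_ne_zero v] with p hp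
  rw [K2Integrand, crossSection_eq γ b hp]; ring

lemma K_repr {α Cl Cg : ℝ} (hCb : 0 < Cb) (hb : GradCutoff Cb b)
    (hl : IsHolderKernel γ α Cl (lossKernel γ (angularMass b)))
    (hg : IsHolderKernel γ α Cg (gainKernel γ (angular b)))
    (hg' : IsHolderKernel γ α Cg (gainKernel γ (angularSwap b)))
    {f : R3 → ℝ} (hf : MemLp f ⊤ volume) (v : R3) :
    (Integrable (K1Integrand γ b f v) ((volume : Measure R3).prod surfaceMeasure) ∧
      Integrable (K2Integrand γ b f v) ((volume : Measure R3).prod surfaceMeasure)) ∧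
    K γ b f v = ∫ η, kernelK γ b v η * f η := by
  have hs := measurable_reducedCross (γ := γ) hCb hb v
  have hs0 := reducedCross_nonneg (γ := γ) hCb hb v
  obtain ⟨i1, j1, e1⟩ := integral_eq_of_lintegral_eq
    (d := fun p : R3 × S2 => reducedCross γ b v p * (sqrtM v * sqrtM p.1)) (by fun_prop)
    (fun p => mul_nonneg (hs0 p) (mul_nonneg (sqrtM_nonneg _) (sqrtM_nonneg _)))
    (T := fun p => p.1) measurable_fst (hl.measurable v) (hl.finite v)
    (fun G hG => lintegral_loss_eq hCb hb v hG) hf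
  obtain ⟨i2, j2, e2⟩ := integral_eq_of_lintegral_eq
    (d := fun p : R3 × S2 => reducedCross γ b v p * (sqrtM p.1 * sqrtM (vPost v p.1 p.2)))
    (by fun_prop)
    (fun p => mul_nonneg (hs0 p) (mul_nonneg (sqrtM_nonneg _) (sqrtM_nonneg _)))
    (T := fun p => uPost v p.1 p.2) (by fun_prop) (hg'.measurable v) (hg'.finite v)
    (fun G hG => lintegral_gain_uPost_eq hCb hb v hG) hf
  obtain ⟨i3, j3, e3⟩ := integral_eq_of_lintegral_eq
    (d := fun p : R3 × S2 => reducedCross γ b v p * (sqrtM p.1 * sqrtM (uPost v p.1 p.2)))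
    (by fun_prop)
    (fun p => mul_nonneg (hs0 p) (mul_nonneg (sqrtM_nonneg _) (sqrtM_nonneg _)))
    (T := fun p => vPost v p.1 p.2) (by fun_prop) (hg.measurable v) (hg.finite v)
    (fun G hG => lintegral_gain_vPost_eq hCb hb v hG) hf
  refine ⟨⟨i1.congr (K1Integrand_ae_eq f v).symm, (i2.add i3).congr (K2Integrand_ae_eq f v).symm⟩,
    ?_⟩
  have s1 : Integrable fun η => -((lossKernel γ (angularMass b) v η).toReal * f η) := j1.neg
  have s2 : Integrable fun η => (gainKernel γ (angularSwap b) v η).toReal * f η +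
      (gainKernel γ (angular b) v η).toReal * f η := j2.add j3
  rw [K, K1, K2, integral_congr_ae (K1Integrand_ae_eq f v), integral_congr_ae
    (K2Integrand_ae_eq f v), integral_add i2 i3, e1, e2, e3, ← integral_add j2 j3, ← integral_neg,
    ← integral_add s1 s2]
  refine integral_congr_ae (Filter.Eventually.of_forall fun η => ?_)
  simp only [kernelK]
  ring

/-! ### Uniqueness of the kernel and the final estimates -/

lemma IsHolderKernel.integrable {α C : ℝ} {κ : R3 → R3 → ℝ≥0∞} (h : IsHolderKernel γ α C κ)
    (v : R3) : Integrable fun η => (κ v η).toReal :=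
  integrable_toReal_of_lintegral_ne_top (h.measurable v).aemeasurable (h.finite v).ne

lemma IsHolderKernel.integral_abs_sub_le {α C : ℝ} (hC : 0 ≤ C) {κ : R3 → R3 → ℝ≥0∞}
    (h : IsHolderKernel γ α C κ) (v₁ v₂ : R3) :
    ∫ η, |(κ v₁ η).toReal - (κ v₂ η).toReal| ≤
      C * ‖v₁ - v₂‖ ^ α * max (bracket v₁ (γ - 1)) (bracket v₂ (γ - 1)) := by
  have hi : Integrable fun η => |(κ v₁ η).toReal - (κ v₂ η).toReal| :=
    ((h.integrable v₁).sub (h.integrable v₂)).abs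
  have hb : 0 ≤ max (bracket v₁ (γ - 1)) (bracket v₂ (γ - 1)) :=
    le_max_of_le_left (bracket_pos _ _).le
  have := h.holder v₁ v₂
  rw [← ofReal_integral_eq_lintegral_ofReal hi (Filter.Eventually.of_forall fun _ => abs_nonneg _)]
    at this
  exact (ENNReal.ofReal_le_ofReal_iff (by positivity)).1 this

/-- Two kernels of the same operator agree almost everywhere. -/
lemma IsKernelOf.ae_eq {T : (R3 → ℝ) → R3 → ℝ} {k k' : R3 → R3 → ℝ} (h : IsKernelOf T k)
    (h' : IsKernelOf T k') (v : R3) : k v =ᵐ[volume] k' v := by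
  refine Integrable.ae_eq_of_forall_setIntegral_eq _ _ (h.integrable v) (h'.integrable v)
    fun s hs hsf => ?_
  have hf : MemLp (s.indicator fun _ => (1 : ℝ)) ⊤ (volume : Measure R3) :=
    memLp_indicator_const ⊤ hs 1 (Or.inr hsf.ne)
  have e := (h.repr _ hf v).symm.trans (h'.repr _ hf v)
  have e1 : ∀ g : R3 → ℝ, ∫ η, g η * s.indicator (fun _ => (1 : ℝ)) η = ∫ η in s, g η := by
    intro g
    rw [← integral_indicator hs]
    refine integral_congr_ae (Filter.Eventually.of_forall fun η => ?_)
    by_cases hη : η ∈ s <;> simp [hη]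
  rwa [e1, e1] at e

lemma IsKernelOf.abs_sub_le {T : (R3 → ℝ) → R3 → ℝ} {k : R3 → R3 → ℝ} (h : IsKernelOf T k)
    {f : R3 → ℝ} (hf : AEStronglyMeasurable f volume) {N : ℝ} (hN : ∀ᵐ η, |f η| ≤ N)
    (v₁ v₂ : R3) : |T f v₁ - T f v₂| ≤ N * ∫ η, |k v₁ η - k v₂ η| := by
  have hfm : MemLp f ⊤ (volume : Measure R3) :=
    memLp_top_of_bound hf N (by simpa [Real.norm_eq_abs] using hN)
  have hi : ∀ v, Integrable fun η => k v η * f η := fun v => by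
    have := (h.integrable v).bdd_mul (f := f) (c := N) hf
      (by simpa [Real.norm_eq_abs] using hN)
    simpa [mul_comm] using this
  rw [h.repr f hfm, h.repr f hfm, ← integral_sub (hi v₁) (hi v₂), ← integral_const_mul]
  refine (abs_integral_le_integral_abs).trans ?_
  refine integral_mono_ae ((hi v₁).sub (hi v₂)).abs
    ((((h.integrable v₁).sub (h.integrable v₂)).abs).const_mul N) ?_
  filter_upwards [hN] with η hη
  rw [← sub_mul, abs_mul, mul_comm]
  gcongr

end Boltzmann

open Boltzmann

theorem lemma2p2 (γ : ℝ) (hγ : -3 < γ) (hγ' : γ < 0) (α : ℝ)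
    (hα : Boltzmann.IsHolderExponent γ α) (Cb : ℝ) (hCb : 0 < Cb) :
    ∃ C : ℝ, 0 < C ∧ ∀ b : ℝ → ℝ, Boltzmann.GradCutoff Cb b →
      -- the integrals defining `K` converge, and `K` has a kernel
      (∀ f : Boltzmann.R3 → ℝ, MemLp f ⊤ volume → ∀ v : Boltzmann.R3,
        Integrable (Boltzmann.K1Integrand γ b f v)
          ((volume : Measure Boltzmann.R3).prod Boltzmann.surfaceMeasure) ∧
        Integrable (Boltzmann.K2Integrand γ b f v)
          ((volume : Measure Boltzmann.R3).prod Boltzmann.surfaceMeasure)) ∧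
      (∃ k : Boltzmann.R3 → Boltzmann.R3 → ℝ, Boltzmann.IsKernelOf (Boltzmann.K γ b) k) ∧
      -- the estimate for the kernel
      (∀ k : Boltzmann.R3 → Boltzmann.R3 → ℝ, Boltzmann.IsKernelOf (Boltzmann.K γ b) k →
        ∀ v₁ v₂ : Boltzmann.R3,
          ∫ η, |k v₁ η - k v₂ η| ≤
            C * ‖v₁ - v₂‖ ^ α *
              max (Boltzmann.bracket v₁ (γ - 1)) (Boltzmann.bracket v₂ (γ - 1))) ∧
      -- the estimate for `K f`: it holds for almost every `x`, and at every single `x` at which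
      -- the slice `f (x, ·)` is measurable and essentially bounded by the norm of `f`
      (∀ Ω : Set Boltzmann.R3, MeasurableSet Ω →
        ∀ f : Boltzmann.R3 × Boltzmann.R3 → ℝ,
          MemLp f ⊤ ((volume : Measure (Boltzmann.R3 × Boltzmann.R3)).restrict
            (Ω ×ˢ Set.univ)) →
          (∀ᵐ x ∂((volume : Measure Boltzmann.R3).restrict Ω), ∀ v₁ v₂ : Boltzmann.R3,
            |Boltzmann.K γ b (fun η => f (x, η)) v₁ - Boltzmann.K γ b (fun η => f (x, η)) v₂| ≤
              C * Boltzmann.normInfty Ω f * ‖v₁ - v₂‖ ^ α *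
                max (Boltzmann.bracket v₁ (γ - 1)) (Boltzmann.bracket v₂ (γ - 1))) ∧
          (∀ x ∈ Ω, AEStronglyMeasurable (fun η => f (x, η)) volume →
            (∀ᵐ η ∂(volume : Measure Boltzmann.R3), |f (x, η)| ≤ Boltzmann.normInfty Ω f) →
            ∀ v₁ v₂ : Boltzmann.R3,
              |Boltzmann.K γ b (fun η => f (x, η)) v₁ -
                  Boltzmann.K γ b (fun η => f (x, η)) v₂| ≤
                C * Boltzmann.normInfty Ω f * ‖v₁ - v₂‖ ^ α *
                  max (Boltzmann.bracket v₁ (γ - 1)) (Boltzmann.bracket v₂ (γ - 1)))) := by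
  obtain ⟨Cg, hCg, hgain⟩ := exists_isHolderKernel_gain hγ hγ' hα hCb
  obtain ⟨Cl, hCl, hloss⟩ := exists_isHolderKernel_loss hγ hγ' hα
    (Cb * (surfaceMeasure Set.univ).toReal + 1) (by positivity)
  -- One loss kernel and two gain kernels; both gain weights obey the same cutoff, so they share
  -- `Cg`.
  refine ⟨Cl + (Cg + Cg), by positivity, fun b hb => ?_⟩
  have hl := hloss _ (angularMass_le hCb hb)
  have hg := hgain _ (isCutoffWeight_angular hCb hb)
  have hg' := hgain _ (isCutoffWeight_angularSwap hCb hb)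
  have hker : IsKernelOf (K γ b) (kernelK γ b) :=
    ⟨fun v => (hl.integrable v).neg.add ((hg'.integrable v).add (hg.integrable v)),
      fun f hf v => (K_repr hCb hb hl hg hg' hf v).2⟩
  have hbound : ∀ v₁ v₂ : R3, ∫ η, |kernelK γ b v₁ η - kernelK γ b v₂ η| ≤
      (Cl + (Cg + Cg)) * ‖v₁ - v₂‖ ^ α * max (bracket v₁ (γ - 1)) (bracket v₂ (γ - 1)) := by
    intro v₁ v₂
    have i1 := ((hl.integrable v₁).sub (hl.integrable v₂)).abs
    have i2 := ((hg'.integrable v₁).sub (hg'.integrable v₂)).abs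
    have i3 := ((hg.integrable v₁).sub (hg.integrable v₂)).abs
    have b1 := hl.integral_abs_sub_le hCl.le v₁ v₂
    have b2 := hg'.integral_abs_sub_le hCg.le v₁ v₂
    have b3 := hg.integral_abs_sub_le hCg.le v₁ v₂
    have hmono := integral_mono (((hker.integrable v₁).sub (hker.integrable v₂)).abs)
      (i1.add (i2.add i3)) (fun η => by
        simp only [Pi.sub_apply, Pi.add_apply, kernelK]
        refine le_trans (le_of_eq ?_) ((abs_add_le _ _).trans
          (add_le_add (abs_neg _).le (abs_add_le _ _)))
        congr 1; ring)
    refine hmono.trans ?_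
    rw [integral_add' i1 (i2.add i3), integral_add' i2 i3]
    calc _ ≤ _ := add_le_add b1 (add_le_add b2 b3)
      _ = _ := by ring
  -- Only the two slices at `v₁` and `v₂` matter, and each agrees almost everywhere with that of
  -- `kernelK`.
  have hall : ∀ k : R3 → R3 → ℝ, IsKernelOf (K γ b) k → ∀ v₁ v₂ : R3,
      ∫ η, |k v₁ η - k v₂ η| ≤
      (Cl + (Cg + Cg)) * ‖v₁ - v₂‖ ^ α * max (bracket v₁ (γ - 1)) (bracket v₂ (γ - 1)) := by
    intro k hk v₁ v₂
    refine le_trans (le_of_eq (integral_congr_ae ?_)) (hbound v₁ v₂)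
    filter_upwards [hk.ae_eq hker v₁, hk.ae_eq hker v₂] with η e₁ e₂
    rw [e₁, e₂]
  have hslice : ∀ (g : R3 → ℝ) (N : ℝ), 0 ≤ N → AEStronglyMeasurable g volume →
      (∀ᵐ η ∂(volume : Measure R3), |g η| ≤ N) → ∀ v₁ v₂ : R3,
      |K γ b g v₁ - K γ b g v₂| ≤ (Cl + (Cg + Cg)) * N * ‖v₁ - v₂‖ ^ α *
        max (bracket v₁ (γ - 1)) (bracket v₂ (γ - 1)) := by
    intro g N hN0 hg hN v₁ v₂
    refine (hker.abs_sub_le hg hN v₁ v₂).trans ?_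
    refine (mul_le_mul_of_nonneg_left (hbound v₁ v₂) hN0).trans (le_of_eq ?_)
    ring
  refine ⟨fun f hf v => (K_repr hCb hb hl hg hg' hf v).1, ⟨_, hker⟩, hall, fun Ω hΩ f hf => ?_⟩
  have hN0 : 0 ≤ normInfty Ω f := ENNReal.toReal_nonneg
  refine ⟨?_, fun x _ hx hxN => hslice _ _ hN0 hx hxN⟩
  have hprod : (volume : Measure (R3 × R3)).restrict (Ω ×ˢ Set.univ) =
      ((volume : Measure R3).restrict Ω).prod volume := by
    rw [Measure.volume_eq_prod, ← Measure.prod_restrict, Measure.restrict_univ]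
  have hbd : ∀ᵐ p ∂((volume : Measure R3).restrict Ω).prod (volume : Measure R3),
      |f p| ≤ normInfty Ω f := by
    rw [← hprod]
    have hfin := hf.2
    unfold normInfty
    rw [eLpNorm_exponent_top] at hfin ⊢
    filter_upwards [ae_le_eLpNormEssSup (f := f)] with p hp
    have := ENNReal.toReal_mono hfin.ne hp
    simpa using this
  have hm : AEStronglyMeasurable f (((volume : Measure R3).restrict Ω).prod volume) :=
    hprod ▸ hf.1
  -- By Fubini almost every `x` has a measurable slice bounded by the norm of `f`.
  filter_upwards [hm.prodMk_left, Measure.ae_ae_of_ae_prod hbd] with x hx hxN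
  exact hslice _ _ hN0 hx hxN
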